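/- **Conventions.** Let $G$ be a locally compact (Hausdorff) group with left Haar measure. $M(A)$ is the multiplier algebra of a $C^*$-algebra $A$. A homomorphism ($=$ $*$-homomorphism) $\varphi:A\to M(B)$ is *nondegenerate* if $\{\varphi(a)b\}$ spans a dense subspace of $B$; $\overline\varphi:M(A)\to M(B)$ is then its unique unital extension. Tensor products are spatial. $C^*(G)$ is the full group $C^*$-algebra, $k_G:G\to UM(C^*(G))$ the canonical map, and $\delta_G:C^*(G)\to M(C^*(G)\otimes C^*(G))$ the nondegenerate homomorphism with $\overline{\delta_G}(k_G(s))=k_G(s)\otimes k_G(s)$. A *full coaction* $(B,\delta)$ of $G$ is a $C^*$-algebra $B$ with an injective nondegenerate homomorphism $\delta:B\to M(B\otimes C^*(G))$ such that $\delta(b)(1\otimes z)\in B\otimes C^*(G)$ for $b\in B$, $z\in C^*(G)$, and $\overline{\delta\otimes\mathrm{id}}\circ\delta=\overline{\mathrm{id}\otimes\delta_G}\circ\delta$. A *morphism* $\varphi:(B,\delta)\to(C,\epsilon)$ is a nondegenerate homomorphism $\varphi:B\to M(C)$ with $\overline{\varphi\otimes\mathrm{id}}\circ\delta=\overline\epsilon\circ\varphi$;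 the composition of morphisms is $\theta\circ\varphi:=\overline\theta\circ\varphi$. Let $\lambda$ be the left regular representation of $G$ on $L^2(G)$, $\pi_\lambda:C^*(G)\to B(L^2(G))=M(\mathcal K(L^2(G)))$ its integrated form, and $M$ the representation of $C_0(G)$ on $L^2(G)$ by multiplication operators. Put $j_B:=\overline{\mathrm{id}\otimes\pi_\lambda}\circ\delta$ and $j_G:=1\otimes M$, with values in $M(B\otimes\mathcal K(L^2(G)))$. The *crossed product* $B\times_\delta G$ is the $C^*$-subalgebra of $M(B\otimes\mathcal K(L^2(G)))$ generated by $\{j_B(b)j_G(f):b\in B,\ f\in C_0(G)\}$; multiplication by $j_B(b)$ and by $j_G(f)$ gives multipliers of it. The coaction is *normal* if $j_B$ is injective. For a morphism $\varphi:(B,\delta)\to(D,\eta)$, $\varphi\times G:B\times_\delta G\to M(D\times_\eta G)$ denotes the unique nondegenerate homomorphism with $\overline{\varphi\times G}\circ j_B=\overline{j_D}\circ\varphi$ and $\overline{\varphi\times G}\circ j_G=j_G$. Finally $B^n:=B/\ker j_B$, $q^n:B\to B^n$ is the quotient map, and $\delta^n$ is the unique homomorphism $B^n\to M(B^n\otimes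 C^*(G))$ with $\delta^n\circ q^n=\overline{q^n\otimes\mathrm{id}}\circ\delta$. **Statement.** (1) Let $(B,\delta)$ be a full coaction of $G$, $(D,\eta)$ a normal full coaction of $G$, and $\varphi:(B,\delta)\to(D,\eta)$ a morphism. Suppose that for every morphism $\psi:(B,\delta)\to(C,\epsilon)$ to a normal coaction there is a unique morphism $\theta:(D,\eta)\to(C,\epsilon)$ with $\psi=\theta\circ\varphi$. Then $\varphi(B)=D$, and $\varphi\times G$ exists, is unique, and is an isomorphism of $B\times_\delta G$ onto $D\times_\eta G$. (2) For every full coaction $(B,\delta)$ of $G$, the homomorphism $\delta^n$ exists, is unique, and is a normal full coaction of $G$ on $B^n$; $q^n:(B,\delta)\to(B^n,\delta^n)$ is a morphism; and $q^n\times G$ exists, is unique, and is an isomorphism of $B\times_\delta G$ onto $B^n\times_{\delta^n}G$. -/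

import Mathlib

open scoped MultiplierAlgebra ENNReal TensorProduct ZeroAtInfty CompactlySupported
open MeasureTheory

set_option linter.unusedSectionVars false

universe u v w

noncomputable section

namespace Coact

section DiagonalOperators

variable {ι : Type*} {H : ι → Type*} [∀ i, NormedAddCommGroup (H i)]
  [∀ i, InnerProductSpace ℂ (H i)] [∀ i, CompleteSpace (H i)]

lemma memℓp_diag (T : lp (fun i => H i →L[ℂ] H i) ∞) (x : lp H 2) :
    Memℓp (fun i => T i (x i)) 2 := by
  have hx := lp.memℓp x
  have h : Memℓp (fun i => (‖T‖ : ℂ) • x i) 2 := hx.const_smul (‖T‖ : ℂ)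
  rw [memℓp_gen_iff (by norm_num)] at h ⊢
  refine h.of_nonneg_of_le (fun i => by positivity) (fun i => ?_)
  refine Real.rpow_le_rpow (norm_nonneg _) ?_ (by norm_num)
  rw [norm_smul]
  simpa using (T i).le_of_opNorm_le (lp.norm_apply_le_norm ENNReal.top_ne_zero T i) (x i)

lemma norm_diag_le (T : lp (fun i => H i →L[ℂ] H i) ∞) (x : lp H 2) :
    ‖(⟨fun i => T i (x i), memℓp_diag T x⟩ : lp H 2)‖ ≤ ‖T‖ * ‖x‖ := by
  have h : ‖(⟨fun i => T i (x i), memℓp_diag T x⟩ : lp H 2)‖ ≤ ‖(‖T‖ : ℂ) • x‖ := by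
    refine lp.norm_mono (by norm_num) (fun i => ?_)
    rw [lp.coeFn_smul, Pi.smul_apply, norm_smul]
    simpa using (T i).le_of_opNorm_le (lp.norm_apply_le_norm ENNReal.top_ne_zero T i) (x i)
  rwa [norm_smul, Complex.norm_real, norm_norm] at h

/-- A bounded family of operators `T i` acting diagonally on the Hilbert space direct sum. -/
def diag (T : lp (fun i => H i →L[ℂ] H i) ∞) : lp H 2 →L[ℂ] lp H 2 :=
  LinearMap.mkContinuous
    { toFun := fun x => ⟨fun i => T i (x i), memℓp_diag T x⟩
      map_add' := fun x y => by
        apply lp.ext; funext i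
        simp only [lp.coeFn_add, Pi.add_apply, map_add]
      map_smul' := fun c x => by
        apply lp.ext; funext i
        simp only [lp.coeFn_smul, Pi.smul_apply, map_smul, RingHom.id_apply] }
    ‖T‖ (norm_diag_le T)

lemma diag_apply (T : lp (fun i => H i →L[ℂ] H i) ∞) (x : lp H 2) (i : ι) :
    diag T x i = T i (x i) := rfl

end DiagonalOperators

section UniversalRepresentation

open scoped ComplexOrder

variable (A : Type u) [NonUnitalCStarAlgebra A]

/-- Positive linear functionals on `A` (for the usual order: `0 ≤ a` iff `a` is a finite sum of
elements `star x * x`). -/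
abbrev PosFunctional : Type u :=
  letI := CStarAlgebra.spectralOrder A
  A →ₚ[ℂ] ℂ

variable {A} in
/-- The GNS Hilbert space of a positive functional. -/
abbrev PosFunctional.Space (f : PosFunctional A) : Type u :=
  letI := CStarAlgebra.spectralOrder A
  haveI := CStarAlgebra.spectralOrderedRing A
  PositiveLinearMap.GNS f

variable {A} in
/-- The GNS representation of a positive functional. -/
def PosFunctional.rep (f : PosFunctional A) : A →⋆ₙₐ[ℂ] (f.Space →L[ℂ] f.Space) :=
  letI := CStarAlgebra.spectralOrder A
  haveI := CStarAlgebra.spectralOrderedRing A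
  PositiveLinearMap.gnsNonUnitalStarAlgHom f

/-- The Hilbert space of the universal representation of a `C*`-algebra: the direct sum of the
GNS spaces of all positive functionals. -/
def UnivSpace : Type u := lp (fun f : PosFunctional A => f.Space) 2

instance : NormedAddCommGroup (UnivSpace A) :=
  inferInstanceAs (NormedAddCommGroup (lp (fun f : PosFunctional A => f.Space) 2))
instance : InnerProductSpace ℂ (UnivSpace A) :=
  inferInstanceAs (InnerProductSpace ℂ (lp (fun f : PosFunctional A => f.Space) 2))
instance : CompleteSpace (UnivSpace A) :=
  inferInstanceAs (CompleteSpace (lp (fun f : PosFunctional A => f.Space) 2))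

variable {A}

/-- The universal representation: the direct sum of the GNS representations of all positive
functionals. -/
def univRep (a : A) : UnivSpace A →L[ℂ] UnivSpace A :=
  diag (H := fun f : PosFunctional A => f.Space)
    ⟨fun f => f.rep a, memℓp_infty ⟨‖a‖, by
      rintro _ ⟨f, rfl⟩
      exact NonUnitalStarAlgHom.norm_apply_le f.rep a⟩⟩

end UniversalRepresentation

section SpatialTensor

variable (A : Type u) (C : Type v) [NonUnitalCStarAlgebra A] [NonUnitalCStarAlgebra C]

/-- The Hilbert space tensor product of the universal Hilbert spaces of `A` and `C`. -/
def TensorSpace : Type (max u v) := UniformSpace.Completion (UnivSpace A ⊗[ℂ] UnivSpace C)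

instance : NormedAddCommGroup (TensorSpace A C) :=
  inferInstanceAs (NormedAddCommGroup (UniformSpace.Completion (UnivSpace A ⊗[ℂ] UnivSpace C)))
instance : InnerProductSpace ℂ (TensorSpace A C) :=
  inferInstanceAs (InnerProductSpace ℂ (UniformSpace.Completion (UnivSpace A ⊗[ℂ] UnivSpace C)))
instance : CompleteSpace (TensorSpace A C) :=
  inferInstanceAs (CompleteSpace (UniformSpace.Completion (UnivSpace A ⊗[ℂ] UnivSpace C)))

variable {A C} in
/-- The operator `π_A(a) ⊗ π_C(c)`. -/
def tensorOp (a : A) (c : C) : TensorSpace A C →L[ℂ] TensorSpace A C :=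
  (TensorProduct.mapL (univRep a) (univRep c)).completion

/-- The spatial tensor product of `A` and `C` as a concrete `C*`-algebra of operators: the
`C*`-algebra generated by the operators `π_A(a) ⊗ π_C(c)`. -/
def spatialTensor : NonUnitalStarSubalgebra ℂ (TensorSpace A C →L[ℂ] TensorSpace A C) :=
  (NonUnitalStarAlgebra.adjoin ℂ
    {T | ∃ (a : A) (c : C), T = tensorOp a c}).topologicalClosure

/-- The spatial tensor product `A ⊗ C`. -/
def SpatialTensor : Type (max u v) := spatialTensor A C

instance : NonUnitalCStarAlgebra (SpatialTensor A C) :=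
  haveI : IsClosed (spatialTensor A C : Set (TensorSpace A C →L[ℂ] TensorSpace A C)) :=
    NonUnitalStarSubalgebra.isClosed_topologicalClosure _
  NonUnitalStarSubalgebra.nonUnitalCStarAlgebra (spatialTensor A C)

variable {A C} in
/-- The elementary tensor `a ⊗ c`. -/
def tmul (a : A) (c : C) : SpatialTensor A C :=
  ⟨tensorOp a c, NonUnitalStarSubalgebra.le_topologicalClosure _
    (NonUnitalStarAlgebra.subset_adjoin ℂ _ ⟨a, c, rfl⟩)⟩

end SpatialTensor

section Multipliers

variable {A : Type u} {B : Type v} [NonUnitalCStarAlgebra A] [NonUnitalCStarAlgebra B]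

/-- A map `φ : A → M(B)` is nondegenerate if the elements `φ(a) b` span a dense subspace of `B`. -/
def Nondegenerate (φ : A → 𝓜(ℂ, B)) : Prop :=
  Dense (Submodule.span ℂ {x : B | ∃ a b, x = (φ a).fst b} : Set B)

/-- The extension `φ̄ : M(A) → M(B)` of a nondegenerate homomorphism `φ : A → M(B)`: the unital
`*`-homomorphism with `φ̄(a) = φ(a)` for `a ∈ A`, which exists and is unique for nondegenerate `φ`. -/
def bar (φ : A → 𝓜(ℂ, B)) : 𝓜(ℂ, A) →⋆ₙₐ[ℂ] 𝓜(ℂ, B) :=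
  Classical.epsilon fun Φ => Φ 1 = 1 ∧ ∀ a : A, Φ (a : 𝓜(ℂ, A)) = φ a

/-- The embedding of `A` in `M(A)`. -/
abbrev incl (A : Type u) [NonUnitalCStarAlgebra A] : A →⋆ₙₐ[ℂ] 𝓜(ℂ, A) :=
  DoubleCentralizer.coeHom

end Multipliers

section InducedMultipliers

variable {P : Type u} [NonUnitalCStarAlgebra P] (S : NonUnitalStarSubalgebra ℂ P)

/-- The multiplier `(x ↦ p x, x ↦ x p)` of a subalgebra `S` given by an element `p` of the ambient
algebra with `p S ⊆ S` and `S p ⊆ S`. -/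
def multiplierOfIdealizer (p : P) (hl : ∀ x ∈ S, p * x ∈ S) (hr : ∀ x ∈ S, x * p ∈ S) :
    𝓜(ℂ, S) where
  fst := LinearMap.mkContinuous
    { toFun := fun x => ⟨p * x, hl x x.2⟩
      map_add' := fun x y => Subtype.ext (mul_add p (x : P) y)
      map_smul' := fun c x => Subtype.ext (mul_smul_comm c p (x : P)) } ‖p‖
    fun x => norm_mul_le p (x : P)
  snd := LinearMap.mkContinuous
    { toFun := fun x => ⟨x * p, hr x x.2⟩
      map_add' := fun x y => Subtype.ext (add_mul (x : P) y p)
      map_smul' := fun c x => Subtype.ext (smul_mul_assoc c (x : P) p) } ‖p‖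
    fun x => (norm_mul_le (x : P) p).trans_eq (mul_comm _ _)
  central := fun x y => Subtype.ext (mul_assoc (x : P) p y)

/-- If multiplication by `p` and `star p` maps a generating set into the generated `C*`-algebra,
then `p` multiplies that algebra into itself. -/
lemma idealizes_of_generators {s : Set P} (p : P)
    (h : ∀ x ∈ s, p * x ∈ (NonUnitalStarAlgebra.adjoin ℂ s).topologicalClosure ∧
      x * p ∈ (NonUnitalStarAlgebra.adjoin ℂ s).topologicalClosure ∧
      star p * x ∈ (NonUnitalStarAlgebra.adjoin ℂ s).topologicalClosure ∧
      x * star p ∈ (NonUnitalStarAlgebra.adjoin ℂ s).topologicalClosure)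
    {x : P} (hx : x ∈ (NonUnitalStarAlgebra.adjoin ℂ s).topologicalClosure) :
    p * x ∈ (NonUnitalStarAlgebra.adjoin ℂ s).topologicalClosure ∧
      x * p ∈ (NonUnitalStarAlgebra.adjoin ℂ s).topologicalClosure := by
  set T := (NonUnitalStarAlgebra.adjoin ℂ s).topologicalClosure with hT
  have hcl : IsClosed (T : Set P) := NonUnitalStarSubalgebra.isClosed_topologicalClosure _
  have hle : NonUnitalStarAlgebra.adjoin ℂ s ≤ T := NonUnitalStarSubalgebra.le_topologicalClosure _
  have key : ∀ y ∈ NonUnitalStarAlgebra.adjoin ℂ s,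
      p * y ∈ T ∧ y * p ∈ T ∧ star p * y ∈ T ∧ y * star p ∈ T := by
    intro y hy
    induction hy using NonUnitalStarAlgebra.adjoin_induction with
    | mem y hy => exact h y hy
    | add y z _ _ hy hz =>
      simp only [mul_add, add_mul]
      exact ⟨add_mem hy.1 hz.1, add_mem hy.2.1 hz.2.1, add_mem hy.2.2.1 hz.2.2.1,
        add_mem hy.2.2.2 hz.2.2.2⟩
    | zero => simp [zero_mem]
    | mul y z hy' hz' hy hz =>
      simp only [← mul_assoc p, ← mul_assoc (star p), mul_assoc y z]
      exact ⟨mul_mem hy.1 (hle hz'), mul_mem (hle hy') hz.2.1, mul_mem hy.2.2.1 (hle hz'),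
        mul_mem (hle hy') hz.2.2.2⟩
    | smul c y _ hy =>
      simp only [mul_smul_comm, smul_mul_assoc]
      exact ⟨SMulMemClass.smul_mem c hy.1, SMulMemClass.smul_mem c hy.2.1,
        SMulMemClass.smul_mem c hy.2.2.1, SMulMemClass.smul_mem c hy.2.2.2⟩
    | star y _ hy =>
      refine ⟨?_, ?_, ?_, ?_⟩
      · simpa using star_mem hy.2.2.2
      · simpa using star_mem hy.2.2.1
      · simpa using star_mem hy.2.1
      · simpa using star_mem hy.1
  have hx' : x ∈ closure (NonUnitalStarAlgebra.adjoin ℂ s : Set P) := hx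
  constructor
  · exact (map_mem_closure (continuous_const_mul p) hx'
      fun y hy => (key y hy).1 : p * x ∈ closure (T : Set P)) |> hcl.closure_subset
  · exact (map_mem_closure (f := fun z => z * p) (continuous_mul_const p) hx'
      fun y hy => (key y hy).2.1 : (fun z => z * p) x ∈ closure (T : Set P)) |> hcl.closure_subset

end InducedMultipliers

section TensorHoms

variable {A : Type*} {B : Type*} {C : Type*} {D : Type*}
  [NonUnitalCStarAlgebra A] [NonUnitalCStarAlgebra B]
  [NonUnitalCStarAlgebra C] [NonUnitalCStarAlgebra D]

/-- For `m ∈ M(A)` and `n ∈ M(C)`, the multiplier `m ⊗ n` of `A ⊗ C`, determined by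
`(m ⊗ n)(a ⊗ c) = m a ⊗ n c`. -/
def mtmul (m : 𝓜(ℂ, A)) (n : 𝓜(ℂ, C)) : 𝓜(ℂ, SpatialTensor A C) :=
  Classical.epsilon fun p => ∀ (a : A) (c : C), p.fst (tmul a c) = tmul (m.fst a) (n.fst c)

/-- For `φ : A → M(B)` and `ψ : C → M(D)`, the `*`-homomorphism `φ ⊗ ψ : A ⊗ C → M(B ⊗ D)`,
determined by `(φ ⊗ ψ)(a ⊗ c) = φ(a) ⊗ ψ(c)`. -/
def tensorHom (φ : A →⋆ₙₐ[ℂ] 𝓜(ℂ, B)) (ψ : C →⋆ₙₐ[ℂ] 𝓜(ℂ, D)) :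
    SpatialTensor A C →⋆ₙₐ[ℂ] 𝓜(ℂ, SpatialTensor B D) :=
  Classical.epsilon fun T => ∀ (a : A) (c : C), T (tmul a c) = mtmul (φ a) (ψ c)

variable (A B C) in
/-- The canonical isomorphism of `(A ⊗ B) ⊗ C` onto `A ⊗ (B ⊗ C)`, viewed as a map into
`M(A ⊗ (B ⊗ C))`; it is determined by `(a ⊗ b) ⊗ c ↦ a ⊗ (b ⊗ c)`. -/
def assocHom : SpatialTensor (SpatialTensor A B) C →⋆ₙₐ[ℂ]
    𝓜(ℂ, SpatialTensor A (SpatialTensor B C)) :=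
  Classical.epsilon fun T => ∀ (a : A) (b : B) (c : C),
    T (tmul (tmul a b) c) = incl _ (tmul a (tmul b c))

end TensorHoms

section GroupAlgebra

variable (G : Type v) [Group G] [TopologicalSpace G] [IsTopologicalGroup G]

/-- A (strongly continuous) unitary representation of `G` on a Hilbert space. -/
structure UnitaryRep : Type (v + 1) where
  H : Type v
  [group : NormedAddCommGroup H]
  [inner : InnerProductSpace ℂ H]
  [complete : CompleteSpace H]
  U : G →* unitary (H →L[ℂ] H)
  cont : ∀ x : H, Continuous fun s : G => (U s : H →L[ℂ] H) x

attribute [instance] UnitaryRep.group UnitaryRep.inner UnitaryRep.complete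

variable {G}

lemma UnitaryRep.norm_apply (π : UnitaryRep G) (s : G) (x : π.H) :
    ‖(π.U s : π.H →L[ℂ] π.H) x‖ = ‖x‖ :=
  (Unitary.linearIsometryEquiv (π.U s)).norm_map x

lemma UnitaryRep.opNorm_le (π : UnitaryRep G) (s : G) : ‖(π.U s : π.H →L[ℂ] π.H)‖ ≤ 1 :=
  ContinuousLinearMap.opNorm_le_bound _ zero_le_one fun x => by simp [π.norm_apply]

variable [LocallyCompactSpace G] [T2Space G] [MeasurableSpace G] [BorelSpace G]

lemma UnitaryRep.integrable (π : UnitaryRep G) (f : C_c(G, ℂ)) (x : π.H) :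
    Integrable (fun s : G => f s • (π.U s : π.H →L[ℂ] π.H) x) Measure.haar :=
  (f.continuous.smul (π.cont x)).integrable_of_hasCompactSupport f.hasCompactSupport.smul_right

lemma UnitaryRep.norm_integral_le (π : UnitaryRep G) (f : C_c(G, ℂ)) (x : π.H) :
    ‖∫ s, f s • (π.U s : π.H →L[ℂ] π.H) x ∂Measure.haar‖ ≤
      (∫ s, ‖f s‖ ∂(Measure.haar : Measure G)) * ‖x‖ := by
  refine (norm_integral_le_integral_norm _).trans_eq ?_
  simp only [norm_smul, π.norm_apply]
  exact integral_mul_const _ _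

/-- The integrated form: `π(f) = ∫ f(s) U_s ds` for `f ∈ C_c(G)`. -/
def UnitaryRep.integrated (π : UnitaryRep G) (f : C_c(G, ℂ)) : π.H →L[ℂ] π.H :=
  LinearMap.mkContinuous
    { toFun := fun x => ∫ s, f s • (π.U s : π.H →L[ℂ] π.H) x ∂Measure.haar
      map_add' := fun x y => by
        simp only [map_add, smul_add]
        exact integral_add (π.integrable f x) (π.integrable f y)
      map_smul' := fun c x => by
        simp only [map_smul, RingHom.id_apply, smul_comm (_ : ℂ) c]
        exact integral_smul c _ }
    (∫ s, ‖f s‖ ∂(Measure.haar : Measure G)) (π.norm_integral_le f)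

lemma UnitaryRep.integrated_apply (π : UnitaryRep G) (f : C_c(G, ℂ)) (x : π.H) :
    π.integrated f x = ∫ s, f s • (π.U s : π.H →L[ℂ] π.H) x ∂Measure.haar := rfl

lemma UnitaryRep.norm_integrated_le (π : UnitaryRep G) (f : C_c(G, ℂ)) :
    ‖π.integrated f‖ ≤ ∫ s, ‖f s‖ ∂(Measure.haar : Measure G) :=
  LinearMap.mkContinuous_norm_le _ (integral_nonneg fun _ => norm_nonneg _) _

variable (G) in
/-- The `C*`-algebra of all bounded families `(T_π)` of operators `T_π` on `H_π`, indexed by the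
unitary representations `π` of `G`. -/
def RepProduct : Type (v + 1) := lp (fun π : UnitaryRep G => π.H →L[ℂ] π.H) ∞

instance : NonUnitalCStarAlgebra (RepProduct G) :=
  inferInstanceAs (NonUnitalCStarAlgebra (lp (fun π : UnitaryRep G => π.H →L[ℂ] π.H) ∞))

/-- The component at `π` of a family in `RepProduct G`. -/
def RepProduct.component (π : UnitaryRep G) : RepProduct G →⋆ₙₐ[ℂ] (π.H →L[ℂ] π.H) where
  toFun x := x.1 π
  map_smul' _ _ := rfl
  map_zero' := rfl
  map_add' _ _ := rfl
  map_mul' _ _ := rfl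
  map_star' _ := rfl

lemma RepProduct.ext {x y : RepProduct G}
    (h : ∀ π : UnitaryRep G, component π x = component π y) : x = y :=
  lp.ext (funext h)

/-- The family `(U_s)` for a group element `s`. -/
def groupFamily (s : G) : RepProduct G :=
  ⟨fun π => (π.U s : π.H →L[ℂ] π.H), memℓp_infty ⟨1, by
    rintro _ ⟨π, rfl⟩; exact π.opNorm_le s⟩⟩

/-- The family `(π(f))` for `f ∈ C_c(G)`. -/
def integratedFamily (f : C_c(G, ℂ)) : RepProduct G :=
  ⟨fun π => π.integrated f, memℓp_infty ⟨_, by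
    rintro _ ⟨π, rfl⟩; exact π.norm_integrated_le f⟩⟩

variable (G) in
/-- The full group `C*`-algebra `C*(G)`: the completion of `C_c(G)` in the norm
`‖f‖ = sup ‖π(f)‖` over all unitary representations `π`, realised as the `C*`-algebra generated by
the families `(π(f))`. -/
def groupAlg : NonUnitalStarSubalgebra ℂ (RepProduct G) :=
  (NonUnitalStarAlgebra.adjoin ℂ (Set.range (integratedFamily (G := G)))).topologicalClosure

variable (G) in
/-- The full group `C*`-algebra `C*(G)`. -/
def GroupAlg : Type (v + 1) := groupAlg G

instance : NonUnitalCStarAlgebra (GroupAlg G) :=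
  haveI : IsClosed (groupAlg G : Set (RepProduct G)) :=
    NonUnitalStarSubalgebra.isClosed_topologicalClosure _
  NonUnitalStarSubalgebra.nonUnitalCStarAlgebra (groupAlg G)

/-- The translate `t ↦ f(s⁻¹ t)`. -/
def leftTranslate (s : G) (f : C_c(G, ℂ)) : C_c(G, ℂ) where
  toFun t := f (s⁻¹ * t)
  continuous_toFun := f.continuous.comp (continuous_const_mul s⁻¹)
  hasCompactSupport' := f.hasCompactSupport.comp_homeomorph (Homeomorph.mulLeft s⁻¹)

/-- The translate `t ↦ f(t s⁻¹)`. -/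
def rightTranslate (s : G) (f : C_c(G, ℂ)) : C_c(G, ℂ) where
  toFun t := f (t * s⁻¹)
  continuous_toFun := f.continuous.comp (continuous_mul_const s⁻¹)
  hasCompactSupport' := f.hasCompactSupport.comp_homeomorph (Homeomorph.mulRight s⁻¹)

lemma leftTranslate_apply (s : G) (f : C_c(G, ℂ)) (t : G) :
    leftTranslate s f t = f (s⁻¹ * t) := rfl

lemma rightTranslate_apply (s : G) (f : C_c(G, ℂ)) (t : G) :
    rightTranslate s f t = f (t * s⁻¹) := rfl

lemma groupFamily_mul_integratedFamily (s : G) (f : C_c(G, ℂ)) :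
    groupFamily s * integratedFamily f = integratedFamily (leftTranslate s f) := by
  refine RepProduct.ext fun π => ContinuousLinearMap.ext fun x => ?_
  change (π.U s : π.H →L[ℂ] π.H) (π.integrated f x) = π.integrated (leftTranslate s f) x
  rw [π.integrated_apply, π.integrated_apply, ← ContinuousLinearMap.integral_comp_comm _
    (π.integrable f x), ← integral_mul_left_eq_self
      (fun t => leftTranslate s f t • (π.U t : π.H →L[ℂ] π.H) x) s]
  refine integral_congr_ae (Filter.Eventually.of_forall fun t => ?_)
  simp [leftTranslate_apply]

lemma integratedFamily_mul_groupFamily (s : G) (f : C_c(G, ℂ)) :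
    ∃ c : ℂ, integratedFamily f * groupFamily s = c • integratedFamily (rightTranslate s f) := by
  have : ((Measure.haar : Measure G).map (Homeomorph.mulRight s)).Regular :=
    Measure.Regular.map (Homeomorph.mulRight s)
  have : ((Measure.haar : Measure G).map (Homeomorph.mulRight s)).IsMulLeftInvariant :=
    isMulLeftInvariant_map_mul_right (μ := Measure.haar) s
  have h := Measure.isMulLeftInvariant_eq_smul_of_regular
    ((Measure.haar : Measure G).map (Homeomorph.mulRight s)) Measure.haar
  refine ⟨((Measure.haarScalarFactor
    ((Measure.haar : Measure G).map (Homeomorph.mulRight s)) Measure.haar : ℝ) : ℂ), ?_⟩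
  refine RepProduct.ext fun π => ContinuousLinearMap.ext fun x => ?_
  rw [map_mul, map_smul]
  change π.integrated f ((π.U s : π.H →L[ℂ] π.H) x) =
    ((Measure.haarScalarFactor ((Measure.haar : Measure G).map (Homeomorph.mulRight s))
      Measure.haar : ℝ) : ℂ) • π.integrated (rightTranslate s f) x
  rw [π.integrated_apply, π.integrated_apply]
  have h2 : ∫ t, (rightTranslate s f) t • (π.U t : π.H →L[ℂ] π.H) x
        ∂((Measure.haar : Measure G).map (Homeomorph.mulRight s)) =
      ∫ t, f t • (π.U t : π.H →L[ℂ] π.H) ((π.U s : π.H →L[ℂ] π.H) x) ∂Measure.haar := by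
    rw [(Homeomorph.mulRight s).measurableEmbedding.integral_map]
    refine integral_congr_ae (Filter.Eventually.of_forall fun t => ?_)
    simp [rightTranslate_apply]
  rw [← h2]
  conv_lhs => rw [h]
  rw [integral_smul_nnreal_measure]
  rfl

lemma star_groupFamily (s : G) : star (groupFamily s) = groupFamily s⁻¹ := by
  refine RepProduct.ext fun π => ?_
  change star (π.U s : π.H →L[ℂ] π.H) = (π.U s⁻¹ : π.H →L[ℂ] π.H)
  rw [map_inv]
  rfl

lemma groupFamily_mul_mem (s : G) (x : RepProduct G) (hx : x ∈ groupAlg G) :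
    groupFamily s * x ∈ groupAlg G ∧ x * groupFamily s ∈ groupAlg G := by
  refine idealizes_of_generators (groupFamily s) ?_ hx
  have hl : ∀ (s : G) (f : C_c(G, ℂ)), groupFamily s * integratedFamily f ∈ groupAlg G :=
    fun s f => by
      rw [groupFamily_mul_integratedFamily]
      exact NonUnitalStarSubalgebra.le_topologicalClosure _
        (NonUnitalStarAlgebra.subset_adjoin ℂ _ ⟨_, rfl⟩)
  have hr : ∀ (s : G) (f : C_c(G, ℂ)), integratedFamily f * groupFamily s ∈ groupAlg G :=
    fun s f => by
      obtain ⟨c, hc⟩ := integratedFamily_mul_groupFamily s f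
      rw [hc]
      exact SMulMemClass.smul_mem _ (NonUnitalStarSubalgebra.le_topologicalClosure _
        (NonUnitalStarAlgebra.subset_adjoin ℂ _ ⟨_, rfl⟩))
  rintro _ ⟨f, rfl⟩
  rw [star_groupFamily]
  exact ⟨hl s f, hr s f, hl s⁻¹ f, hr s⁻¹ f⟩

/-- The canonical unitary `k_G(s) ∈ M(C*(G))`: multiplication by the family `(U_s)`. -/
def kG (s : G) : 𝓜(ℂ, GroupAlg G) :=
  multiplierOfIdealizer (groupAlg G) (groupFamily s)
    (fun x hx => (groupFamily_mul_mem s x hx).1) (fun x hx => (groupFamily_mul_mem s x hx).2)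

variable (G) in
/-- The comultiplication `δ_G : C*(G) → M(C*(G) ⊗ C*(G))`, the integrated form of
`s ↦ k_G(s) ⊗ k_G(s)`: the unique nondegenerate homomorphism whose extension maps `k_G(s)` to
`k_G(s) ⊗ k_G(s)`. -/
def comul : GroupAlg G →⋆ₙₐ[ℂ] 𝓜(ℂ, SpatialTensor (GroupAlg G) (GroupAlg G)) :=
  Classical.epsilon fun Δ => Nondegenerate Δ ∧ ∀ s : G, bar Δ (kG s) = mtmul (kG s) (kG s)

end GroupAlgebra

section CompactOperators

variable (H : Type v) [NormedAddCommGroup H] [InnerProductSpace ℂ H] [CompleteSpace H]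

variable {H} in
lemma isCompactOperator_star {T : H →L[ℂ] H} (hT : IsCompactOperator T) :
    IsCompactOperator (star T : H →L[ℂ] H) := by
  have hc : IsCompactOperator (T * star T : H →L[ℂ] H) := hT.comp_clm (star T)
  have key : ∀ x y : H, ‖x‖ ≤ 1 → ‖y‖ ≤ 1 →
      ‖star T x - star T y‖ ^ 2 ≤ 2 * ‖(T * star T) x - (T * star T) y‖ := by
    intro x y hx hy
    have h1 : ‖star T (x - y)‖ ^ 2 ≤ ‖(T * star T) (x - y)‖ * ‖x - y‖ := by
      rw [← inner_self_eq_norm_sq (𝕜 := ℂ)]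
      conv_lhs => rw [ContinuousLinearMap.star_eq_adjoint,
        ContinuousLinearMap.adjoint_inner_right]
      refine (RCLike.re_le_norm _).trans ?_
      exact norm_inner_le_norm _ _
    have h2 : ‖x - y‖ ≤ 2 := (norm_sub_le x y).trans (by linarith)
    rw [← map_sub, ← map_sub]
    refine h1.trans ?_
    rw [mul_comm]
    gcongr
  have htb : TotallyBounded ((T * star T : H →L[ℂ] H) '' Metric.closedBall 0 1) :=
    ((IsCompactOperator.isCompact_closure_image_closedBall
      (f := ((T * star T : H →L[ℂ] H) : H →ₗ[ℂ] H)) hc 1).totallyBounded).subset subset_closure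
  have htb2 : TotallyBounded ((star T : H →L[ℂ] H) '' Metric.closedBall 0 1) := by
    rw [Metric.totallyBounded_iff]
    intro ε hε
    obtain ⟨t, ht, htf, hcov⟩ := Metric.finite_approx_of_totallyBounded htb (ε ^ 2 / 2) (by positivity)
    have ht' : ∀ y ∈ t, ∃ z, z ∈ Metric.closedBall (0 : H) 1 ∧ (T * star T) z = y :=
      fun y hy => ht hy
    choose! g hg hg' using ht'
    refine ⟨(fun y => star T (g y)) '' t, htf.image _, ?_⟩
    rintro _ ⟨x, hx, rfl⟩
    have := hcov ⟨x, hx, rfl⟩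
    simp only [Set.mem_iUnion, Metric.mem_ball, exists_prop] at this
    obtain ⟨y, hy, hxy⟩ := this
    simp only [Set.mem_iUnion, Metric.mem_ball, exists_prop]
    refine ⟨_, ⟨y, hy, rfl⟩, ?_⟩
    have hk := key x (g y) (by simpa using hx) (by simpa using hg y hy)
    rw [hg' y hy, ← dist_eq_norm, ← dist_eq_norm] at hk
    exact lt_of_pow_lt_pow_left₀ 2 hε.le (by linarith)
  refine (isCompactOperator_iff_isCompact_closure_image_closedBall
    ((star T : H →L[ℂ] H) : H →ₗ[ℂ] H) one_pos).2 ?_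
  exact htb2.closure.isCompact_of_isClosed isClosed_closure

/-- The compact operators on a Hilbert space. -/
def compactOps : NonUnitalStarSubalgebra ℂ (H →L[ℂ] H) where
  carrier := {T | IsCompactOperator T}
  add_mem' := fun hS hT => IsCompactOperator.add hS hT
  zero_mem' := isCompactOperator_zero
  mul_mem' := fun {_ T} hS _ => IsCompactOperator.comp_clm hS T
  smul_mem' := fun c _ hT => IsCompactOperator.smul hT c
  star_mem' := fun hT => isCompactOperator_star hT

lemma isClosed_compactOps : IsClosed (compactOps H : Set (H →L[ℂ] H)) :=
  isClosed_setOfPred_isCompactOperator (𝕜₁ := ℂ) (σ₁₂ := RingHom.id ℂ) (M₁ := H) (M₂ := H)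

/-- The `C*`-algebra `K(H)`. -/
def CompactOps : Type v := compactOps H

instance : NonUnitalCStarAlgebra (CompactOps H) :=
  haveI := isClosed_compactOps H
  NonUnitalStarSubalgebra.nonUnitalCStarAlgebra (compactOps H)

/-- The embedding of `B(H)` in `M(K(H))`, by left and right multiplication. -/
def boundedToMultiplier : (H →L[ℂ] H) →⋆ₙₐ[ℂ] 𝓜(ℂ, CompactOps H) where
  toFun T := multiplierOfIdealizer (compactOps H) T
    (fun S hS => IsCompactOperator.clm_comp (f := S) hS T)
    (fun S hS => IsCompactOperator.comp_clm (f := S) hS T)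
  map_smul' c T := by
    refine DoubleCentralizer.ext _ _ _ _ (Prod.ext ?_ ?_)
    · exact ContinuousLinearMap.ext fun x => Subtype.ext (smul_mul_assoc c T (x.1 : H →L[ℂ] H))
    · exact ContinuousLinearMap.ext fun x => Subtype.ext (mul_smul_comm c (x.1 : H →L[ℂ] H) T)
  map_zero' := by
    refine DoubleCentralizer.ext _ _ _ _ (Prod.ext ?_ ?_)
    · exact ContinuousLinearMap.ext fun x => Subtype.ext (zero_mul (x.1 : H →L[ℂ] H))
    · exact ContinuousLinearMap.ext fun x => Subtype.ext (mul_zero (x.1 : H →L[ℂ] H))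
  map_add' S T := by
    refine DoubleCentralizer.ext _ _ _ _ (Prod.ext ?_ ?_)
    · exact ContinuousLinearMap.ext fun x => Subtype.ext (add_mul S T (x.1 : H →L[ℂ] H))
    · exact ContinuousLinearMap.ext fun x => Subtype.ext (mul_add (x.1 : H →L[ℂ] H) S T)
  map_mul' S T := by
    refine DoubleCentralizer.ext _ _ _ _ (Prod.ext ?_ ?_)
    · exact ContinuousLinearMap.ext fun x => Subtype.ext (mul_assoc S T (x.1 : H →L[ℂ] H))
    · exact ContinuousLinearMap.ext fun x =>
        Subtype.ext (mul_assoc (x.1 : H →L[ℂ] H) S T).symm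
  map_star' T := by
    refine DoubleCentralizer.ext _ _ _ _ (Prod.ext ?_ ?_)
    · exact ContinuousLinearMap.ext fun x =>
        Subtype.ext (star_star_mul (x.1 : H →L[ℂ] H) T).symm
    · exact ContinuousLinearMap.ext fun x =>
        Subtype.ext (star_mul_star T (x.1 : H →L[ℂ] H)).symm

end CompactOperators

section RegularRepresentation

variable (G : Type v) [Group G] [TopologicalSpace G] [IsTopologicalGroup G]
  [LocallyCompactSpace G] [T2Space G] [MeasurableSpace G] [BorelSpace G]

/-- `L²(G)` for a left Haar measure. -/
abbrev L2 : Type v := Lp ℂ 2 (Measure.haar : Measure G)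

variable {G} in
/-- Left translation `(λ_s ξ)(t) = ξ(s⁻¹ t)` on `L²(G)`. -/
def leftReg (s : G) : L2 G ≃ₗᵢ[ℂ] L2 G where
  toFun x := DomMulAct.mk s⁻¹ • x
  invFun x := DomMulAct.mk s • x
  map_add' x y := smul_add _ x y
  map_smul' c x := smul_comm _ c x
  left_inv x := by simp [smul_smul]
  right_inv x := by simp [smul_smul]
  norm_map' x := DomMulAct.norm_smul_Lp _ x

/-- The left regular representation `λ` of `G` on `L²(G)`. -/
def regularRep : UnitaryRep G where
  H := L2 G
  U :=
    { toFun := fun s => Unitary.linearIsometryEquiv.symm (leftReg s)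
      map_one' := by
        rw [← map_one (Unitary.linearIsometryEquiv (𝕜 := ℂ) (H := L2 G)).symm]
        congr 1
        ext1 x
        change DomMulAct.mk (1 : G)⁻¹ • x = x
        simp
      map_mul' := fun s t => by
        rw [← map_mul]
        congr 1
        ext1 x
        change DomMulAct.mk (s * t)⁻¹ • x = DomMulAct.mk s⁻¹ • DomMulAct.mk t⁻¹ • x
        rw [smul_smul, ← DomMulAct.mk_mul, mul_inv_rev] }
  cont x := by
    have : Fact ((2 : ℝ≥0∞) ≠ ∞) := ⟨ENNReal.ofNat_ne_top⟩
    change Continuous fun s : G => DomMulAct.mk s⁻¹ • x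
    exact (DomMulAct.continuous_mk.comp continuous_inv).smul continuous_const

/-- The integrated form `π_λ : C*(G) → M(K(L²(G)))` of the left regular representation. On a family
`(T_π)` in `C*(G)` it is the component at `λ`, so it maps `(π(f))` to `λ(f)`. -/
def regHom : GroupAlg G →⋆ₙₐ[ℂ] 𝓜(ℂ, CompactOps (L2 G)) :=
  (boundedToMultiplier (L2 G)).comp
    ((RepProduct.component (regularRep G)).comp
      (NonUnitalStarSubalgebraClass.subtype (groupAlg G)))

variable {G} in
/-- The class in `L^∞(G)` of a function in `C_0(G)`. -/
def toLinfty (f : C₀(G, ℂ)) : Lp ℂ ∞ (Measure.haar : Measure G) :=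
  (memLp_top_of_bound f.continuous.aestronglyMeasurable ‖f‖ (Filter.Eventually.of_forall fun s =>
    f.toBCF.norm_coe_le_norm s)).toLp f

variable {G} in
/-- The multiplication operator `(M(f) ξ)(t) = f(t) ξ(t)` on `L²(G)`. -/
def multOp (f : C₀(G, ℂ)) : L2 G →L[ℂ] L2 G :=
  (ContinuousLinearMap.mul ℂ ℂ).holderL Measure.haar ∞ 2 2 (toLinfty f)

end RegularRepresentation

section Quotients

variable {A : Type u} {E : Type v} [NonUnitalCStarAlgebra A] [NonUnitalCStarAlgebra E]

lemma exists_lift_of_isSelfAdjoint (φ : A →⋆ₙₐ[ℂ] E) (x : A) (hx : IsSelfAdjoint x) :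
    ∃ z : A, φ z = φ x ∧ ‖z‖ ≤ ‖φ x‖ := by
  have hφ : Continuous φ := AddMonoidHomClass.continuous_of_bound φ 1 fun a => by
    simpa using NonUnitalStarAlgHom.norm_apply_le φ a
  have hy : IsSelfAdjoint (φ x) := hx.map φ
  set r := ‖φ x‖ with hr
  let f : ℝ → ℝ := fun t => max (-r) (min t r)
  have hf : Continuous f := by fun_prop
  have hr0 : 0 ≤ r := norm_nonneg _
  have hf0 : f 0 = 0 := by simp [f, hr0]
  refine ⟨cfcₙ f x, ?_, ?_⟩
  · rw [NonUnitalStarAlgHomClass.map_cfcₙ (S := ℂ) φ f x hf.continuousOn hf0 hφ hx hy]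
    conv_rhs => rw [← cfcₙ_id ℝ (φ x)]
    refine cfcₙ_congr fun t ht => ?_
    have h1 : ‖t‖ ≤ r := by
      have := norm_apply_le_norm_cfcₙ (id : ℝ → ℝ) (φ x) ht
      rwa [cfcₙ_id ℝ (φ x)] at this
    rw [Real.norm_eq_abs, abs_le] at h1
    simp [f, h1.1, h1.2]
  · refine norm_cfcₙ_le fun t _ => ?_
    rw [Real.norm_eq_abs, abs_le]
    exact ⟨le_max_left _ _, max_le (by linarith) (min_le_right _ _)⟩

lemma exists_lift (φ : A →⋆ₙₐ[ℂ] E) (x : A) : ∃ z : A, φ z = φ x ∧ ‖z‖ ≤ 2 * ‖φ x‖ := by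
  have hn : ∀ c : ℂ, ‖c‖ = 1 → ∃ z : A, φ z = φ ((2⁻¹ : ℂ) • (c • x + star (c • x))) ∧
      ‖z‖ ≤ ‖φ x‖ := by
    intro c hc
    obtain ⟨z, hz, hz'⟩ := exists_lift_of_isSelfAdjoint φ ((2⁻¹ : ℂ) • (c • x + star (c • x)))
      (by simp [isSelfAdjoint_iff, add_comm])
    refine ⟨z, hz, hz'.trans ?_⟩
    have h : φ ((2⁻¹ : ℂ) • (c • x + star (c • x))) =
        (2⁻¹ : ℂ) • (c • φ x + star (c • φ x)) := by
      rw [map_smul, map_add, map_star, map_smul]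
    rw [h, norm_smul]
    have h2 : ‖c • φ x + star (c • φ x)‖ ≤ ‖φ x‖ + ‖φ x‖ := by
      refine (norm_add_le _ _).trans_eq ?_
      rw [norm_star, norm_smul, hc, one_mul]
    rw [norm_inv, Complex.norm_ofNat]
    linarith
  obtain ⟨a, ha, ha'⟩ := hn 1 (by simp)
  obtain ⟨b, hb, hb'⟩ := hn (-Complex.I) (by simp)
  refine ⟨a + Complex.I • b, ?_, ?_⟩
  · rw [map_add, map_smul, ha, hb, ← map_smul, ← map_add]
    congr 1
    have h : star ((-Complex.I) • x) = Complex.I • star x := by simp [star_smul]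
    rw [h, one_smul]
    simp only [smul_add, smul_smul]
    have h1 : Complex.I * (2⁻¹ * -Complex.I) = (2⁻¹ : ℂ) := by
      linear_combination -(2⁻¹ : ℂ) * Complex.I_mul_I
    have h2 : Complex.I * (2⁻¹ * Complex.I) = -(2⁻¹ : ℂ) := by
      linear_combination (2⁻¹ : ℂ) * Complex.I_mul_I
    rw [← mul_assoc, ← mul_assoc] at *
    rw [h1, h2, neg_smul]
    have h3 : (2⁻¹ : ℂ) • x + (2⁻¹ : ℂ) • x = x := by
      rw [← add_smul]; norm_num
    calc _ = (2⁻¹ : ℂ) • x + (2⁻¹ : ℂ) • x := by abel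
      _ = x := h3
  · refine (norm_add_le _ _).trans ?_
    rw [norm_smul, Complex.norm_I, one_mul]
    linarith

lemma isClosed_range (φ : A →⋆ₙₐ[ℂ] E) :
    IsClosed (NonUnitalStarAlgHom.range φ : Set E) := by
  let g : NormedAddGroupHom A E := AddMonoidHom.mkNormedAddGroupHom (φ : A →+ E) 1 fun a => by
    simpa using NonUnitalStarAlgHom.norm_apply_le φ a
  let K : AddSubgroup E := (φ : A →+ E).range
  have h : g.SurjectiveOnWith K 2 := by
    rintro _ ⟨x, rfl⟩
    exact exists_lift φ x
  have h2 := controlled_closure_of_complete (f := g) (K := K) two_pos one_pos h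
  have h3 : (NonUnitalStarAlgHom.range φ : Set E) = K := by
    ext; simp [K]
  rw [h3]
  refine isClosed_of_closure_subset fun y hy => ?_
  obtain ⟨x, hx, -⟩ := h2 y hy
  exact ⟨x, hx⟩


/-- The quotient `C*`-algebra `A / ker φ` for a `*`-homomorphism `φ`. The underlying set is the set
of cosets of `ker φ`; the operations are the quotient operations, and the `C*`-norm is
`‖a + ker φ‖ = ‖φ(a)‖`. -/
def CStarQuotient (φ : A →⋆ₙₐ[ℂ] E) : Type u := Quotient (Setoid.ker φ)

namespace CStarQuotient

/-- The bijection of `A / ker φ` onto the range of `φ`; the structure of `A / ker φ` is transported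
along it. -/
def equivRange (φ : A →⋆ₙₐ[ℂ] E) : CStarQuotient φ ≃ NonUnitalStarAlgHom.range φ :=
  (Setoid.quotientKerEquivRange φ).trans (Equiv.setCongr (NonUnitalStarAlgHom.coe_range φ).symm)

variable (φ : A →⋆ₙₐ[ℂ] E)

instance : NonUnitalNormedRing (CStarQuotient φ) :=
  letI : NonUnitalRing (CStarQuotient φ) := (equivRange φ).nonUnitalRing
  NonUnitalNormedRing.induced (CStarQuotient φ) (NonUnitalStarAlgHom.range φ)
    (equivRange φ).ringEquiv (equivRange φ).injective

instance : Star (CStarQuotient φ) := ⟨fun x => (equivRange φ).symm (star (equivRange φ x))⟩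

instance : SMul ℂ (CStarQuotient φ) := ⟨fun c x => (equivRange φ).symm (c • equivRange φ x)⟩

lemma equivRange_add (x y : CStarQuotient φ) :
    equivRange φ (x + y) = equivRange φ x + equivRange φ y := (equivRange φ).apply_symm_apply _

lemma equivRange_zero : equivRange φ 0 = 0 := (equivRange φ).apply_symm_apply _

lemma equivRange_mul (x y : CStarQuotient φ) :
    equivRange φ (x * y) = equivRange φ x * equivRange φ y := (equivRange φ).apply_symm_apply _

lemma equivRange_star (x : CStarQuotient φ) :
    equivRange φ (star x) = star (equivRange φ x) := (equivRange φ).apply_symm_apply _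

lemma equivRange_smul (c : ℂ) (x : CStarQuotient φ) :
    equivRange φ (c • x) = c • equivRange φ x := (equivRange φ).apply_symm_apply _

lemma norm_equivRange (x : CStarQuotient φ) : ‖equivRange φ x‖ = ‖x‖ := rfl

instance : NonUnitalCStarAlgebra (CStarQuotient φ) where
  star_involutive x := (equivRange φ).injective (by simp only [equivRange_star, star_star])
  star_mul x y := (equivRange φ).injective (by simp only [equivRange_star, equivRange_mul, star_mul])
  star_add x y := (equivRange φ).injective (by simp only [equivRange_star, equivRange_add, star_add])
  one_smul x := (equivRange φ).injective (by simp only [equivRange_smul, one_smul])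
  mul_smul c d x := (equivRange φ).injective (by simp only [equivRange_smul, mul_smul])
  smul_zero c := (equivRange φ).injective (by simp only [equivRange_smul, equivRange_zero, smul_zero])
  smul_add c x y := (equivRange φ).injective (by
    simp only [equivRange_smul, equivRange_add, smul_add])
  add_smul c d x := (equivRange φ).injective (by
    simp only [equivRange_smul, equivRange_add, add_smul])
  zero_smul x := (equivRange φ).injective (by
    simp only [equivRange_smul, equivRange_zero, zero_smul])
  norm_smul_le c x := by
    rw [← norm_equivRange, equivRange_smul, ← norm_equivRange]; exact norm_smul_le _ _
  smul_assoc c x y := (equivRange φ).injective (by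
    simp only [smul_eq_mul, equivRange_smul, equivRange_mul, smul_mul_assoc])
  smul_comm c x y := (equivRange φ).injective (by
    simp only [smul_eq_mul, equivRange_smul, equivRange_mul, mul_smul_comm])
  star_smul c x := (equivRange φ).injective (by
    simp only [equivRange_smul, equivRange_star, star_smul])
  norm_mul_self_le x := by
    simp only [← norm_equivRange, equivRange_mul, equivRange_star]
    exact (CStarRing.norm_star_mul_self (x := (equivRange φ x : E))).symm.le
  complete := by
    have : CompleteSpace (NonUnitalStarAlgHom.range φ) := (isClosed_range φ).completeSpace_coe
    have h : Isometry (equivRange φ) := AddMonoidHomClass.isometry_of_norm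
      ({ toFun := equivRange φ, map_zero' := equivRange_zero φ, map_add' := equivRange_add φ } :
        CStarQuotient φ →+ NonUnitalStarAlgHom.range φ) (norm_equivRange φ)
    have h2 := (completeSpace_congr (e := equivRange φ) h.isUniformEmbedding).2 this
    intro f hf
    exact h2.complete hf

/-- The coset `a + ker φ`. -/
def coset (a : A) : CStarQuotient φ := Quotient.mk (Setoid.ker φ) a

/-- The quotient map `A → A / ker φ`. -/
def mk : A →⋆ₙₐ[ℂ] CStarQuotient φ where
  toFun a := coset φ a
  map_smul' c a := (equivRange φ).injective (by
    rw [MonoidHom.id_apply, equivRange_smul]; exact Subtype.ext (map_smul φ c a))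
  map_zero' := (equivRange φ).injective (by
    rw [equivRange_zero]; exact Subtype.ext (map_zero φ))
  map_add' a b := (equivRange φ).injective (by
    rw [equivRange_add]; exact Subtype.ext (map_add φ a b))
  map_mul' a b := (equivRange φ).injective (by
    rw [equivRange_mul]; exact Subtype.ext (map_mul φ a b))
  map_star' a := (equivRange φ).injective (by
    rw [equivRange_star]; exact Subtype.ext (map_star φ a))

end CStarQuotient

end Quotients

section Coactions

variable (G : Type v) [Group G] [TopologicalSpace G] [IsTopologicalGroup G]
  [LocallyCompactSpace G] [T2Space G] [MeasurableSpace G] [BorelSpace G]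

/-- A full coaction of `G` on a `C*`-algebra `B`: an injective nondegenerate homomorphism
`δ : B → M(B ⊗ C*(G))` with `δ(b)(1 ⊗ z) ∈ B ⊗ C*(G)` and `(δ ⊗ id) ∘ δ = (id ⊗ δ_G) ∘ δ`, where
the homomorphisms `δ ⊗ id` and `id ⊗ δ_G` are extended to multiplier algebras, and
`(B ⊗ C*(G)) ⊗ C*(G)` is identified with `B ⊗ (C*(G) ⊗ C*(G))`. -/
structure FullCoaction (B : Type u) [NonUnitalCStarAlgebra B] where
  δ : B →⋆ₙₐ[ℂ] 𝓜(ℂ, SpatialTensor B (GroupAlg G))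
  injective : Function.Injective δ
  nondegenerate : Nondegenerate δ
  mul_mem : ∀ (b : B) (z : GroupAlg G), ∃ x : SpatialTensor B (GroupAlg G),
    δ b * mtmul 1 (incl _ z) = incl _ x
  coassoc : ∀ b : B,
    bar (assocHom B (GroupAlg G) (GroupAlg G)) (bar (tensorHom δ (incl (GroupAlg G))) (δ b)) =
      bar (tensorHom (incl B) (comul G)) (δ b)

variable {G} {B : Type u} {C : Type w} [NonUnitalCStarAlgebra B] [NonUnitalCStarAlgebra C]

/-- `φ : B → M(C)` is a morphism from `(B, δ)` to `(C, ε)`: it is nondegenerate and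
`(φ ⊗ id) ∘ δ = ε ∘ φ`, with `φ ⊗ id` and `ε` extended to multiplier algebras. -/
def IsMorphism (δ : FullCoaction G B) (ε : FullCoaction G C) (φ : B →⋆ₙₐ[ℂ] 𝓜(ℂ, C)) : Prop :=
  Nondegenerate φ ∧ ∀ b : B, bar (tensorHom φ (incl (GroupAlg G))) (δ.δ b) = bar ε.δ (φ b)

namespace FullCoaction

/-- The homomorphism `j_B = (id ⊗ π_λ) ∘ δ : B → M(B ⊗ K(L²(G)))`. -/
def jB (δ : FullCoaction G B) : B →⋆ₙₐ[ℂ] 𝓜(ℂ, SpatialTensor B (CompactOps (L2 G))) :=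
  (bar (tensorHom (incl B) (regHom G))).comp δ.δ

/-- The map `j_G = 1 ⊗ M : C_0(G) → M(B ⊗ K(L²(G)))`. -/
def jG (_δ : FullCoaction G B) (f : C₀(G, ℂ)) : 𝓜(ℂ, SpatialTensor B (CompactOps (L2 G))) :=
  mtmul 1 (boundedToMultiplier (L2 G) (multOp f))

/-- A coaction is normal if `j_B` is faithful. -/
def IsNormal (δ : FullCoaction G B) : Prop := Function.Injective δ.jB

/-- The standard crossed product: the `C*`-subalgebra of `M(B ⊗ K(L²(G)))` generated by the
elements `j_B(b) j_G(f)`. -/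
def crossedProduct (δ : FullCoaction G B) :
    NonUnitalStarSubalgebra ℂ 𝓜(ℂ, SpatialTensor B (CompactOps (L2 G))) :=
  (NonUnitalStarAlgebra.adjoin ℂ
    {x | ∃ (b : B) (f : C₀(G, ℂ)), x = δ.jB b * δ.jG f}).topologicalClosure

/-- The standard crossed product `B ×_δ G`. -/
def CrossedProduct (δ : FullCoaction G B) : Type (max u v) := δ.crossedProduct

instance (δ : FullCoaction G B) : NonUnitalCStarAlgebra δ.CrossedProduct :=
  haveI : IsClosed (δ.crossedProduct : Set 𝓜(ℂ, SpatialTensor B (CompactOps (L2 G)))) :=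
    NonUnitalStarSubalgebra.isClosed_topologicalClosure _
  NonUnitalStarSubalgebra.nonUnitalCStarAlgebra δ.crossedProduct

/-- The multiplier of `B ×_δ G` given by multiplication by `p ∈ M(B ⊗ K(L²(G)))`, if `p` multiplies
`B ×_δ G` into itself (as the elements `j_B(b)` and `j_G(f)` do). -/
def multiplier (δ : FullCoaction G B) (p : 𝓜(ℂ, SpatialTensor B (CompactOps (L2 G)))) :
    𝓜(ℂ, δ.CrossedProduct) :=
  open Classical in
  if h : ∀ x ∈ δ.crossedProduct, p * x ∈ δ.crossedProduct ∧ x * p ∈ δ.crossedProduct then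
    multiplierOfIdealizer δ.crossedProduct p (fun x hx => (h x hx).1) (fun x hx => (h x hx).2)
  else 0

/-- `Φ : B ×_δ G → M(C ×_ε G)` is the homomorphism `φ × G`: it is nondegenerate, and its extension
to multipliers satisfies `Φ ∘ j_B = j_C ∘ φ` and `Φ ∘ j_G = j_G`. -/
def IsCrossedMap (δ : FullCoaction G B) (ε : FullCoaction G C) (φ : B →⋆ₙₐ[ℂ] 𝓜(ℂ, C))
    (Φ : δ.CrossedProduct →⋆ₙₐ[ℂ] 𝓜(ℂ, ε.CrossedProduct)) : Prop :=
  Nondegenerate Φ ∧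
  (∀ b : B, bar Φ (δ.multiplier (δ.jB b)) = bar (fun c : C => ε.multiplier (ε.jB c)) (φ b)) ∧
  ∀ f : C₀(G, ℂ), bar Φ (δ.multiplier (δ.jG f)) = ε.multiplier (ε.jG f)

/-- There is exactly one homomorphism `φ × G`, and it is an isomorphism of `B ×_δ G` onto
`C ×_ε G`. -/
def CrossedMapIsIso (δ : FullCoaction G B) (ε : FullCoaction G C) (φ : B →⋆ₙₐ[ℂ] 𝓜(ℂ, C)) :
    Prop :=
  ∃ Φ : δ.CrossedProduct →⋆ₙₐ[ℂ] 𝓜(ℂ, ε.CrossedProduct),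
    IsCrossedMap δ ε φ Φ ∧ (∀ Ψ, IsCrossedMap δ ε φ Ψ → Ψ = Φ) ∧
    Function.Injective Φ ∧ Set.range Φ = Set.range (incl ε.CrossedProduct)

/-- `B^n = B / ker j_B`. -/
abbrev Normalized (δ : FullCoaction G B) : Type u := CStarQuotient δ.jB

/-- The quotient map `q^n : B → B^n`. -/
abbrev qn (δ : FullCoaction G B) : B →⋆ₙₐ[ℂ] δ.Normalized := CStarQuotient.mk δ.jB

end FullCoaction

end Coactions

end Coact

end

noncomputable section

namespace Coact

open Filter Topology
open scoped Pointwise NNReal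

/-! ### Elementary facts on multipliers and on extending homomorphisms from generators. -/

section Basics

variable {A : Type*} {B : Type*} {E : Type*} [NonUnitalCStarAlgebra A] [NonUnitalCStarAlgebra B]
  [NonUnitalCStarAlgebra E]

/-! Fix a nondegenerate representation σ of B on H and put J = (σ ⊗ λ) ∘ δ, acting on H ⊗ L²(G). For
faithful σ this is j_B written in operators (`tensorExt_jB`). Everything rests on one identity,
`conj_regRep`. Let π be a unitary representation of G. Applying σ ⊗ λ ⊗ π to the coassociativity
relation gives (J ⊗ π) ∘ δ on one side and (σ ⊗ (λ ⊗ π)δ_G) ∘ δ on the other. By absorption, the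
unitary (Wξ)(t) = π(t)ξ(t) carries λ ⊗ 1 to λ ⊗ π. Hence (J ⊗ π) ∘ δ is unitarily equivalent to J ⊗
1.

Normalization: for faithful σ, J induces a faithful representation of B / ker j_B. If J(b) = 0, then
(J ⊗ π)(δ(b)) = 0 for every π, so (q ⊗ id)(δ(b)) = 0 and δ descends to the quotient. Taking π = λ,
the kernel of (J ⊗ λ) ∘ δ is exactly that of J (`regRep_eq_zero_iff`); this gives both the
injectivity of the descended map and its normality.

Crossed products: W for π = λ, followed by the flip, carries λ ⊗ 1 to λ ⊗ λ and M(f) ⊗ 1 to 1 ⊗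
M(f). So for x in B ×_δ G the operator (J ⊗ id)(x) is equivalent to x ⊗ 1 (`conj_crossedProduct`),
and J ⊗ id is faithful there. If a surjective morphism p : B → D has kernel inside ker j_B, then J
factors through p, so p ⊗ id is already faithful on B ×_δ G. It sends j_B(b) j_G(f) to j_D(p(b))
j_G(f), hence is onto D ×_η G (`crossedMapIsIso_of_surjective`).

Universality: j_B is natural, so a morphism φ to a normal coaction kills ker j_B and factors as φ' ∘
q, with q the quotient map to the normalization. The universal property of φ provides θ with θ ∘ φ =
q, and its uniqueness clause shows that θ and φ' are mutually inverse morphisms. Such morphisms take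
values in the algebras themselves: φ'(θ(d) n) = d φ'(n) lies in D, and the elements θ(d) n span a
dense subspace. So φ is q followed by an isomorphism onto D (`IsMorphism.of_universal`).

Much of the work is foundational. The extension φ̄, the tensors m ⊗ n and φ ⊗ ψ, the associativity
isomorphism and δ_G are defined as arbitrary solutions of their characteristic properties, so
solutions must be exhibited. Each is first constructed by operators in jointly faithful
representations and then pulled back to multipliers with `exists_multiplier` or
`exists_lift_multiplier`. This requires that any two nondegenerate representations have a tensor
product on the spatial tensor product (`exists_tensorRep`) and that joint faithfulness is inherited
(`tensorRep_jointly_faithful`). Finally, the extension of D → M(D ×_η G) to M(D) makes sense only if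
that map is nondegenerate; this comes from the commutation relation `jG_mul_jB_mem_closure`. -/

lemma continuous_hom (φ : A →⋆ₙₐ[ℂ] E) : Continuous φ :=
  AddMonoidHomClass.continuous_of_bound φ 1 fun a => by
    simpa using NonUnitalStarAlgHom.norm_apply_le φ a

/-- A `*`-homomorphism as a continuous linear map. -/
def homCLM (φ : A →⋆ₙₐ[ℂ] E) : A →L[ℂ] E :=
  LinearMap.mkContinuous
    { toFun := φ, map_add' := map_add φ, map_smul' := map_smul φ } 1 fun a => by
    simpa using NonUnitalStarAlgHom.norm_apply_le φ a

@[simp] lemma homCLM_apply (φ : A →⋆ₙₐ[ℂ] E) (a : A) : homCLM φ a = φ a := rfl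

variable (A) in
lemma exists_approxUnit : ∃ l : Filter A, l.NeBot ∧ (∀ a, Tendsto (fun e => e * a) l (𝓝 a)) ∧
    (∀ a, Tendsto (fun e => a * e) l (𝓝 a)) ∧ ∀ᶠ e in l, ‖e‖ ≤ 1 := by
  letI := CStarAlgebra.spectralOrder A
  haveI := CStarAlgebra.spectralOrderedRing A
  have h := CStarAlgebra.increasingApproximateUnit A
  exact ⟨CStarAlgebra.approximateUnit A, h.neBot, h.tendsto_mul_right, h.tendsto_mul_left,
    h.eventually_norm⟩

lemma eq_of_forall_mul_left {y z : A} (h : ∀ x : A, x * y = x * z) : y = z := by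
  have := h (star (y - z))
  rw [← sub_eq_zero, ← mul_sub, CStarRing.star_mul_self_eq_zero_iff] at this
  exact sub_eq_zero.1 this

lemma eq_of_forall_mul_right {y z : A} (h : ∀ x : A, y * x = z * x) : y = z := by
  have := h (star (y - z))
  rw [← sub_eq_zero, ← sub_mul, CStarRing.mul_star_self_eq_zero_iff] at this
  exact sub_eq_zero.1 this

lemma mem_closure_mul {S : Set A} (hS : ∀ e a : A, e * a ∈ S) (a : A) : a ∈ closure S := by
  obtain ⟨l, hl, h, -, -⟩ := exists_approxUnit A
  exact mem_closure_of_tendsto (h a) (Eventually.of_forall fun e => hS e a)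

/-- Centrality determines the right action from the left one, so only left actions are compared from
here on. -/
lemma mult_ext {m n : 𝓜(ℂ, A)} (h : ∀ a, m.fst a = n.fst a) : m = n := by
  refine DoubleCentralizer.ext _ _ _ _ (Prod.ext (ContinuousLinearMap.ext h)
    (ContinuousLinearMap.ext fun a => ?_))
  refine eq_of_forall_mul_right fun x => ?_
  rw [m.central, n.central, h]

lemma fst_mul (m : 𝓜(ℂ, A)) (a b : A) : m.fst (a * b) = m.fst a * b := by
  refine eq_of_forall_mul_left fun x => ?_
  rw [← m.central, ← mul_assoc, m.central, mul_assoc]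

lemma snd_mul (m : 𝓜(ℂ, A)) (a b : A) : m.snd (a * b) = a * m.snd b := by
  refine eq_of_forall_mul_right fun x => ?_
  rw [m.central, mul_assoc, mul_assoc, m.central]

lemma mul_incl (m : 𝓜(ℂ, A)) (a : A) : m * incl A a = incl A (m.fst a) :=
  mult_ext fun x => fst_mul m a x

lemma incl_mul (m : 𝓜(ℂ, A)) (a : A) : incl A a * m = incl A (m.snd a) :=
  mult_ext fun x => (m.central a x).symm

lemma incl_fst (a b : A) : (incl A a).fst b = a * b := rfl

lemma mul_fst_apply (m n : 𝓜(ℂ, A)) (a : A) : (m * n).fst a = m.fst (n.fst a) := rfl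

lemma incl_injective : Function.Injective (incl A) := fun a b h =>
  eq_of_forall_mul_right fun x => by
    rw [← incl_fst, h, incl_fst]

lemma norm_fst_apply_le (m : 𝓜(ℂ, A)) (a : A) : ‖m.fst a‖ ≤ ‖m‖ * ‖a‖ :=
  (m.fst.le_opNorm a).trans_eq (by rw [DoubleCentralizer.norm_fst])

/-- Two homomorphisms agreeing on a generating set agree. -/
lemma hom_ext_of_generators {s : Set A}
    (hs : Dense (NonUnitalStarAlgebra.adjoin ℂ s : Set A))
    {φ ψ : A →⋆ₙₐ[ℂ] E} (h : ∀ x ∈ s, φ x = ψ x) : φ = ψ := by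
  have h1 : ∀ x ∈ NonUnitalStarAlgebra.adjoin ℂ s, φ x = ψ x := by
    intro x hx
    induction hx using NonUnitalStarAlgebra.adjoin_induction with
    | mem y hy => exact h y hy
    | add y z _ _ hy hz => rw [map_add, map_add, hy, hz]
    | zero => rw [map_zero, map_zero]
    | mul y z _ _ hy hz => rw [map_mul, map_mul, hy, hz]
    | smul c y _ hy => rw [map_smul, map_smul, hy]
    | star y _ hy => rw [map_star, map_star, hy]
  refine NonUnitalStarAlgHom.ext fun x => ?_
  have hx : x ∈ closure (NonUnitalStarAlgebra.adjoin ℂ s : Set A) := hs x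
  exact (isClosed_eq (continuous_hom φ) (continuous_hom ψ)).closure_subset_iff.2 h1 hx

/-- The generators of a closed subalgebra, seen inside of it, generate it. -/
lemma generators_subtype (s : Set A) :
    Dense (NonUnitalStarAlgebra.adjoin ℂ
      {y : (NonUnitalStarAlgebra.adjoin ℂ s).topologicalClosure | (y : A) ∈ s} :
        Set (NonUnitalStarAlgebra.adjoin ℂ s).topologicalClosure) := by
  set S := (NonUnitalStarAlgebra.adjoin ℂ s).topologicalClosure with hS
  set T := NonUnitalStarAlgebra.adjoin ℂ {y : S | (y : A) ∈ s}
  have hle : NonUnitalStarAlgebra.adjoin ℂ s ≤ S := NonUnitalStarSubalgebra.le_topologicalClosure _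
  have key : ∀ y ∈ NonUnitalStarAlgebra.adjoin ℂ s, ∃ z ∈ T, (z : A) = y := by
    intro y hy
    induction hy using NonUnitalStarAlgebra.adjoin_induction with
    | mem y hy => exact ⟨⟨y, hle (NonUnitalStarAlgebra.subset_adjoin ℂ _ hy)⟩,
        NonUnitalStarAlgebra.subset_adjoin ℂ _ hy, rfl⟩
    | add y z _ _ hy hz =>
      obtain ⟨y, hy, rfl⟩ := hy; obtain ⟨z, hz, rfl⟩ := hz
      exact ⟨y + z, add_mem hy hz, rfl⟩
    | zero => exact ⟨0, zero_mem _, rfl⟩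
    | mul y z _ _ hy hz =>
      obtain ⟨y, hy, rfl⟩ := hy; obtain ⟨z, hz, rfl⟩ := hz
      exact ⟨y * z, mul_mem hy hz, rfl⟩
    | smul c y _ hy =>
      obtain ⟨y, hy, rfl⟩ := hy
      exact ⟨c • y, SMulMemClass.smul_mem c hy, rfl⟩
    | star y _ hy =>
      obtain ⟨y, hy, rfl⟩ := hy
      exact ⟨star y, star_mem hy, rfl⟩
  intro x
  have hx : (x : A) ∈ closure (NonUnitalStarAlgebra.adjoin ℂ s : Set A) := x.2
  rw [closure_subtype]
  refine closure_mono ?_ hx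
  intro y hy
  obtain ⟨z, hz, rfl⟩ := key y hy
  exact ⟨z, hz, rfl⟩

end Basics

/-! ### Turning operators that multiply a subalgebra into itself into multipliers. -/

section Lift

variable {A : Type*} {B : Type*} {P : Type*} [NonUnitalCStarAlgebra A] [NonUnitalCStarAlgebra B]
  [NonUnitalCStarAlgebra P]

/-- An element of `P` multiplying the image of an injective homomorphism `ι : B → P` into itself
gives a multiplier of `B`. -/
lemma exists_multiplier (ι : B →⋆ₙₐ[ℂ] P) (hι : Function.Injective ι) (p : P)
    (hl : ∀ b, p * ι b ∈ Set.range ι) (hr : ∀ b, ι b * p ∈ Set.range ι) :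
    ∃ m : 𝓜(ℂ, B), (∀ b, ι (m.fst b) = p * ι b) ∧ ∀ b, ι (m.snd b) = ι b * p := by
  choose L hL using hl
  choose R hR using hr
  have hn : ∀ b, ‖ι b‖ = ‖b‖ := NonUnitalStarAlgHom.norm_map ι hι
  refine ⟨⟨⟨LinearMap.mkContinuous ⟨⟨L, ?_⟩, ?_⟩ ‖p‖ ?_,
    LinearMap.mkContinuous ⟨⟨R, ?_⟩, ?_⟩ ‖p‖ ?_⟩, ?_⟩, hL, hR⟩
  · exact fun x y => hι (by rw [map_add, hL, hL, hL, map_add, mul_add])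
  · exact fun c x => hι (by simp only [hL, map_smul, RingHom.id_apply, mul_smul_comm])
  · intro x
    change ‖L x‖ ≤ _
    rw [← hn, hL, ← hn x]; exact norm_mul_le _ _
  · exact fun x y => hι (by rw [map_add, hR, hR, hR, map_add, add_mul])
  · exact fun c x => hι (by simp only [hR, map_smul, RingHom.id_apply, smul_mul_assoc])
  · intro x
    change ‖R x‖ ≤ _
    rw [← hn, hR, ← hn x, mul_comm]; exact norm_mul_le _ _
  · intro x y
    change R x * y = x * L y
    exact hι (by rw [map_mul, map_mul, hR, hL, mul_assoc])

/-- A homomorphism `Θ : A → P` whose values multiply the image of an injective homomorphism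
`ι : B → P` into itself gives a homomorphism `A → M(B)`. -/
lemma exists_lift_multiplier (ι : B →⋆ₙₐ[ℂ] P) (hι : Function.Injective ι) (Θ : A →⋆ₙₐ[ℂ] P)
    (hl : ∀ a b, Θ a * ι b ∈ Set.range ι) :
    ∃ φ : A →⋆ₙₐ[ℂ] 𝓜(ℂ, B), ∀ a b, ι ((φ a).fst b) = Θ a * ι b := by
  have hr : ∀ a b, ι b * Θ a ∈ Set.range ι := by
    intro a b
    obtain ⟨c, hc⟩ := hl (star a) (star b)
    refine ⟨star c, ?_⟩
    rw [map_star, hc, star_mul, map_star, map_star, star_star, star_star]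
  choose f hf hf' using fun a => exists_multiplier ι hι (Θ a) (hl a) (hr a)
  refine ⟨⟨⟨⟨⟨f, ?_⟩, ?_, ?_⟩, ?_⟩, ?_⟩, hf⟩
  · intro c a
    refine mult_ext fun b => hι ?_
    simp only [hf, map_smul, DoubleCentralizer.smul_fst, smul_apply,
      smul_mul_assoc, MonoidHom.id_apply]
  · refine mult_ext fun b => hι ?_
    simp only [hf, map_zero, zero_mul, DoubleCentralizer.zero_fst, zero_apply]
  · intro a a'
    refine mult_ext fun b => hι ?_
    change ι ((f (a + a')).fst b) = ι ((f a).fst b + (f a').fst b)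
    rw [map_add, hf, hf, hf, map_add, add_mul]
  · intro a a'
    refine mult_ext fun b => hι ?_
    change ι ((f (a * a')).fst b) = ι ((f a).fst ((f a').fst b))
    rw [hf, hf, hf, map_mul, mul_assoc]
  · intro a
    refine mult_ext fun b => hι ?_
    change ι ((f (star a)).fst b) = ι ((star (f a)).fst b)
    rw [DoubleCentralizer.star_fst, map_star, hf, hf', star_mul, map_star, map_star, star_star]

end Lift

/-! ### Homomorphisms obtained from their graphs. -/

section Graph

variable {X : Type*} {Y : Type*} [NonUnitalCStarAlgebra X] [NonUnitalCStarAlgebra Y]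

/-- If the `*`-algebra generated by a set `s` of pairs is the graph of a contraction, then there is
a homomorphism mapping `p.1` to `p.2` for all `p ∈ s`. -/
lemma exists_hom_of_graph (s : Set (X × Y))
    (hs : Dense (NonUnitalStarAlgebra.adjoin ℂ (Prod.fst '' s) : Set X))
    (h : ∀ p ∈ NonUnitalStarAlgebra.adjoin ℂ s, ‖p.2‖ ≤ ‖p.1‖) :
    ∃ Φ : X →⋆ₙₐ[ℂ] Y, ∀ p ∈ s, Φ p.1 = p.2 := by
  set S := (NonUnitalStarAlgebra.adjoin ℂ s).topologicalClosure with hS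
  haveI hcl : IsClosed (S : Set (X × Y)) := NonUnitalStarSubalgebra.isClosed_topologicalClosure _
  letI : NonUnitalCStarAlgebra S := NonUnitalStarSubalgebra.nonUnitalCStarAlgebra S
  have hmem : ∀ p ∈ s, p ∈ S := fun p hp => NonUnitalStarSubalgebra.le_topologicalClosure _
    (NonUnitalStarAlgebra.subset_adjoin ℂ _ hp)
  have h' : ∀ p ∈ S, ‖p.2‖ ≤ ‖p.1‖ := by
    intro p hp
    have hp' : p ∈ closure (NonUnitalStarAlgebra.adjoin ℂ s : Set (X × Y)) := hp
    exact (isClosed_le (f := fun p : X × Y => ‖p.2‖) (g := fun p => ‖p.1‖) (by fun_prop)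
      (by fun_prop)).closure_subset_iff.2 h hp'
  let F : S →⋆ₙₐ[ℂ] X := (NonUnitalStarAlgHom.fst ℂ X Y).comp
    (NonUnitalStarSubalgebraClass.subtype S)
  -- The contraction bound makes the closed graph single-valued.
  have hFinj : Function.Injective F := by
    rw [injective_iff_map_eq_zero]
    intro p hp
    have h1 : p.1.1 = 0 := hp
    have h2 := h' p.1 p.2
    rw [h1, norm_zero, norm_le_zero_iff] at h2
    exact Subtype.ext (Prod.ext h1 h2)
  -- The range is closed, as for every `*`-homomorphism, and contains a dense subalgebra.
  have hFsurj : Function.Surjective F := by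
    intro x
    have h1 : (NonUnitalStarAlgebra.adjoin ℂ (Prod.fst '' s)).topologicalClosure ≤
        NonUnitalStarAlgHom.range F := by
      refine NonUnitalStarSubalgebra.topologicalClosure_minimal _ ?_ (isClosed_range F)
      rw [NonUnitalStarAlgebra.adjoin_le_iff]
      rintro _ ⟨p, hp, rfl⟩
      exact ⟨⟨p, hmem p hp⟩, rfl⟩
    exact h1 (hs x)
  let e := StarAlgEquiv.ofBijective F ⟨hFinj, hFsurj⟩
  refine ⟨((NonUnitalStarAlgHom.snd ℂ X Y).comp (NonUnitalStarSubalgebraClass.subtype S)).comp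
    (e.symm : X →⋆ₙₐ[ℂ] S), fun p hp => ?_⟩
  have h1 : e.symm p.1 = ⟨p, hmem p hp⟩ := by
    rw [StarAlgEquiv.symm_apply_eq]; rfl
  change ((e.symm p.1 : S) : X × Y).2 = p.2
  rw [h1]

end Graph

/-! ### Nondegenerate representations and their extension to multipliers. -/

section HilbertReps

variable {A : Type*} [NonUnitalCStarAlgebra A]
variable {H : Type*} [NormedAddCommGroup H] [InnerProductSpace ℂ H] [CompleteSpace H]

/-- A representation on a Hilbert space is nondegenerate if the vectors `σ(a) x` span a dense
subspace. -/
def NondegRep (σ : A →⋆ₙₐ[ℂ] (H →L[ℂ] H)) : Prop :=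
  Dense (Submodule.span ℂ {y : H | ∃ a x, y = σ a x} : Set H)

lemma inner_hom_apply (σ : A →⋆ₙₐ[ℂ] (H →L[ℂ] H)) (a : A) (x y : H) :
    inner ℂ (σ a x) y = inner ℂ x (σ (star a) y) := by
  rw [map_star, ContinuousLinearMap.star_eq_adjoint, ContinuousLinearMap.adjoint_inner_right]

/-- Because the range of σ is closed under adjoints, the orthogonal complement of its vectors is the
common kernel of the operators. -/
lemma nondegRep_iff {σ : A →⋆ₙₐ[ℂ] (H →L[ℂ] H)} :
    NondegRep σ ↔ ∀ x, (∀ a, σ a x = 0) → x = 0 := by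
  rw [NondegRep, Submodule.dense_iff_topologicalClosure_eq_top,
    Submodule.topologicalClosure_eq_top_iff, Submodule.eq_bot_iff]
  refine forall_congr' fun x => imp_congr_left ?_
  rw [Submodule.mem_orthogonal]
  constructor
  · intro h a
    have := h (σ (star a) (σ a x)) (Submodule.subset_span ⟨_, _, rfl⟩)
    rwa [inner_hom_apply, star_star, inner_self_eq_zero] at this
  · intro h y hy
    induction hy using Submodule.span_induction with
    | mem y hy => obtain ⟨a, z, rfl⟩ := hy; rw [inner_hom_apply, h, inner_zero_right]
    | zero => simp
    | add y z _ _ hy hz => rw [inner_add_left, hy, hz, add_zero]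
    | smul c y _ hy => rw [inner_smul_left, hy, mul_zero]

lemma NondegRep.clm_ext {σ : A →⋆ₙₐ[ℂ] (H →L[ℂ] H)} (hσ : NondegRep σ)
    {F : Type*} [NormedAddCommGroup F] [NormedSpace ℂ F] {S T : H →L[ℂ] F}
    (h : ∀ a x, S (σ a x) = T (σ a x)) : S = T := by
  refine ContinuousLinearMap.ext_on hσ ?_
  rintro _ ⟨a, x, rfl⟩
  exact h a x

/-- The linear map `a ⊗ x ↦ σ(a) x`. -/
def actionMap (σ : A →ₗ[ℂ] (H →L[ℂ] H)) : A ⊗[ℂ] H →ₗ[ℂ] H :=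
  TensorProduct.lift
    { toFun := fun a => (σ a : H →ₗ[ℂ] H)
      map_add' := fun a b => by rw [map_add]; rfl
      map_smul' := fun c a => by rw [map_smul]; rfl }

lemma actionMap_tmul (σ : A →ₗ[ℂ] (H →L[ℂ] H)) (a : A) (x : H) :
    actionMap σ (a ⊗ₜ x) = σ a x := rfl

lemma NondegRep.denseRange {σ : A →⋆ₙₐ[ℂ] (H →L[ℂ] H)} (hσ : NondegRep σ) :
    DenseRange (actionMap (homCLM σ : A →ₗ[ℂ] (H →L[ℂ] H))) := by
  refine Dense.mono ?_ hσ
  change ((Submodule.span ℂ {y : H | ∃ a x, y = σ a x} : Submodule ℂ H) : Set H) ⊆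
    (LinearMap.range (actionMap (homCLM σ : A →ₗ[ℂ] (H →L[ℂ] H))) : Set H)
  rw [SetLike.coe_subset_coe, Submodule.span_le]
  rintro _ ⟨a, x, rfl⟩
  exact ⟨a ⊗ₜ x, rfl⟩

/-- This makes σ(a)x ↦ σ(ma)x well defined and bounded on the span of all σ(a)x: the right side is
the limit of σ(me)σ(a)x along an approximate unit, and each σ(me) has norm at most ‖m‖. -/
lemma norm_actionMap_le (σ : A →⋆ₙₐ[ℂ] (H →L[ℂ] H)) (m : 𝓜(ℂ, A)) (t : A ⊗[ℂ] H) :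
    ‖actionMap (homCLM σ ∘L m.fst : A →L[ℂ] (H →L[ℂ] H)).toLinearMap t‖ ≤
      ‖m‖ * ‖actionMap (homCLM σ : A →ₗ[ℂ] (H →L[ℂ] H)) t‖ := by
  obtain ⟨l, hl, h1, -, h2⟩ := exists_approxUnit A
  have h : Tendsto (fun e => σ (m.fst e) (actionMap (homCLM σ : A →ₗ[ℂ] (H →L[ℂ] H)) t)) l
      (𝓝 (actionMap (homCLM σ ∘L m.fst : A →L[ℂ] (H →L[ℂ] H)).toLinearMap t)) := by
    induction t using TensorProduct.induction_on with
    | zero => simp only [map_zero]; exact tendsto_const_nhds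
    | tmul a x =>
      simp only [actionMap_tmul]
      have : ∀ e, σ (m.fst e) (σ a x) = (homCLM σ ∘L m.fst) (e * a) x := fun e => by
        simp [fst_mul]
      change Tendsto (fun e => σ (m.fst e) (σ a x)) l (𝓝 ((homCLM σ ∘L m.fst) a x))
      simp only [this]
      exact ((((homCLM σ ∘L m.fst).flip x).continuous.tendsto a).comp (h1 a))
    | add s t hs ht => simp only [map_add]; exact hs.add ht
  refine le_of_tendsto h.norm (h2.mono fun e he => ?_)
  refine (ContinuousLinearMap.le_opNorm _ _).trans ?_
  gcongr
  refine (NonUnitalStarAlgHom.norm_apply_le σ _).trans ((norm_fst_apply_le m e).trans ?_)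
  exact mul_le_of_le_one_right (norm_nonneg _) he

/-- The operator `σ̄(m)`, for a nondegenerate representation `σ` and a multiplier `m`. -/
def extOp (σ : A →⋆ₙₐ[ℂ] (H →L[ℂ] H)) (m : 𝓜(ℂ, A)) : H →L[ℂ] H :=
  (actionMap (homCLM σ ∘L m.fst : A →L[ℂ] (H →L[ℂ] H)).toLinearMap).extendOfNorm
    (actionMap (homCLM σ : A →ₗ[ℂ] (H →L[ℂ] H)))

lemma extOp_apply {σ : A →⋆ₙₐ[ℂ] (H →L[ℂ] H)} (hσ : NondegRep σ) (m : 𝓜(ℂ, A)) (a : A) (x : H) :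
    extOp σ m (σ a x) = σ (m.fst a) x :=
  LinearMap.extendOfNorm_eq hσ.denseRange ⟨‖m‖, norm_actionMap_le σ m⟩ (a ⊗ₜ x)

/-- The extension of a nondegenerate representation to the multiplier algebra. -/
def ext (σ : A →⋆ₙₐ[ℂ] (H →L[ℂ] H)) (hσ : NondegRep σ) : 𝓜(ℂ, A) →⋆ₙₐ[ℂ] (H →L[ℂ] H) where
  toFun := extOp σ
  map_smul' c m := hσ.clm_ext fun a x => by
    rw [extOp_apply hσ, MonoidHom.id_apply, smul_apply, extOp_apply hσ]
    change σ (c • m.fst a) x = _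
    rw [map_smul]; rfl
  map_zero' := hσ.clm_ext fun a x => by
    rw [extOp_apply hσ]
    change σ 0 x = _
    rw [map_zero]; rfl
  map_add' m n := hσ.clm_ext fun a x => by
    rw [extOp_apply hσ, add_apply, extOp_apply hσ, extOp_apply hσ]
    change σ (m.fst a + n.fst a) x = _
    rw [map_add]; rfl
  map_mul' m n := hσ.clm_ext fun a x => by
    rw [extOp_apply hσ, mul_fst_apply, mul_apply_eq_comp, extOp_apply hσ,
      extOp_apply hσ]
  map_star' m := by
    refine hσ.clm_ext fun a x => ?_
    have hd : DenseRange (actionMap (homCLM σ : A →ₗ[ℂ] (H →L[ℂ] H))) := hσ.denseRange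
    refine hd.eq_of_inner_right ℂ ?_
    intro t
    induction t using TensorProduct.induction_on with
    | zero => simp
    | add s t hs ht => rw [map_add, inner_add_left, inner_add_left, hs, ht]
    | tmul b y =>
      rw [actionMap_tmul]
      change inner ℂ (σ b y) _ = inner ℂ (σ b y) _
      rw [extOp_apply hσ, ContinuousLinearMap.star_eq_adjoint,
        ContinuousLinearMap.adjoint_inner_right, extOp_apply hσ, inner_hom_apply, inner_hom_apply,
        ← mul_apply_eq_comp, ← mul_apply_eq_comp, ← map_mul, ← map_mul,
        ← (star m).central, DoubleCentralizer.star_snd, star_star]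

section Ext

variable {σ : A →⋆ₙₐ[ℂ] (H →L[ℂ] H)} (hσ : NondegRep σ)

lemma ext_apply (m : 𝓜(ℂ, A)) (a : A) (x : H) : ext σ hσ m (σ a x) = σ (m.fst a) x :=
  extOp_apply hσ m a x

lemma ext_mul (m : 𝓜(ℂ, A)) (a : A) : ext σ hσ m * σ a = σ (m.fst a) :=
  ContinuousLinearMap.ext fun x => ext_apply hσ m a x

lemma ext_incl (a : A) : ext σ hσ (incl A a) = σ a :=
  hσ.clm_ext fun b x => by rw [ext_apply, incl_fst, map_mul]; rfl

lemma ext_one : ext σ hσ 1 = 1 :=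
  hσ.clm_ext fun b x => by rw [ext_apply]; rfl

lemma ext_unique {m : 𝓜(ℂ, A)} {T : H →L[ℂ] H} (h : ∀ a x, T (σ a x) = σ (m.fst a) x) :
    ext σ hσ m = T :=
  hσ.clm_ext fun b x => by rw [ext_apply, h]

lemma ext_injective (h : Function.Injective σ) : Function.Injective (ext σ hσ) := fun m n hmn =>
  mult_ext fun a => h (by rw [← ext_mul hσ, hmn, ext_mul])

variable {B : Type*} [NonUnitalCStarAlgebra B]

/-- The composition of a nondegenerate homomorphism with a nondegenerate representation is
nondegenerate. -/
lemma nondegRep_comp {φ : B →⋆ₙₐ[ℂ] 𝓜(ℂ, A)} (hφ : Nondegenerate φ) :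
    NondegRep ((ext σ hσ).comp φ) := by
  rw [nondegRep_iff]
  intro x hx
  refine nondegRep_iff.1 hσ x fun a => ?_
  -- Moving φ(b) to the other side shows that x is orthogonal to σ(φ(b)a)z; the elements φ(b)a span
  -- a dense subspace, so x is orthogonal to every σ(a)z.
  have h : ∀ z, (innerSL ℂ x) ∘L ((homCLM σ).flip z) = 0 := fun z => by
    refine ContinuousLinearMap.ext_on hφ ?_
    rintro _ ⟨b, a, rfl⟩
    change inner ℂ x (σ ((φ b).fst a) z) = 0
    have h1 : inner ℂ (((ext σ hσ).comp φ) (star b) x) (σ a z) = (0 : ℂ) := by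
      rw [hx, inner_zero_left]
    rwa [inner_hom_apply, star_star, NonUnitalStarAlgHom.comp_apply, ext_apply] at h1
  have h2 : inner ℂ x (σ (star a) (σ a x)) = (0 : ℂ) := congrArg (fun T => T (star a)) (h (σ a x))
  rwa [← inner_hom_apply, inner_self_eq_zero] at h2

end Ext

/-- A homomorphism with surjective composition is nondegenerate with it. -/
lemma NondegRep.of_surjective {B : Type*} [NonUnitalCStarAlgebra B] {σ : B →⋆ₙₐ[ℂ] (H →L[ℂ] H)}
    {p : A →⋆ₙₐ[ℂ] B} (h : NondegRep (σ.comp p)) : NondegRep σ :=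
  nondegRep_iff.2 fun x hx => nondegRep_iff.1 h x fun a => hx (p a)

end HilbertReps

/-! ### The universal representation: nondegenerate, faithful, and rich in intertwiners. -/

section Universal

open scoped ComplexOrder

variable {A : Type*} [NonUnitalCStarAlgebra A]
variable {H : Type*} [NormedAddCommGroup H] [InnerProductSpace ℂ H] [CompleteSpace H]

variable (A) in
/-- The universal representation as a `*`-homomorphism. -/
def univHom : A →⋆ₙₐ[ℂ] (UnivSpace A →L[ℂ] UnivSpace A) where
  toFun := univRep
  map_smul' c a := ContinuousLinearMap.ext fun x => lp.ext (funext fun f => by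
    change f.rep (c • a) (x.1 f) = c • f.rep a (x.1 f)
    rw [map_smul]; rfl)
  map_zero' := ContinuousLinearMap.ext fun x => lp.ext (funext fun f => by
    change f.rep 0 (x.1 f) = 0
    rw [map_zero]; rfl)
  map_add' a b := ContinuousLinearMap.ext fun x => lp.ext (funext fun f => by
    change f.rep (a + b) (x.1 f) = f.rep a (x.1 f) + f.rep b (x.1 f)
    rw [map_add]; rfl)
  map_mul' a b := ContinuousLinearMap.ext fun x => lp.ext (funext fun f => by
    change f.rep (a * b) (x.1 f) = f.rep a (f.rep b (x.1 f))
    rw [map_mul]; rfl)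
  map_star' a := by
    rw [ContinuousLinearMap.star_eq_adjoint, ContinuousLinearMap.eq_adjoint_iff]
    intro x y
    refine (lp.inner_eq_tsum _ _).trans (Eq.trans ?_ (lp.inner_eq_tsum _ _).symm)
    refine tsum_congr fun f => ?_
    change inner ℂ (f.rep (star a) (x.1 f)) (y.1 f) = inner ℂ (x.1 f) (f.rep a (y.1 f))
    rw [inner_hom_apply, star_star]

lemma univHom_apply_apply (a : A) (ξ : UnivSpace A) (f : PosFunctional A) :
    (univHom A a ξ).1 f = f.rep a (ξ.1 f) := rfl

/-- The class of `a` in the GNS space. -/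
def PosFunctional.cls (f : PosFunctional A) : A →L[ℂ] f.Space :=
  letI := CStarAlgebra.spectralOrder A
  haveI := CStarAlgebra.spectralOrderedRing A
  { toLinearMap := (UniformSpace.Completion.toComplL : f.PreGNS →L[ℂ] f.Space).toLinearMap ∘ₗ
      f.toPreGNS.toLinearMap
    cont := by
      refine UniformSpace.Completion.continuous_coe _ |>.comp ?_
      refine continuous_of_continuousAt_zero f.toPreGNS.toLinearMap.toAddMonoidHom ?_
      have hc : Continuous fun a : A => f (star a * a) := (map_continuous f).comp (by fun_prop)
      have h : Continuous fun a : A => ‖f.toPreGNS a‖ := by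
        simp only [PositiveLinearMap.preGNS_norm_def]
        exact Real.continuous_sqrt.comp (Complex.continuous_re.comp hc)
      rw [ContinuousAt, map_zero, tendsto_zero_iff_norm_tendsto_zero]
      simpa using h.tendsto 0 }

lemma PosFunctional.rep_cls (f : PosFunctional A) (a b : A) : f.rep a (f.cls b) = f.cls (a * b) :=
  letI := CStarAlgebra.spectralOrder A
  haveI := CStarAlgebra.spectralOrderedRing A
  PositiveLinearMap.gnsNonUnitalStarAlgHom_apply_coe f

lemma PosFunctional.denseRange_cls (f : PosFunctional A) : DenseRange f.cls :=
  letI := CStarAlgebra.spectralOrder A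
  haveI := CStarAlgebra.spectralOrderedRing A
  UniformSpace.Completion.denseRange_coe (α := f.PreGNS)

lemma PosFunctional.norm_cls_sq (f : PosFunctional A) (a : A) :
    ((‖f.cls a‖ ^ 2 : ℝ) : ℂ) = f (star a * a) := by
  letI := CStarAlgebra.spectralOrder A
  haveI := CStarAlgebra.spectralOrderedRing A
  have h : ‖f.cls a‖ = ‖f.toPreGNS a‖ := UniformSpace.Completion.norm_coe _
  rw [h, Complex.ofReal_pow]
  exact f.preGNS_norm_sq (f.toPreGNS a)

variable (A) in
-- A vector killed by A has GNS components orthogonal to all classes of eb, and these tend to the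
-- class of b along an approximate unit.
lemma nondegRep_univHom : NondegRep (univHom A) := by
  rw [nondegRep_iff]
  intro ξ hξ
  refine lp.ext (funext fun f => ?_)
  change ξ.1 f = 0
  have h0 : ∀ a, f.rep a (ξ.1 f) = 0 := fun a => by
    rw [← univHom_apply_apply, hξ]; rfl
  have h1 : ∀ b, inner ℂ (f.cls b) (ξ.1 f) = (0 : ℂ) := by
    intro b
    obtain ⟨l, hl, h, -, -⟩ := exists_approxUnit A
    have h2 : Tendsto (fun e => inner ℂ (f.cls (e * b)) (ξ.1 f)) l
        (𝓝 (inner ℂ (f.cls b) (ξ.1 f))) :=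
      (((f.cls.continuous.tendsto b).comp (h b))).inner tendsto_const_nhds
    refine tendsto_nhds_unique h2 ?_
    have : ∀ e, inner ℂ (f.cls (e * b)) (ξ.1 f) = (0 : ℂ) := fun e => by
      rw [← f.rep_cls, inner_hom_apply, h0, inner_zero_right]
    simp only [this]
    exact tendsto_const_nhds
  exact f.denseRange_cls.eq_zero_of_inner_right ℂ h1

/-- Positive functionals separate the positive elements from zero. -/
lemma exists_posFunctional (b : A) (hb : b ≠ 0) : ∃ f : PosFunctional A, f (star b * b) ≠ 0 := by
  letI := CStarAlgebra.spectralOrder A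
  haveI := CStarAlgebra.spectralOrderedRing A
  set h := star b * b with hh
  have hpos : 0 ≤ h := star_mul_self_nonneg b
  have hne : h ≠ 0 := by rwa [hh, Ne, CStarRing.star_mul_self_eq_zero_iff]
  have hnot : -h ∉ {a : A | 0 ≤ a} := fun h' => hne (le_antisymm (by simpa using h') hpos)
  have hconv : Convex ℝ {a : A | 0 ≤ a} := by
    intro x hx y hy s t hs ht _
    exact add_nonneg (smul_nonneg hs (Set.mem_ofPred.1 hx)) (smul_nonneg ht (Set.mem_ofPred.1 hy))
  -- The point `-h` is separated from the closed cone of positive elements; a real functional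
  -- bounded below on a cone is nonnegative there.
  obtain ⟨g, r, h1, h2⟩ := geometric_hahn_banach_point_closed hconv
    CStarAlgebra.isClosed_nonneg hnot
  have hr : r < 0 := by simpa using h2 0 (le_refl (0 : A))
  have hg : ∀ a : A, 0 ≤ a → 0 ≤ g a := by
    intro a ha
    by_contra! hlt
    have := h2 ((r / g a) • a) (smul_nonneg (div_nonneg_of_nonpos hr.le hlt.le) ha)
    rw [map_smul, smul_eq_mul, div_mul_cancel₀ _ hlt.ne] at this
    exact lt_irrefl _ this
  -- Composing with the real part before complexifying keeps the values of `g` on positive elements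
  -- and makes the imaginary contribution there vanish.
  let gr : Module.Dual ℝ A := (g : A →ₗ[ℝ] ℝ) ∘ₗ (selfAdjoint.submodule ℝ A).subtype ∘ₗ realPart
  have hval : ∀ a : A, 0 ≤ a → (gr.extendRCLike : Module.Dual ℂ A) a = g a := by
    intro a ha
    have hsa : IsSelfAdjoint a := IsSelfAdjoint.of_nonneg ha
    have e1 : gr a = g a := by
      change g (realPart a : A) = g a
      rw [hsa.coe_realPart]
    have e2 : gr (Complex.I • a) = 0 := by
      change g (realPart (Complex.I • a) : A) = 0
      rw [realPart_I_smul, hsa.imaginaryPart]; simp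
    rw [Module.Dual.extendRCLike_apply, e1]
    change (g a : ℂ) - Complex.I * (gr (Complex.I • a) : ℝ) = _
    rw [e2]; simp
  let F : A →ₚ[ℂ] ℂ := PositiveLinearMap.mk₀ gr.extendRCLike fun a ha => by
    rw [hval a ha]; exact_mod_cast hg a ha
  refine ⟨F, ?_⟩
  change gr.extendRCLike h ≠ 0
  rw [hval h hpos]
  have : 0 < g h := by rw [map_neg] at h1; linarith
  exact_mod_cast this.ne'

variable (A) in
lemma univHom_injective : Function.Injective (univHom A) := by
  rw [injective_iff_map_eq_zero]
  intro a ha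
  by_contra hne
  -- Without a unit there is no class of `1` to test on; instead the class of `a * star a` is the
  -- image of the class of `star a` under the operator of `a`.
  have hne' : a * star a ≠ 0 := by rwa [Ne, CStarRing.mul_star_self_eq_zero_iff]
  obtain ⟨f, hf⟩ := exists_posFunctional (a * star a) hne'
  have hrep : f.rep a = 0 := by
    refine ContinuousLinearMap.ext fun x => ?_
    classical
    have := congrArg (fun T : UnivSpace A →L[ℂ] UnivSpace A => (T (lp.single 2 f x)).1 f) ha
    have h1 : f.rep a ((lp.single 2 f x : lp (fun f : PosFunctional A => f.Space) 2) f) = 0 := this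
    rwa [lp.single_apply_self] at h1
  apply hf
  rw [← f.norm_cls_sq, ← f.rep_cls, hrep]
  simp

/-- The vector functional of a representation. -/
def vecFunctional (σ : A →⋆ₙₐ[ℂ] (H →L[ℂ] H)) (x : H) : PosFunctional A :=
  letI := CStarAlgebra.spectralOrder A
  haveI := CStarAlgebra.spectralOrderedRing A
  PositiveLinearMap.mk₀ ((innerSL ℂ x) ∘L ((homCLM σ).flip x)).toLinearMap fun a ha => by
    obtain ⟨b, rfl⟩ := CStarAlgebra.nonneg_iff_eq_star_mul_self.1 ha
    change 0 ≤ inner ℂ x (σ (star b * b) x)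
    rw [map_mul]
    change 0 ≤ inner ℂ x (σ (star b) (σ b x))
    rw [← inner_hom_apply, inner_self_eq_norm_sq_to_K]
    norm_cast
    positivity

lemma norm_cls_vecFunctional (σ : A →⋆ₙₐ[ℂ] (H →L[ℂ] H)) (x : H) (a : A) :
    ‖σ a x‖ = ‖(vecFunctional σ x).cls a‖ := by
  have h := (vecFunctional σ x).norm_cls_sq a
  have h2 : vecFunctional σ x (star a * a) = ((‖σ a x‖ ^ 2 : ℝ) : ℂ) := by
    change inner ℂ x (σ (star a * a) x) = _
    rw [map_mul]
    change inner ℂ x (σ (star a) (σ a x)) = _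
    rw [← inner_hom_apply, inner_self_eq_norm_sq_to_K]
    norm_cast
  rw [h2, Complex.ofReal_inj] at h
  exact ((sq_eq_sq₀ (norm_nonneg _) (norm_nonneg _)).1 h).symm

/-- Every vector `σ(a) x` lies in the range of an intertwiner from the universal
representation. -/
lemma exists_intertwiner (σ : A →⋆ₙₐ[ℂ] (H →L[ℂ] H)) (a : A) (x : H) :
    ∃ S : UnivSpace A →L[ℂ] H, (∀ b, S ∘L univRep b = σ b ∘L S) ∧ ∃ ξ, S ξ = σ a x := by
  classical
  set f := vecFunctional σ x
  have hn : ∀ a, ‖((homCLM σ).flip x) a‖ ≤ 1 * ‖f.cls a‖ := fun a => by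
    rw [one_mul]; exact (norm_cls_vecFunctional σ x a).le
  -- The class of a goes to σ(a)x. By the choice of the vector functional this is isometric, and it
  -- intertwines the GNS representation with σ; coordinate projection then leads from the universal
  -- space to the GNS space.
  let S₀ : f.Space →L[ℂ] H :=
    ((homCLM σ).flip x).toLinearMap.extendOfNorm f.cls.toLinearMap
  have hS₀ : ∀ a, S₀ (f.cls a) = σ a x := fun a =>
    LinearMap.extendOfNorm_eq (f := ((homCLM σ).flip x).toLinearMap) (e := f.cls.toLinearMap)
      f.denseRange_cls ⟨1, hn⟩ a
  have hS₁ : ∀ b y, S₀ (f.rep b y) = σ b (S₀ y) := by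
    intro b y
    refine f.denseRange_cls.induction_on (p := fun y => S₀ (f.rep b y) = σ b (S₀ y)) y ?_ ?_
    · exact isClosed_eq (by fun_prop) (by fun_prop)
    · intro c
      rw [f.rep_cls, hS₀, hS₀, map_mul]; rfl
  let ev : UnivSpace A →L[ℂ] f.Space := lp.evalCLM ℂ (fun f : PosFunctional A => f.Space) 2 f
  refine ⟨S₀ ∘L ev, fun b => ContinuousLinearMap.ext fun ξ => hS₁ b (ξ.1 f),
    lp.single 2 f (f.cls a), ?_⟩
  change S₀ ((lp.single 2 f (f.cls a) : lp (fun f : PosFunctional A => f.Space) 2) f) = _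
  rw [lp.single_apply_self, hS₀]

end Universal

/-! ### Hilbert space tensor products and tensor products of operators. -/

section HilbertTensor

variable {H : Type*} [NormedAddCommGroup H] [InnerProductSpace ℂ H]
variable {H' : Type*} [NormedAddCommGroup H'] [InnerProductSpace ℂ H']
variable {H'' : Type*} [NormedAddCommGroup H''] [InnerProductSpace ℂ H'']
variable {K : Type*} [NormedAddCommGroup K] [InnerProductSpace ℂ K]
variable {K' : Type*} [NormedAddCommGroup K'] [InnerProductSpace ℂ K']
variable {K'' : Type*} [NormedAddCommGroup K''] [InnerProductSpace ℂ K'']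
variable {F : Type*} [NormedAddCommGroup F] [NormedSpace ℂ F]

variable (H K) in
/-- The Hilbert space tensor product. -/
def HT : Type _ := UniformSpace.Completion (H ⊗[ℂ] K)

instance : NormedAddCommGroup (HT H K) :=
  inferInstanceAs (NormedAddCommGroup (UniformSpace.Completion (H ⊗[ℂ] K)))
instance : InnerProductSpace ℂ (HT H K) :=
  inferInstanceAs (InnerProductSpace ℂ (UniformSpace.Completion (H ⊗[ℂ] K)))
instance : CompleteSpace (HT H K) :=
  inferInstanceAs (CompleteSpace (UniformSpace.Completion (H ⊗[ℂ] K)))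

variable (H K) in
/-- The embedding of the algebraic tensor product. -/
def htIn : H ⊗[ℂ] K →ₗᵢ[ℂ] HT H K :=
  (UniformSpace.Completion.toComplₗᵢ : H ⊗[ℂ] K →ₗᵢ[ℂ] UniformSpace.Completion (H ⊗[ℂ] K))

variable (H K) in
lemma denseRange_htIn : DenseRange (htIn H K) :=
  UniformSpace.Completion.denseRange_coe (α := H ⊗[ℂ] K)

lemma ht_induction {p : HT H K → Prop} (z : HT H K) (hp : IsClosed {z | p z})
    (h : ∀ t : H ⊗[ℂ] K, p (htIn H K t)) : p z :=
  (denseRange_htIn H K).induction_on z hp h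

/-- Elementary tensors. -/
def htm (x : H) (y : K) : HT H K := htIn H K (x ⊗ₜ[ℂ] y)

/-- The tensor product of two operators. -/
def htop (S : H →L[ℂ] H') (T : K →L[ℂ] K') : HT H K →L[ℂ] HT H' K' :=
  ((TensorProduct.mapL S T).completion :
    UniformSpace.Completion (H ⊗[ℂ] K) →L[ℂ] UniformSpace.Completion (H' ⊗[ℂ] K'))

lemma htop_htIn (S : H →L[ℂ] H') (T : K →L[ℂ] K') (t : H ⊗[ℂ] K) :
    htop S T (htIn H K t) = htIn H' K' (TensorProduct.mapL S T t) :=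
  ContinuousLinearMap.completion_apply_coe (TensorProduct.mapL S T) t

lemma htop_htm (S : H →L[ℂ] H') (T : K →L[ℂ] K') (x : H) (y : K) :
    htop S T (htm x y) = htm (S x) (T y) :=
  htop_htIn S T _

lemma inner_htm (x x' : H) (y y' : K) :
    inner ℂ (htm x y) (htm x' y') = inner ℂ x x' * inner ℂ y y' := by
  rw [htm, htm, LinearIsometry.inner_map_map, TensorProduct.inner_tmul]

lemma norm_htm (x : H) (y : K) : ‖htm x y‖ = ‖x‖ * ‖y‖ := by
  rw [htm, LinearIsometry.norm_map, TensorProduct.norm_tmul]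

variable (H K) in
/-- The bilinear map `(x, y) ↦ x ⊗ y`. -/
def htmL : H →L[ℂ] K →L[ℂ] HT H K :=
  LinearMap.mkContinuous₂ ((TensorProduct.mk ℂ H K).compr₂
    (htIn H K).toLinearMap) 1 fun x y => by
    rw [one_mul]; exact (norm_htm x y).le

/-- If two sets span dense subspaces, so do the tensors of their elements. -/
lemma dense_span_htm {s : Set H} {t : Set K} (hs : Dense (Submodule.span ℂ s : Set H))
    (ht : Dense (Submodule.span ℂ t : Set K)) :
    Dense (Submodule.span ℂ {z : HT H K | ∃ x ∈ s, ∃ y ∈ t, z = htm x y} : Set (HT H K)) := by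
  set P := (Submodule.span ℂ {z : HT H K | ∃ x ∈ s, ∃ y ∈ t, z = htm x y}).topologicalClosure
    with hP
  have hcl : IsClosed (P : Set (HT H K)) := Submodule.isClosed_topologicalClosure _
  have h1 : ∀ x ∈ s, ∀ y, htm x y ∈ P := by
    intro x hx y
    have hc : IsClosed ((P.comap (htmL H K x).toLinearMap : Submodule ℂ K) : Set K) :=
      hcl.preimage (htmL H K x).continuous
    have hle : Submodule.span ℂ t ≤ P.comap (htmL H K x).toLinearMap :=
      Submodule.span_le.2 fun y hy => Submodule.le_topologicalClosure _
        (Submodule.subset_span ⟨x, hx, y, hy, rfl⟩)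
    exact hc.closure_subset_iff.2 hle (ht y)
  have h2 : ∀ x y, htm x y ∈ P := by
    intro x y
    have hc : IsClosed ((P.comap ((htmL H K).flip y).toLinearMap : Submodule ℂ H) : Set H) :=
      hcl.preimage ((htmL H K).flip y).continuous
    have hle : Submodule.span ℂ s ≤ P.comap ((htmL H K).flip y).toLinearMap :=
      Submodule.span_le.2 fun x hx => h1 x hx y
    exact hc.closure_subset_iff.2 hle (hs x)
  have h3 : ∀ z : H ⊗[ℂ] K, htIn H K z ∈ P := by
    intro z
    induction z using TensorProduct.induction_on with
    | zero => rw [map_zero]; exact zero_mem _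
    | tmul x y => exact h2 x y
    | add x y hx hy => rw [map_add]; exact add_mem hx hy
  exact fun z => ht_induction z hcl h3

lemma htm_ext {S T : HT H K →L[ℂ] F} (h : ∀ x y, S (htm x y) = T (htm x y)) : S = T := by
  refine ContinuousLinearMap.ext fun z => ?_
  refine ht_induction z (isClosed_eq S.continuous T.continuous) fun t => ?_
  induction t using TensorProduct.induction_on with
  | zero => simp
  | tmul x y => exact h x y
  | add x y hx hy => rw [map_add, map_add, map_add, hx, hy]

lemma htop_comp (S' : H' →L[ℂ] H'') (S : H →L[ℂ] H') (T' : K' →L[ℂ] K'') (T : K →L[ℂ] K') :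
    htop S' T' ∘L htop S T = htop (S' ∘L S) (T' ∘L T) :=
  htm_ext fun x y => by
    rw [ContinuousLinearMap.comp_apply, htop_htm, htop_htm, htop_htm]; rfl

lemma htop_mul (S' S : H →L[ℂ] H) (T' T : K →L[ℂ] K) :
    htop S' T' * htop S T = htop (S' * S) (T' * T) := htop_comp S' S T' T

lemma htop_one : htop (1 : H →L[ℂ] H) (1 : K →L[ℂ] K) = 1 :=
  htm_ext fun x y => by rw [htop_htm]; rfl

lemma htm_add_left (x x' : H) (y : K) : htm (x + x') y = htm x y + htm x' y :=
  congrArg (fun T => T y) ((htmL H K).map_add x x')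
lemma htm_add_right (x : H) (y y' : K) : htm x (y + y') = htm x y + htm x y' :=
  (htmL H K x).map_add y y'
lemma htm_smul_left (c : ℂ) (x : H) (y : K) : htm (c • x) y = c • htm x y :=
  congrArg (fun T => T y) ((htmL H K).map_smul c x)
lemma htm_smul_right (c : ℂ) (x : H) (y : K) : htm x (c • y) = c • htm x y :=
  (htmL H K x).map_smul c y

lemma htop_add_left (S S' : H →L[ℂ] H') (T : K →L[ℂ] K') :
    htop (S + S') T = htop S T + htop S' T :=
  htm_ext fun x y => by simp only [htop_htm, add_apply, htm_add_left]
lemma htop_add_right (S : H →L[ℂ] H') (T T' : K →L[ℂ] K') :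
    htop S (T + T') = htop S T + htop S T' :=
  htm_ext fun x y => by simp only [htop_htm, add_apply, htm_add_right]
lemma htop_smul_left (c : ℂ) (S : H →L[ℂ] H') (T : K →L[ℂ] K') :
    htop (c • S) T = c • htop S T :=
  htm_ext fun x y => by simp only [htop_htm, smul_apply, htm_smul_left]
lemma htop_smul_right (c : ℂ) (S : H →L[ℂ] H') (T : K →L[ℂ] K') :
    htop S (c • T) = c • htop S T :=
  htm_ext fun x y => by simp only [htop_htm, smul_apply, htm_smul_right]

lemma norm_htop_le (S : H →L[ℂ] H') (T : K →L[ℂ] K') : ‖htop S T‖ ≤ ‖S‖ * ‖T‖ := by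
  refine ContinuousLinearMap.opNorm_le_bound _ (by positivity) fun z => ?_
  refine ht_induction (p := fun z => ‖htop S T z‖ ≤ ‖S‖ * ‖T‖ * ‖z‖) z
    (isClosed_le (by fun_prop) (by fun_prop)) fun t => ?_
  rw [htop_htIn, LinearIsometry.norm_map, LinearIsometry.norm_map]
  exact ((TensorProduct.mapL S T).le_opNorm t).trans
    (by gcongr; exact TensorProduct.norm_mapL_le S T)

/-- Two vectors with the same inner products with elementary tensors agree. -/
lemma eq_of_inner_htm {z z' : HT H K} (h : ∀ x y, inner ℂ (htm x y) z = inner ℂ (htm x y) z') :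
    z = z' := by
  refine (denseRange_htIn H K).eq_of_inner_right ℂ fun t => ?_
  induction t using TensorProduct.induction_on with
  | zero => simp
  | tmul x y => exact h x y
  | add x y hx hy => rw [map_add, inner_add_left, inner_add_left, hx, hy]

variable [CompleteSpace H] [CompleteSpace K] [CompleteSpace H'] [CompleteSpace K']

lemma star_htop (S : H →L[ℂ] H) (T : K →L[ℂ] K) : star (htop S T) = htop (star S) (star T) := by
  refine htm_ext fun x y => eq_of_inner_htm fun x' y' => ?_
  simp only [ContinuousLinearMap.star_eq_adjoint, ContinuousLinearMap.adjoint_inner_right, htop_htm,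
    inner_htm]

/-- Compressing an operator between such a map and its adjoint removes the second tensor factor;
this is how slices are written below. -/
lemma adjoint_htmL_flip (z : K) (x : H) (y : K) :
    ContinuousLinearMap.adjoint ((htmL H K).flip z) (htm x y) = (inner ℂ z y : ℂ) • x := by
  refine ext_inner_left ℂ fun w => ?_
  rw [ContinuousLinearMap.adjoint_inner_right, inner_smul_right]
  change inner ℂ (htm w z) (htm x y) = _
  rw [inner_htm, mul_comm]

lemma adjoint_htmL (z : H) (x : H) (y : K) :
    ContinuousLinearMap.adjoint (htmL H K z) (htm x y) = (inner ℂ z x : ℂ) • y := by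
  refine ext_inner_left ℂ fun w => ?_
  rw [ContinuousLinearMap.adjoint_inner_right, inner_smul_right]
  change inner ℂ (htm z w) (htm x y) = _
  rw [inner_htm]

end HilbertTensor

/-! ### Associativity and flip of Hilbert space tensor products. -/

section TensorIsometries

variable {H : Type*} [NormedAddCommGroup H] [InnerProductSpace ℂ H]
variable {K : Type*} [NormedAddCommGroup K] [InnerProductSpace ℂ K]
variable {L : Type*} [NormedAddCommGroup L] [InnerProductSpace ℂ L]

variable (H K L) in
-- Both sides are completions of the algebraic triple tensor product, embedded isometrically with
-- dense range.
lemma exists_assocHT : ∃ U : HT (HT H K) L ≃ₗᵢ[ℂ] HT H (HT K L),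
    ∀ x y z, U (htm (htm x y) z) = htm x (htm y z) := by
  let e₁ : (H ⊗[ℂ] K) ⊗[ℂ] L →ₗ[ℂ] HT (HT H K) L :=
    (htIn (HT H K) L).toLinearMap ∘ₗ
      TensorProduct.map (htIn H K).toLinearMap LinearMap.id
  let e₂ : (H ⊗[ℂ] K) ⊗[ℂ] L →ₗ[ℂ] HT H (HT K L) :=
    (htIn H (HT K L)).toLinearMap ∘ₗ
      TensorProduct.map LinearMap.id (htIn K L).toLinearMap ∘ₗ
        (TensorProduct.assoc ℂ H K L).toLinearMap
  have hn₁ : ∀ t, ‖e₁ t‖ = ‖t‖ := fun t =>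
    ((htIn _ _).norm_map _).trans
      (TensorProduct.norm_map (htIn H K) (LinearIsometry.id : L →ₗᵢ[ℂ] L) t)
  have hn₂ : ∀ t, ‖e₂ t‖ = ‖t‖ := fun t =>
    ((htIn _ _).norm_map _).trans
      ((TensorProduct.norm_map (LinearIsometry.id : H →ₗᵢ[ℂ] H) (htIn K L) _).trans
        (TensorProduct.norm_assoc t))
  have hd : Dense (Submodule.span ℂ (Set.univ : Set H) : Set H) := by simp
  have hdL : Dense (Submodule.span ℂ (Set.univ : Set L) : Set L) := by simp
  have hdK : Dense (Submodule.span ℂ (Set.univ : Set K) : Set K) := by simp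
  have hd₁ : DenseRange e₁ := by
    refine Dense.mono ?_ (dense_span_htm (dense_span_htm hd hdK) hdL)
    refine Submodule.span_le (p := LinearMap.range e₁) |>.2 ?_
    rintro _ ⟨_, ⟨x, -, y, -, rfl⟩, z, -, rfl⟩
    exact ⟨(x ⊗ₜ y) ⊗ₜ z, rfl⟩
  have hd₂ : DenseRange e₂ := by
    refine Dense.mono ?_ (dense_span_htm hd (dense_span_htm hdK hdL))
    refine Submodule.span_le (p := LinearMap.range e₂) |>.2 ?_
    rintro _ ⟨x, -, _, ⟨y, -, z, -, rfl⟩, rfl⟩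
    exact ⟨(x ⊗ₜ y) ⊗ₜ z, rfl⟩
  have hn : ∀ t, ‖e₂ (LinearEquiv.refl ℂ _ t)‖ = ‖e₁ t‖ := fun t => (hn₂ t).trans (hn₁ t).symm
  exact ⟨(LinearEquiv.refl ℂ _).extendOfIsometry e₁ e₂ hd₁ hd₂ hn, fun x y z =>
    LinearEquiv.extendOfIsometry_eq (LinearEquiv.refl ℂ _) e₁ e₂ hd₁ hd₂ hn ((x ⊗ₜ y) ⊗ₜ z)⟩

variable (H K L) in
/-- The associativity isomorphism of Hilbert space tensor products. -/
def assocHT : HT (HT H K) L ≃ₗᵢ[ℂ] HT H (HT K L) := (exists_assocHT H K L).choose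

lemma assocHT_htm (x : H) (y : K) (z : L) :
    assocHT H K L (htm (htm x y) z) = htm x (htm y z) := (exists_assocHT H K L).choose_spec x y z

variable (H K) in
lemma exists_flipHT : ∃ U : HT H K ≃ₗᵢ[ℂ] HT K H, ∀ x y, U (htm x y) = htm y x := by
  let e₁ : H ⊗[ℂ] K →ₗ[ℂ] HT H K := (htIn H K).toLinearMap
  let e₂ : K ⊗[ℂ] H →ₗ[ℂ] HT K H := (htIn K H).toLinearMap
  have hd₁ : DenseRange e₁ := denseRange_htIn H K
  have hd₂ : DenseRange e₂ := denseRange_htIn K H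
  have hn : ∀ t, ‖e₂ (TensorProduct.comm ℂ H K t)‖ = ‖e₁ t‖ := fun t =>
    ((htIn K H).norm_map _).trans ((TensorProduct.norm_comm t).trans
      ((htIn H K).norm_map _).symm)
  exact ⟨(TensorProduct.comm ℂ H K).extendOfIsometry e₁ e₂ hd₁ hd₂ hn, fun x y =>
    LinearEquiv.extendOfIsometry_eq (TensorProduct.comm ℂ H K) e₁ e₂ hd₁ hd₂ hn (x ⊗ₜ y)⟩

variable (H K) in
/-- The flip. -/
def flipHT : HT H K ≃ₗᵢ[ℂ] HT K H := (exists_flipHT H K).choose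

lemma flipHT_htm (x : H) (y : K) : flipHT H K (htm x y) = htm y x :=
  (exists_flipHT H K).choose_spec x y

end TensorIsometries

/-! ### A contraction criterion from boundedness on a dense set of vectors. -/

section BoundedVectors

variable {X : Type*} [NonUnitalCStarAlgebra X]
variable {K : Type*} [NormedAddCommGroup K] [InnerProductSpace ℂ K] [CompleteSpace K]

/-- If x exceeded y > 0, the powers of x / y would outgrow every constant: taking roots removes `C`.
-/
lemma le_of_pow_two_pow_le {x y C : ℝ} (hy : 0 ≤ y)
    (h : ∀ n : ℕ, x ^ (2 ^ n) ≤ C * y ^ (2 ^ n)) : x ≤ y := by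
  by_contra! hlt
  have hx' : 0 < x := hy.trans_lt hlt
  rcases hy.eq_or_lt with rfl | hy'
  · have := h 0
    simp at this
    linarith
  have h1 : 1 < x / y := (one_lt_div hy').2 hlt
  obtain ⟨n, hn⟩ := pow_unbounded_of_one_lt C h1
  have h2 : (x / y) ^ (2 ^ n) ≤ C := by
    rw [div_pow, div_le_iff₀ (by positivity)]; exact h n
  have h3 : (x / y) ^ n ≤ (x / y) ^ (2 ^ n) := pow_le_pow_right₀ h1.le Nat.lt_two_pow_self.le
  linarith

/-- A `*`-algebra of pairs `(x, T)` for which each vector `ζ` of a dense set has a bound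
`‖T ζ‖ ≤ M ‖x‖` is the graph of a contraction. -/
lemma norm_snd_le_of_bounded_vectors (S : NonUnitalStarSubalgebra ℂ (X × (K →L[ℂ] K)))
    (hd : Dense {ζ : K | ∃ M : ℝ, ∀ p ∈ S, ‖p.2 ζ‖ ≤ M * ‖p.1‖}) :
    ∀ p ∈ S, ‖p.2‖ ≤ ‖p.1‖ := by
  -- Cauchy–Schwarz, which plays the role of the C*-identity at a single vector.
  have hsq : ∀ (p : X × (K →L[ℂ] K)) (ζ : K), ‖p.2 ζ‖ ^ 2 ≤ ‖ζ‖ * ‖(star p * p).2 ζ‖ := by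
    intro p ζ
    have h1 : (‖p.2 ζ‖ ^ 2 : ℝ) = RCLike.re (inner ℂ ζ ((star p * p).2 ζ)) := by
      change _ = RCLike.re (inner ℂ ζ (star p.2 (p.2 ζ)))
      rw [ContinuousLinearMap.star_eq_adjoint, ContinuousLinearMap.adjoint_inner_right,
        inner_self_eq_norm_sq]
    rw [h1]
    exact (RCLike.re_le_norm _).trans (norm_inner_le_norm _ _)
  intro p hp
  refine ContinuousLinearMap.opNorm_le_bound _ (norm_nonneg _) fun ζ => ?_
  refine hd.induction (P := fun ζ => ‖p.2 ζ‖ ≤ ‖p.1‖ * ‖ζ‖) ?_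
    (isClosed_le (by fun_prop) (by fun_prop)) ζ
  rintro ζ ⟨M, hM⟩
  rcases eq_or_ne ζ 0 with rfl | hζ
  · simp
  have hζ' : 0 < ‖ζ‖ := norm_pos_iff.2 hζ
  -- `q n` is the power of `star p * p` with exponent `2 ^ n`, written with `star` so that the
  -- C*-identity for the first component and `hsq` for the second apply at each step.
  let q : ℕ → X × (K →L[ℂ] K) := fun n => Nat.rec (star p * p) (fun _ r => star r * r) n
  have hq0 : q 0 = star p * p := rfl
  have hqs : ∀ n, q (n + 1) = star (q n) * q n := fun n => rfl
  have hqS : ∀ n, q n ∈ S := by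
    intro n
    induction n with
    | zero => exact mul_mem (star_mem hp) hp
    | succ n ih => exact mul_mem (star_mem ih) ih
  have hqn : ∀ n, ‖(q n).1‖ = (‖p.1‖ ^ 2) ^ (2 ^ n) := by
    intro n
    induction n with
    | zero =>
      change ‖star p.1 * p.1‖ = _
      rw [CStarRing.norm_star_mul_self]; ring
    | succ n ih =>
      change ‖star (q n).1 * (q n).1‖ = _
      rw [CStarRing.norm_star_mul_self, ih, ← pow_add]; congr 1; ring
  have hqa : ∀ n, (‖(q 0).2 ζ‖ / ‖ζ‖) ^ (2 ^ n) ≤ ‖(q n).2 ζ‖ / ‖ζ‖ := by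
    intro n
    induction n with
    | zero => simp
    | succ n ih =>
      have h1 := hsq (q n) ζ
      rw [← hqs] at h1
      calc (‖(q 0).2 ζ‖ / ‖ζ‖) ^ (2 ^ (n + 1))
          = ((‖(q 0).2 ζ‖ / ‖ζ‖) ^ (2 ^ n)) ^ 2 := by rw [← pow_mul, pow_succ]
        _ ≤ (‖(q n).2 ζ‖ / ‖ζ‖) ^ 2 := by gcongr
        _ = ‖(q n).2 ζ‖ ^ 2 / ‖ζ‖ ^ 2 := div_pow _ _ _
        _ ≤ (‖ζ‖ * ‖(q (n + 1)).2 ζ‖) / ‖ζ‖ ^ 2 := by gcongr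
        _ = ‖(q (n + 1)).2 ζ‖ / ‖ζ‖ := by field_simp
  have h1 : ‖(q 0).2 ζ‖ / ‖ζ‖ ≤ ‖p.1‖ ^ 2 := by
    -- The bound M depends on ζ only through the constant, which disappears under repeated roots.
    refine le_of_pow_two_pow_le (C := M / ‖ζ‖) (by positivity) fun n => ?_
    refine (hqa n).trans ?_
    rw [div_mul_eq_mul_div]
    gcongr
    exact (hM _ (hqS n)).trans_eq (by rw [hqn])
  rw [div_le_iff₀ hζ'] at h1
  have h2 := hsq p ζ
  rw [← hq0] at h2
  refine le_of_sq_le_sq ?_ (by positivity)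
  calc ‖p.2 ζ‖ ^ 2 ≤ ‖ζ‖ * (‖p.1‖ ^ 2 * ‖ζ‖) := h2.trans (by gcongr)
    _ = (‖p.1‖ * ‖ζ‖) ^ 2 := by ring

end BoundedVectors

/-! ### Representations of the spatial tensor product. -/

section TensorReps

variable {A : Type*} {C : Type*} [NonUnitalCStarAlgebra A] [NonUnitalCStarAlgebra C]
variable {H : Type*} [NormedAddCommGroup H] [InnerProductSpace ℂ H] [CompleteSpace H]
variable {K : Type*} [NormedAddCommGroup K] [InnerProductSpace ℂ K] [CompleteSpace K]

variable (A C) in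
/-- The defining representation of the spatial tensor product. -/
def spatialIncl : SpatialTensor A C →⋆ₙₐ[ℂ]
    (HT (UnivSpace A) (UnivSpace C) →L[ℂ] HT (UnivSpace A) (UnivSpace C)) :=
  NonUnitalStarSubalgebraClass.subtype (spatialTensor A C)

lemma spatialIncl_tmul (a : A) (c : C) :
    spatialIncl A C (tmul a c) = htop (univHom A a) (univHom C c) := rfl

variable (A C) in
lemma spatialIncl_injective : Function.Injective (spatialIncl A C) := Subtype.val_injective

variable (A C) in
lemma dense_adjoin_tmul : Dense (NonUnitalStarAlgebra.adjoin ℂ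
    {x : SpatialTensor A C | ∃ a c, x = tmul a c} : Set (SpatialTensor A C)) := by
  have h := generators_subtype {T : TensorSpace A C →L[ℂ] TensorSpace A C |
    ∃ (a : A) (c : C), T = tensorOp a c}
  have h2 : {x : SpatialTensor A C | ∃ a c, x = tmul a c} =
      {x : SpatialTensor A C | ∃ (a : A) (c : C), spatialIncl A C x = tensorOp a c} := by
    ext x
    exact exists_congr fun a => exists_congr fun c => (spatialIncl_injective A C).eq_iff.symm
  rw [h2]
  exact h

lemma spatial_hom_ext {E : Type*} [NonUnitalCStarAlgebra E] {φ ψ : SpatialTensor A C →⋆ₙₐ[ℂ] E}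
    (h : ∀ a c, φ (tmul a c) = ψ (tmul a c)) : φ = ψ :=
  hom_ext_of_generators (dense_adjoin_tmul A C) (by rintro _ ⟨a, c, rfl⟩; exact h a c)

lemma tmul_mul (a a' : A) (c c' : C) : tmul a c * tmul a' c' = tmul (a * a') (c * c') :=
  spatialIncl_injective A C (by
    rw [map_mul, spatialIncl_tmul, spatialIncl_tmul, spatialIncl_tmul, htop_mul, map_mul, map_mul])

lemma star_tmul (a : A) (c : C) : star (tmul a c) = tmul (star a) (star c) :=
  spatialIncl_injective A C (by
    rw [map_star, spatialIncl_tmul, spatialIncl_tmul, star_htop, map_star, map_star])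

lemma norm_tmul_le (a : A) (c : C) : ‖tmul a c‖ ≤ ‖a‖ * ‖c‖ := by
  rw [← NonUnitalStarAlgHom.norm_map _ (spatialIncl_injective A C), spatialIncl_tmul]
  refine (norm_htop_le _ _).trans ?_
  gcongr <;> exact NonUnitalStarAlgHom.norm_apply_le _ _

variable (A C) in
/-- The bilinear map `(a, c) ↦ a ⊗ c`. -/
def tmulL : A →L[ℂ] C →L[ℂ] SpatialTensor A C :=
  LinearMap.mkContinuous₂ (LinearMap.mk₂ ℂ tmul
    (fun a a' c => spatialIncl_injective A C (by
      simp only [map_add, spatialIncl_tmul, htop_add_left]))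
    (fun r a c => spatialIncl_injective A C (by
      simp only [map_smul, spatialIncl_tmul, htop_smul_left]))
    (fun a c c' => spatialIncl_injective A C (by
      simp only [map_add, spatialIncl_tmul, htop_add_right]))
    (fun r a c => spatialIncl_injective A C (by
      simp only [map_smul, spatialIncl_tmul, htop_smul_right]))) 1 fun a c => by
    rw [one_mul]; exact norm_tmul_le a c

lemma tmulL_apply (a : A) (c : C) : tmulL A C a c = tmul a c := rfl

variable (A C) in
/-- The map of the algebraic into the spatial tensor product. -/
def algTensor : A ⊗[ℂ] C →ₗ[ℂ] SpatialTensor A C :=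
  TensorProduct.lift ((ContinuousLinearMap.coeLM ℂ) ∘ₗ (tmulL A C).toLinearMap)

lemma algTensor_tmul (a : A) (c : C) : algTensor A C (a ⊗ₜ c) = tmul a c := rfl

variable (A C) in
-- Sums of elementary tensors are already closed under products and adjoints, so they exhaust the
-- generated `*`-algebra.
lemma denseRange_algTensor : DenseRange (algTensor A C) := by
  refine Dense.mono ?_ (dense_adjoin_tmul A C)
  have hm : ∀ s t, ∃ r, algTensor A C s * algTensor A C t = algTensor A C r := by
    intro s t
    induction s using TensorProduct.induction_on with
    | zero => exact ⟨0, by simp⟩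
    | add s s' hs hs' =>
      obtain ⟨r, hr⟩ := hs; obtain ⟨r', hr'⟩ := hs'
      exact ⟨r + r', by rw [map_add, add_mul, hr, hr', map_add]⟩
    | tmul a c =>
      induction t using TensorProduct.induction_on with
      | zero => exact ⟨0, by simp⟩
      | add s s' hs hs' =>
        obtain ⟨r, hr⟩ := hs; obtain ⟨r', hr'⟩ := hs'
        exact ⟨r + r', by rw [map_add, mul_add, hr, hr', map_add]⟩
      | tmul a' c' => exact ⟨(a * a') ⊗ₜ (c * c'), tmul_mul a a' c c'⟩
  have hst : ∀ r, star (algTensor A C r) ∈ Set.range (algTensor A C) := by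
    intro r
    induction r using TensorProduct.induction_on with
    | zero => exact ⟨0, by simp⟩
    | add s s' hs hs' =>
      obtain ⟨r, hr⟩ := hs; obtain ⟨r', hr'⟩ := hs'
      exact ⟨r + r', by rw [map_add, map_add, hr, hr', star_add]⟩
    | tmul a c => exact ⟨star a ⊗ₜ star c, (star_tmul a c).symm⟩
  intro x hx
  induction hx using NonUnitalStarAlgebra.adjoin_induction with
  | mem x hx => obtain ⟨a, c, rfl⟩ := hx; exact ⟨a ⊗ₜ c, rfl⟩
  | add y z _ _ hy hz =>
    obtain ⟨r, rfl⟩ := hy; obtain ⟨r', rfl⟩ := hz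
    exact ⟨r + r', map_add _ _ _⟩
  | zero => exact ⟨0, map_zero _⟩
  | mul y z _ _ hy hz =>
    obtain ⟨r, rfl⟩ := hy; obtain ⟨r', rfl⟩ := hz
    obtain ⟨s, hs⟩ := hm r r'
    exact ⟨s, hs.symm⟩
  | smul c y _ hy =>
    obtain ⟨r, rfl⟩ := hy
    exact ⟨c • r, map_smul _ _ _⟩
  | star y _ hy =>
    obtain ⟨r, rfl⟩ := hy
    exact hst r

lemma spatial_clm_ext {F : Type*} [NormedAddCommGroup F] [NormedSpace ℂ F]
    {S T : SpatialTensor A C →L[ℂ] F} (h : ∀ a c, S (tmul a c) = T (tmul a c)) : S = T := by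
  refine ContinuousLinearMap.ext fun x => ?_
  refine (denseRange_algTensor A C).induction_on (p := fun x => S x = T x) x
    (isClosed_eq S.continuous T.continuous) fun t => ?_
  induction t using TensorProduct.induction_on with
  | zero => simp
  | add s t hs ht => rw [map_add, map_add, map_add, hs, ht]
  | tmul a c => exact h a c

variable (σ : A →⋆ₙₐ[ℂ] (H →L[ℂ] H)) (τ : C →⋆ₙₐ[ℂ] (K →L[ℂ] K))

/-- Two nondegenerate representations have a tensor product. -/
lemma exists_tensorRep (hσ : NondegRep σ) (hτ : NondegRep τ) :
    ∃ ρ : SpatialTensor A C →⋆ₙₐ[ℂ] (HT H K →L[ℂ] HT H K),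
      ∀ a c, ρ (tmul a c) = htop (σ a) (τ c) := by
  set s : Set (SpatialTensor A C × (HT H K →L[ℂ] HT H K)) :=
    {p | ∃ a c, p = (tmul a c, htop (σ a) (τ c))} with hs
  have hfst : Prod.fst '' s = {x : SpatialTensor A C | ∃ a c, x = tmul a c} := by
    ext x
    constructor
    · rintro ⟨_, ⟨a, c, rfl⟩, rfl⟩; exact ⟨a, c, rfl⟩
    · rintro ⟨a, c, rfl⟩; exact ⟨_, ⟨a, c, rfl⟩, rfl⟩
  suffices h : ∀ p ∈ NonUnitalStarAlgebra.adjoin ℂ s, ‖p.2‖ ≤ ‖p.1‖ by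
    obtain ⟨ρ, hρ⟩ := exists_hom_of_graph s (by rw [hfst]; exact dense_adjoin_tmul A C) h
    exact ⟨ρ, fun a c => hρ _ ⟨a, c, rfl⟩⟩
  refine norm_snd_le_of_bounded_vectors _ ?_
  -- The bounded vectors form a subspace, so it is enough to find among them the tensors of vectors
  -- σ(a)x and τ(c)y.
  let P : Submodule ℂ (HT H K) :=
    { carrier := {ζ | ∃ M : ℝ, ∀ p ∈ NonUnitalStarAlgebra.adjoin ℂ s, ‖p.2 ζ‖ ≤ M * ‖p.1‖}
      zero_mem' := ⟨0, fun p _ => by simp⟩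
      add_mem' := by
        rintro ζ ζ' ⟨M, hM⟩ ⟨M', hM'⟩
        refine ⟨M + M', fun p hp => ?_⟩
        rw [map_add, add_mul]
        exact (norm_add_le _ _).trans (add_le_add (hM p hp) (hM' p hp))
      smul_mem' := by
        rintro c ζ ⟨M, hM⟩
        refine ⟨‖c‖ * M, fun p hp => ?_⟩
        rw [map_smul, norm_smul, mul_assoc]
        gcongr
        exact hM p hp }
  change Dense (P : Set (HT H K))
  refine Dense.mono ?_ (dense_span_htm hσ hτ)
  refine Submodule.span_le.2 ?_
  rintro _ ⟨_, ⟨a, x, rfl⟩, _, ⟨c, y, rfl⟩, rfl⟩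
  obtain ⟨S, hS, ξ, hξ⟩ := exists_intertwiner σ a x
  obtain ⟨T, hT, η, hη⟩ := exists_intertwiner τ c y
  -- The tensor product of two intertwiners intertwines the defining representation with the
  -- operators on H ⊗ K. The relation for the adjoint is carried along because it does not follow
  -- from the first one.
  have key : ∀ p ∈ NonUnitalStarAlgebra.adjoin ℂ s,
      p.2 ∘L htop S T = htop S T ∘L spatialIncl A C p.1 ∧
      star p.2 ∘L htop S T = htop S T ∘L spatialIncl A C (star p.1) := by
    have hgen : ∀ a c, htop (σ a) (τ c) ∘L htop S T = htop S T ∘L spatialIncl A C (tmul a c) := by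
      intro a c
      rw [spatialIncl_tmul, htop_comp, htop_comp]
      exact congrArg₂ htop (hS a).symm (hT c).symm
    have hmul : ∀ {P Q : HT H K →L[ℂ] HT H K}
        {p q : HT (UnivSpace A) (UnivSpace C) →L[ℂ] HT (UnivSpace A) (UnivSpace C)},
        P ∘L htop S T = htop S T ∘L p → Q ∘L htop S T = htop S T ∘L q →
        (P * Q) ∘L htop S T = htop S T ∘L (p * q) := by
      intro P Q p q hP hQ
      rw [ContinuousLinearMap.mul_def, ContinuousLinearMap.comp_assoc, hQ,
        ← ContinuousLinearMap.comp_assoc, hP, ContinuousLinearMap.comp_assoc]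
      rfl
    intro p hp
    induction hp using NonUnitalStarAlgebra.adjoin_induction with
    | mem p hp =>
      obtain ⟨a, c, rfl⟩ := hp
      refine ⟨hgen a c, ?_⟩
      rw [star_htop, star_tmul, ← map_star, ← map_star]
      exact hgen _ _
    | add p q _ _ hp hq =>
      simp only [Prod.snd_add, Prod.fst_add, star_add, map_add, ContinuousLinearMap.add_comp,
        ContinuousLinearMap.comp_add, hp.1, hp.2, hq.1, hq.2, and_self]
    | zero => simp
    | mul p q _ _ hp hq =>
      refine ⟨?_, ?_⟩
      · rw [Prod.snd_mul, Prod.fst_mul, map_mul]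
        exact hmul hp.1 hq.1
      · rw [Prod.snd_mul, Prod.fst_mul, star_mul, star_mul, map_mul]
        exact hmul hq.2 hp.2
    | smul c p _ hp =>
      simp only [Prod.smul_snd, Prod.smul_fst, star_smul, map_smul, ContinuousLinearMap.smul_comp,
        ContinuousLinearMap.comp_smul, hp.1, hp.2, and_self]
    | star p _ hp =>
      simp only [Prod.snd_star, Prod.fst_star, star_star]
      exact ⟨hp.2, hp.1⟩
  -- The vector is the image of ξ ⊗ η under S ⊗ T, so applying `p.2` to it amounts to applying `p.1`
  -- in the defining representation first.
  refine ⟨‖htop S T‖ * ‖htm ξ η‖, fun p hp => ?_⟩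
  rw [← hξ, ← hη, ← htop_htm]
  have h1 : p.2 (htop S T (htm ξ η)) = htop S T (spatialIncl A C p.1 (htm ξ η)) :=
    congrArg (fun R => R (htm ξ η)) (key p hp).1
  rw [h1]
  calc ‖htop S T (spatialIncl A C p.1 (htm ξ η))‖ ≤ ‖htop S T‖ * (‖p.1‖ * ‖htm ξ η‖) := by
        refine (ContinuousLinearMap.le_opNorm _ _).trans ?_
        gcongr
        refine (ContinuousLinearMap.le_opNorm _ _).trans ?_
        gcongr
        exact NonUnitalStarAlgHom.norm_apply_le _ _
    _ = _ := by ring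

/-- The tensor product of two nondegenerate representations. -/
def tensorRep (hσ : NondegRep σ) (hτ : NondegRep τ) :
    SpatialTensor A C →⋆ₙₐ[ℂ] (HT H K →L[ℂ] HT H K) := (exists_tensorRep σ τ hσ hτ).choose

variable {σ τ} (hσ : NondegRep σ) (hτ : NondegRep τ)

lemma tensorRep_tmul (a : A) (c : C) : tensorRep σ τ hσ hτ (tmul a c) = htop (σ a) (τ c) :=
  (exists_tensorRep σ τ hσ hτ).choose_spec a c

lemma nondegRep_tensorRep : NondegRep (tensorRep σ τ hσ hτ) := by
  refine Dense.mono ?_ (dense_span_htm hσ hτ)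
  refine Submodule.span_mono ?_
  rintro _ ⟨_, ⟨a, x, rfl⟩, _, ⟨c, y, rfl⟩, rfl⟩
  exact ⟨tmul a c, htm x y, by rw [tensorRep_tmul, htop_htm]⟩

lemma tensorRep_univ : tensorRep (univHom A) (univHom C) (nondegRep_univHom A)
    (nondegRep_univHom C) = spatialIncl A C :=
  spatial_hom_ext fun a c => by rw [tensorRep_tmul, spatialIncl_tmul]

/-! ### Slice maps and joint faithfulness. -/

section Slices

/-- The vector functional `c ↦ ⟨z', τ(c) z⟩`. -/
def coeffFunctional (τ : C →⋆ₙₐ[ℂ] (K →L[ℂ] K)) (z z' : K) : C →L[ℂ] ℂ :=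
  (innerSL ℂ z') ∘L ((homCLM τ).flip z)

lemma coeffFunctional_apply (z z' : K) (c : C) :
    coeffFunctional τ z z' c = inner ℂ z' (τ c z) := rfl

/-- The slice map `a ⊗ c ↦ ⟨z', τ(c) z⟩ a` on the algebraic tensor product. -/
def algSliceRight (A : Type*) [NonUnitalCStarAlgebra A] (τ : C →⋆ₙₐ[ℂ] (K →L[ℂ] K)) (z z' : K) :
    A ⊗[ℂ] C →ₗ[ℂ] A :=
  (TensorProduct.rid ℂ A).toLinearMap ∘ₗ
    LinearMap.lTensor A (coeffFunctional τ z z').toLinearMap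

/-- The slice map `a ⊗ c ↦ ⟨x', σ(a) x⟩ c` on the algebraic tensor product. -/
def algSliceLeft (C : Type*) [NonUnitalCStarAlgebra C] (σ : A →⋆ₙₐ[ℂ] (H →L[ℂ] H)) (x x' : H) :
    A ⊗[ℂ] C →ₗ[ℂ] C :=
  (TensorProduct.lid ℂ C).toLinearMap ∘ₗ
    LinearMap.rTensor C (coeffFunctional σ x x').toLinearMap

/-- Writing the slice as a compression of σ ⊗ τ bounds it in the spatial norm once σ is faithful, so
that it extends by continuity. -/
lemma hom_algSliceRight (z z' : K) (t : A ⊗[ℂ] C) :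
    σ (algSliceRight A τ z z' t) = ContinuousLinearMap.adjoint ((htmL H K).flip z') ∘L
      tensorRep σ τ hσ hτ (algTensor A C t) ∘L (htmL H K).flip z := by
  induction t using TensorProduct.induction_on with
  | zero => simp
  | add s t hs ht =>
    simp only [map_add, hs, ht, ContinuousLinearMap.add_comp, ContinuousLinearMap.comp_add]
  | tmul a c =>
    refine ContinuousLinearMap.ext fun x => ?_
    rw [algTensor_tmul, tensorRep_tmul]
    change σ ((coeffFunctional τ z z' c : ℂ) • a) x =
      ContinuousLinearMap.adjoint ((htmL H K).flip z') (htop (σ a) (τ c) (htm x z))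
    rw [htop_htm, adjoint_htmL_flip, map_smul, coeffFunctional_apply]; rfl

lemma hom_algSliceLeft (x x' : H) (t : A ⊗[ℂ] C) :
    τ (algSliceLeft C σ x x' t) = ContinuousLinearMap.adjoint (htmL H K x') ∘L
      tensorRep σ τ hσ hτ (algTensor A C t) ∘L htmL H K x := by
  induction t using TensorProduct.induction_on with
  | zero => simp
  | add s t hs ht =>
    simp only [map_add, hs, ht, ContinuousLinearMap.add_comp, ContinuousLinearMap.comp_add]
  | tmul a c =>
    refine ContinuousLinearMap.ext fun z => ?_
    rw [algTensor_tmul, tensorRep_tmul]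
    change τ ((coeffFunctional σ x x' a : ℂ) • c) z =
      ContinuousLinearMap.adjoint (htmL H K x') (htop (σ a) (τ c) (htm x z))
    rw [htop_htm, adjoint_htmL, map_smul, coeffFunctional_apply]; rfl

lemma norm_comp_hom_comp_le {X : Type*} [NonUnitalCStarAlgebra X] {F₁ F₂ : Type*}
    [NormedAddCommGroup F₁] [NormedSpace ℂ F₁] [NormedAddCommGroup F₂] [NormedSpace ℂ F₂]
    (ρ : X →⋆ₙₐ[ℂ] (H →L[ℂ] H)) (S : H →L[ℂ] F₂) (T : F₁ →L[ℂ] H) (x : X) :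
    ‖S ∘L ρ x ∘L T‖ ≤ (‖S‖ * ‖T‖) * ‖x‖ := by
  calc ‖S ∘L ρ x ∘L T‖ ≤ ‖S‖ * (‖ρ x‖ * ‖T‖) :=
        (ContinuousLinearMap.opNorm_comp_le _ _).trans
          (by gcongr; exact ContinuousLinearMap.opNorm_comp_le _ _)
    _ ≤ ‖S‖ * (‖x‖ * ‖T‖) := by gcongr; exact NonUnitalStarAlgHom.norm_apply_le _ _
    _ = _ := by ring

lemma bound_algSliceRight {τ : C →⋆ₙₐ[ℂ] (K →L[ℂ] K)} (hτ : NondegRep τ) (z z' : K) : ∃ M : ℝ, ∀ t : A ⊗[ℂ] C,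
    ‖algSliceRight A τ z z' t‖ ≤ M * ‖algTensor A C t‖ := by
  refine ⟨‖ContinuousLinearMap.adjoint ((htmL (UnivSpace A) K).flip z')‖ *
    ‖(htmL (UnivSpace A) K).flip z‖, fun t => ?_⟩
  rw [← NonUnitalStarAlgHom.norm_map _ (univHom_injective A),
    hom_algSliceRight (nondegRep_univHom A) hτ]
  exact norm_comp_hom_comp_le _ _ _ _

lemma bound_algSliceLeft {σ : A →⋆ₙₐ[ℂ] (H →L[ℂ] H)} (hσ : NondegRep σ) (x x' : H) : ∃ M : ℝ, ∀ t : A ⊗[ℂ] C,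
    ‖algSliceLeft C σ x x' t‖ ≤ M * ‖algTensor A C t‖ := by
  refine ⟨‖ContinuousLinearMap.adjoint (htmL H (UnivSpace C) x')‖ *
    ‖htmL H (UnivSpace C) x‖, fun t => ?_⟩
  rw [← NonUnitalStarAlgHom.norm_map _ (univHom_injective C),
    hom_algSliceLeft hσ (nondegRep_univHom C)]
  exact norm_comp_hom_comp_le _ _ _ _

/-- The slice map `a ⊗ c ↦ ⟨z', τ(c) z⟩ a` on the spatial tensor product. -/
def sliceRight (A : Type*) [NonUnitalCStarAlgebra A] (τ : C →⋆ₙₐ[ℂ] (K →L[ℂ] K)) (z z' : K) :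
    SpatialTensor A C →L[ℂ] A :=
  (algSliceRight A τ z z').extendOfNorm (algTensor A C)

/-- The slice map `a ⊗ c ↦ ⟨x', σ(a) x⟩ c` on the spatial tensor product. -/
def sliceLeft (C : Type*) [NonUnitalCStarAlgebra C] (σ : A →⋆ₙₐ[ℂ] (H →L[ℂ] H)) (x x' : H) :
    SpatialTensor A C →L[ℂ] C :=
  (algSliceLeft C σ x x').extendOfNorm (algTensor A C)

lemma hom_sliceRight (z z' : K) (y : SpatialTensor A C) :
    σ (sliceRight A τ z z' y) = ContinuousLinearMap.adjoint ((htmL H K).flip z') ∘L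
      tensorRep σ τ hσ hτ y ∘L (htmL H K).flip z := by
  refine (denseRange_algTensor A C).induction_on
    (p := fun y => σ (sliceRight A τ z z' y) = ContinuousLinearMap.adjoint ((htmL H K).flip z') ∘L
      tensorRep σ τ hσ hτ y ∘L (htmL H K).flip z) y ?_ fun t => ?_
  · have h1 := continuous_hom σ
    have h2 := continuous_hom (tensorRep σ τ hσ hτ)
    exact isClosed_eq (by fun_prop) (by fun_prop)
  · rw [sliceRight, LinearMap.extendOfNorm_eq (denseRange_algTensor A C)
      (bound_algSliceRight hτ z z'), hom_algSliceRight hσ hτ]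

lemma hom_sliceLeft (x x' : H) (y : SpatialTensor A C) :
    τ (sliceLeft C σ x x' y) = ContinuousLinearMap.adjoint (htmL H K x') ∘L
      tensorRep σ τ hσ hτ y ∘L htmL H K x := by
  refine (denseRange_algTensor A C).induction_on
    (p := fun y => τ (sliceLeft C σ x x' y) = ContinuousLinearMap.adjoint (htmL H K x') ∘L
      tensorRep σ τ hσ hτ y ∘L htmL H K x) y ?_ fun t => ?_
  · have h1 := continuous_hom τ
    have h2 := continuous_hom (tensorRep σ τ hσ hτ)
    exact isClosed_eq (by fun_prop) (by fun_prop)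
  · rw [sliceLeft, LinearMap.extendOfNorm_eq (denseRange_algTensor A C)
      (bound_algSliceLeft hσ x x'), hom_algSliceLeft hσ hτ]

lemma eq_zero_of_slices_right {T : HT H K →L[ℂ] HT H K}
    (h : ∀ z z' : K, ContinuousLinearMap.adjoint ((htmL H K).flip z') ∘L T ∘L
      (htmL H K).flip z = 0) : T = 0 := by
  refine htm_ext fun x z => eq_of_inner_htm fun x' z' => ?_
  have := congrArg (fun R : H →L[ℂ] H => inner ℂ x' (R x)) (h z z')
  change inner ℂ x' (ContinuousLinearMap.adjoint ((htmL H K).flip z') (T (htm x z))) =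
    inner ℂ x' 0 at this
  rw [ContinuousLinearMap.adjoint_inner_right, inner_zero_right] at this
  rw [zero_apply, inner_zero_right]
  exact this

lemma eq_zero_of_slices_left {T : HT H K →L[ℂ] HT H K}
    (h : ∀ x x' : H, ContinuousLinearMap.adjoint (htmL H K x') ∘L T ∘L htmL H K x = 0) :
    T = 0 := by
  refine htm_ext fun x z => eq_of_inner_htm fun x' z' => ?_
  have := congrArg (fun R : K →L[ℂ] K => inner ℂ z' (R z)) (h x x')
  change inner ℂ z' (ContinuousLinearMap.adjoint (htmL H K x') (T (htm x z))) =
    inner ℂ z' 0 at this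
  rw [ContinuousLinearMap.adjoint_inner_right, inner_zero_right] at this
  rw [zero_apply, inner_zero_right]
  exact this

/-- The tensor products of two jointly faithful families of nondegenerate representations are
jointly faithful. -/
lemma tensorRep_jointly_faithful {I J : Type*} {H : I → Type*} {K : J → Type*}
    [∀ i, NormedAddCommGroup (H i)] [∀ i, InnerProductSpace ℂ (H i)] [∀ i, CompleteSpace (H i)]
    [∀ j, NormedAddCommGroup (K j)] [∀ j, InnerProductSpace ℂ (K j)] [∀ j, CompleteSpace (K j)]
    {σ : ∀ i, A →⋆ₙₐ[ℂ] (H i →L[ℂ] H i)} {τ : ∀ j, C →⋆ₙₐ[ℂ] (K j →L[ℂ] K j)}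
    (hσ : ∀ i, NondegRep (σ i)) (hτ : ∀ j, NondegRep (τ j))
    (hσ' : ∀ a, (∀ i, σ i a = 0) → a = 0) (hτ' : ∀ c, (∀ j, τ j c = 0) → c = 0)
    {y : SpatialTensor A C} (h : ∀ i j, tensorRep (σ i) (τ j) (hσ i) (hτ j) y = 0) : y = 0 := by
  -- Slicing off the second factor lands in A, where the family σ is faithful; this replaces each σ
  -- i by the universal representation.
  have h1 : ∀ j, tensorRep (univHom A) (τ j) (nondegRep_univHom A) (hτ j) y = 0 := by
    intro j
    refine eq_zero_of_slices_right fun z z' => ?_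
    rw [← hom_sliceRight, hσ' (sliceRight A (τ j) z z' y), map_zero]
    intro i
    rw [hom_sliceRight (hσ i) (hτ j), h i j]
    simp
  -- The same argument with the first factor sliced off and the family τ on C.
  refine spatialIncl_injective A C ?_
  rw [map_zero, ← tensorRep_univ]
  refine eq_zero_of_slices_left fun x x' => ?_
  rw [← hom_sliceLeft, hτ' (sliceLeft C (univHom A) x x' y), map_zero]
  intro j
  rw [hom_sliceLeft (nondegRep_univHom A) (hτ j), h1 j]
  simp

lemma tensorRep_injective (hσ' : Function.Injective σ) (hτ' : Function.Injective τ) :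
    Function.Injective (tensorRep σ τ hσ hτ) := by
  rw [injective_iff_map_eq_zero] at *
  intro y hy
  exact tensorRep_jointly_faithful (I := Unit) (J := Unit) (σ := fun _ => σ) (τ := fun _ => τ)
    (fun _ => hσ) (fun _ => hτ) (fun a ha => hσ' a (ha ())) (fun c hc => hτ' c (hc ()))
    fun _ _ => hy

end Slices

end TensorReps

/-! ### Testing bounded linear maps on sets with dense span. -/

section DenseSpans

variable {E : Type*} {F : Type*} [NormedAddCommGroup E] [NormedSpace ℂ E]
  [NormedAddCommGroup F] [NormedSpace ℂ F]

/-- A bounded linear map taking a set with dense span into a closed subspace takes its values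
there. -/
lemma clm_mem_of_dense_span {s : Set E} (hs : Dense (Submodule.span ℂ s : Set E)) (L : E →L[ℂ] F)
    {P : Submodule ℂ F} (hP : IsClosed (P : Set F)) (h : ∀ x ∈ s, L x ∈ P) (x : E) : L x ∈ P := by
  have hc : IsClosed ((P.comap L.toLinearMap : Submodule ℂ E) : Set E) := hP.preimage L.continuous
  have hle : Submodule.span ℂ s ≤ P.comap L.toLinearMap := Submodule.span_le.2 h
  exact hc.closure_subset_iff.2 hle (hs x)

/-- The range of a `*`-homomorphism is a closed subspace. This reduces the hypotheses of
`exists_multiplier` and `exists_lift_multiplier` to elementary tensors or to elements φ(a)b. -/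
lemma clm_mem_range {B X : Type*} [NonUnitalCStarAlgebra B] [NonUnitalCStarAlgebra X]
    (ι : B →⋆ₙₐ[ℂ] X) {s : Set E} (hs : Dense (Submodule.span ℂ s : Set E)) (L : E →L[ℂ] X)
    (h : ∀ x ∈ s, L x ∈ Set.range ι) (x : E) : L x ∈ Set.range ι := by
  have hr := isClosed_range ι
  have h2 : (NonUnitalStarAlgHom.range ι : Set X) =
      (LinearMap.range (homCLM ι).toLinearMap : Set X) := by
    ext; simp
  rw [h2] at hr
  have := clm_mem_of_dense_span hs L hr (fun x hx => by
    obtain ⟨b, hb⟩ := h x hx; exact ⟨b, hb⟩) x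
  obtain ⟨b, hb⟩ := this
  exact ⟨b, hb⟩

lemma dense_span_of_clm {s : Set E} (hs : Dense (Submodule.span ℂ s : Set E)) (L : E →L[ℂ] F)
    (hL : DenseRange L) {t : Set F} (h : ∀ x ∈ s, L x ∈ closure (Submodule.span ℂ t : Set F)) :
    Dense (Submodule.span ℂ t : Set F) := by
  have h1 := clm_mem_of_dense_span hs L (Submodule.span ℂ t).isClosed_topologicalClosure
    (fun x hx => by
      change L x ∈ ((Submodule.span ℂ t).topologicalClosure : Set F)
      rw [Submodule.topologicalClosure_coe]; exact h x hx)
  intro y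
  refine hL.induction_on (p := fun y => y ∈ closure (Submodule.span ℂ t : Set F)) y
    isClosed_closure fun x => ?_
  rw [← Submodule.topologicalClosure_coe]; exact h1 x

end DenseSpans

/-! ### The extension of a nondegenerate homomorphism to multipliers. -/

section Extension

variable {A : Type*} {B : Type*} {C : Type*} [NonUnitalCStarAlgebra A] [NonUnitalCStarAlgebra B]
  [NonUnitalCStarAlgebra C]
variable {H : Type*} [NormedAddCommGroup H] [InnerProductSpace ℂ H] [CompleteSpace H]

/-- Represent B universally; the composition with φ is a nondegenerate representation of A and so
extends to M(A). The operator of m takes φ(a)b to φ(ma)b, hence by density multiplies B into itself.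
-/
lemma exists_bar {φ : A →⋆ₙₐ[ℂ] 𝓜(ℂ, B)} (hφ : Nondegenerate φ) :
    ∃ Φ : 𝓜(ℂ, A) →⋆ₙₐ[ℂ] 𝓜(ℂ, B), Φ 1 = 1 ∧ ∀ a : A, Φ (incl A a) = φ a := by
  have hσ := nondegRep_univHom B
  have hτ := nondegRep_comp hσ hφ
  obtain ⟨Φ, hΦ⟩ := exists_lift_multiplier (univHom B) (univHom_injective B) (ext _ hτ) (by
    intro m b
    refine clm_mem_range (univHom B) hφ
      (ContinuousLinearMap.mul ℂ _ (ext _ hτ m) ∘L homCLM (univHom B)) ?_ b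
    rintro _ ⟨a, b, rfl⟩
    refine ⟨(φ (m.fst a)).fst b, ?_⟩
    change _ = ext _ hτ m * univHom B ((φ a).fst b)
    rw [← ext_mul hσ, ← ext_mul hσ, ← mul_assoc]
    congr 1
    exact (ext_mul hτ m a).symm)
  refine ⟨Φ, ?_, fun a => ?_⟩
  · refine mult_ext fun b => univHom_injective B ?_
    rw [hΦ, ext_one, one_mul]; rfl
  · refine mult_ext fun b => univHom_injective B ?_
    rw [hΦ, ext_incl, ← ext_mul hσ]; rfl

variable {φ : A →⋆ₙₐ[ℂ] 𝓜(ℂ, B)}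

lemma Nondegenerate.mult_ext {φ : A →⋆ₙₐ[ℂ] 𝓜(ℂ, B)} (hφ : Nondegenerate φ) {m n : 𝓜(ℂ, B)}
    (h : ∀ a b, m.fst ((φ a).fst b) = n.fst ((φ a).fst b)) : m = n := by
  refine Coact.mult_ext fun b => ?_
  have : m.fst = n.fst := ContinuousLinearMap.ext_on hφ (by rintro _ ⟨a, b, rfl⟩; exact h a b)
  rw [this]

lemma mul_incl_of_extends {Φ : 𝓜(ℂ, A) →⋆ₙₐ[ℂ] 𝓜(ℂ, B)} (h : ∀ a, Φ (incl A a) = φ a)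
    (m : 𝓜(ℂ, A)) (a : A) : Φ m * φ a = φ (m.fst a) := by
  rw [← h, ← map_mul, mul_incl, h]

lemma bar_spec (hφ : Nondegenerate φ) : bar φ 1 = 1 ∧ ∀ a : A, bar φ (incl A a) = φ a :=
  Classical.epsilon_spec (exists_bar hφ)

lemma bar_one (hφ : Nondegenerate φ) : bar φ 1 = 1 := (bar_spec hφ).1

lemma bar_incl (hφ : Nondegenerate φ) (a : A) : bar φ (incl A a) = φ a := (bar_spec hφ).2 a

lemma bar_mul (hφ : Nondegenerate φ) (m : 𝓜(ℂ, A)) (a : A) : bar φ m * φ a = φ (m.fst a) :=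
  mul_incl_of_extends (bar_incl hφ) m a

lemma bar_fst (hφ : Nondegenerate φ) (m : 𝓜(ℂ, A)) (a : A) (b : B) :
    (bar φ m).fst ((φ a).fst b) = (φ (m.fst a)).fst b := by
  rw [← mul_fst_apply, bar_mul hφ]

/-- Any extension satisfies Φ(m)φ(a)b = φ(ma)b, and these vectors are total; unitality need not be
assumed. -/
lemma bar_unique (hφ : Nondegenerate φ) {Φ : 𝓜(ℂ, A) →⋆ₙₐ[ℂ] 𝓜(ℂ, B)} (h : ∀ a, Φ (incl A a) = φ a) : bar φ = Φ := by
  refine NonUnitalStarAlgHom.ext fun m => hφ.mult_ext fun a b => ?_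
  rw [bar_fst hφ, ← mul_fst_apply, mul_incl_of_extends h]

lemma Nondegenerate.comp {ψ : B →⋆ₙₐ[ℂ] 𝓜(ℂ, C)} (hψ : Nondegenerate ψ) (hφ : Nondegenerate φ) :
    Nondegenerate ((bar ψ).comp φ) := by
  have h : ∀ b c, (ψ b).fst c ∈ closure (Submodule.span ℂ {x : C | ∃ a c,
      x = (((bar ψ).comp φ) a).fst c} : Set C) := by
    intro b c
    have h1 := clm_mem_of_dense_span hφ
      (LinearMap.mkContinuous (E := B) (F := C)
        { toFun := fun b => (ψ b).fst c
          map_add' := fun b b' => by rw [map_add]; rfl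
          map_smul' := fun r b => by rw [map_smul]; rfl } ‖c‖ fun b => by
          change ‖(ψ b).fst c‖ ≤ _
          refine (norm_fst_apply_le _ _).trans ?_
          rw [mul_comm]
          gcongr
          exact NonUnitalStarAlgHom.norm_apply_le _ _)
      (Submodule.span ℂ {x : C | ∃ a c, x = (((bar ψ).comp φ) a).fst c}).isClosed_topologicalClosure
      (by
        rintro _ ⟨a, b, rfl⟩
        refine Submodule.le_topologicalClosure _ (Submodule.subset_span ⟨a, (ψ b).fst c, ?_⟩)
        exact (bar_fst hψ (φ a) b c).symm) b
    rw [← Submodule.topologicalClosure_coe]; exact h1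
  refine dense_span_of_clm hψ (ContinuousLinearMap.id ℂ C) denseRange_id ?_
  rintro _ ⟨b, c, rfl⟩
  exact h b c

lemma ext_congr {σ τ : A →⋆ₙₐ[ℂ] (H →L[ℂ] H)} {hσ : NondegRep σ} {hτ : NondegRep τ} (h : σ = τ)
    (m : 𝓜(ℂ, A)) : ext σ hσ m = ext τ hτ m := by subst h; rfl

/-- The passage from identities between multipliers to identities between operators. -/
lemma ext_bar (hφ : Nondegenerate φ) {σ : B →⋆ₙₐ[ℂ] (H →L[ℂ] H)} (hσ : NondegRep σ) (m : 𝓜(ℂ, A)) :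
    ext σ hσ (bar φ m) = ext ((ext σ hσ).comp φ) (nondegRep_comp hσ hφ) m := by
  refine (ext_unique (nondegRep_comp hσ hφ) fun a x => ?_).symm
  change ext σ hσ (bar φ m) (ext σ hσ (φ a) x) = ext σ hσ (φ (m.fst a)) x
  rw [← bar_mul hφ, map_mul]; rfl

lemma bar_bar (hφ : Nondegenerate φ) {ψ : B →⋆ₙₐ[ℂ] 𝓜(ℂ, C)} (hψ : Nondegenerate ψ) (m : 𝓜(ℂ, A)) :
    bar ψ (bar φ m) = bar ((bar ψ).comp φ) m := by
  rw [bar_unique (hψ.comp hφ) (Φ := (bar ψ).comp (bar φ)) fun a => ?_]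
  · rfl
  · change bar ψ (bar φ (incl A a)) = _
    rw [bar_incl hφ]; rfl

lemma nondegenerate_of_surjective {p : A →⋆ₙₐ[ℂ] B} (hp : Function.Surjective p) :
    Nondegenerate ((incl B).comp p) := fun b =>
  mem_closure_mul (fun e a => Submodule.subset_span (by
    obtain ⟨e', rfl⟩ := hp e
    exact ⟨e', a, rfl⟩)) b

variable (A) in
lemma nondegenerate_incl : Nondegenerate (incl A) :=
  nondegenerate_of_surjective (p := NonUnitalStarAlgHom.id ℂ A) Function.surjective_id

lemma bar_incl_self (m : 𝓜(ℂ, A)) : bar (incl A) m = m := by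
  rw [bar_unique (nondegenerate_incl A) (Φ := NonUnitalStarAlgHom.id ℂ _) fun a => rfl]; rfl

lemma bar_injective (hφ : Nondegenerate φ) (h : Function.Injective φ) : Function.Injective (bar φ) := by
  intro m n hmn
  refine Coact.mult_ext fun a => h ?_
  rw [← bar_mul hφ, ← bar_mul hφ, hmn]

end Extension

/-! ### Tensor products of multipliers and of homomorphisms, and associativity. -/

section TensorCalculus

variable {A : Type*} {B : Type*} {C : Type*} {D : Type*}
  [NonUnitalCStarAlgebra A] [NonUnitalCStarAlgebra B]
  [NonUnitalCStarAlgebra C] [NonUnitalCStarAlgebra D]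
variable {H : Type*} [NormedAddCommGroup H] [InnerProductSpace ℂ H] [CompleteSpace H]
variable {K : Type*} [NormedAddCommGroup K] [InnerProductSpace ℂ K] [CompleteSpace K]
variable {L : Type*} [NormedAddCommGroup L] [InnerProductSpace ℂ L] [CompleteSpace L]

/-- If two sets span dense subspaces, so do the tensors of their elements. -/
lemma dense_span_tmul {s : Set A} {t : Set C} (hs : Dense (Submodule.span ℂ s : Set A))
    (ht : Dense (Submodule.span ℂ t : Set C)) :
    Dense (Submodule.span ℂ {z : SpatialTensor A C | ∃ x ∈ s, ∃ y ∈ t, z = tmul x y} :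
      Set (SpatialTensor A C)) := by
  set P := (Submodule.span ℂ {z : SpatialTensor A C | ∃ x ∈ s, ∃ y ∈ t, z = tmul x y}).topologicalClosure
    with hP
  have hcl : IsClosed (P : Set (SpatialTensor A C)) := Submodule.isClosed_topologicalClosure _
  have h1 : ∀ x ∈ s, ∀ y, tmul x y ∈ P := fun x hx =>
    clm_mem_of_dense_span ht (tmulL A C x) hcl fun y hy => Submodule.le_topologicalClosure _
        (Submodule.subset_span ⟨x, hx, y, hy, rfl⟩)
  have h2 : ∀ x y, tmul x y ∈ P := fun x y =>
    clm_mem_of_dense_span hs ((tmulL A C).flip y) hcl (fun x hx => h1 x hx y) x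
  intro z
  refine (denseRange_algTensor A C).induction_on (p := fun z => z ∈ P) z hcl fun t => ?_
  induction t using TensorProduct.induction_on with
  | zero => rw [map_zero]; exact zero_mem _
  | tmul x y => exact h2 x y
  | add x y hx hy => rw [map_add]; exact add_mem hx hy

variable (A C) in
lemma dense_span_range_tmul : Dense (Submodule.span ℂ {z : SpatialTensor A C | ∃ x y, z = tmul x y} :
    Set (SpatialTensor A C)) := by
  have h := dense_span_tmul (s := (Set.univ : Set A)) (t := (Set.univ : Set C))
    (by rw [Submodule.span_univ]; exact dense_univ) (by rw [Submodule.span_univ]; exact dense_univ)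
  refine h.mono (Submodule.span_mono ?_)
  rintro _ ⟨x, -, y, -, rfl⟩
  exact ⟨x, y, rfl⟩

lemma htop_ext_mul_mem {σ : A →⋆ₙₐ[ℂ] (H →L[ℂ] H)} {τ : C →⋆ₙₐ[ℂ] (K →L[ℂ] K)}
    (hσ : NondegRep σ) (hτ : NondegRep τ) (m : 𝓜(ℂ, A)) (n : 𝓜(ℂ, C)) (y : SpatialTensor A C) :
    htop (ext σ hσ m) (ext τ hτ n) * tensorRep σ τ hσ hτ y ∈ Set.range (tensorRep σ τ hσ hτ) := by
  refine clm_mem_range _ (dense_span_range_tmul A C)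
    (ContinuousLinearMap.mul ℂ _ (htop (ext σ hσ m) (ext τ hτ n)) ∘L
      homCLM (tensorRep σ τ hσ hτ)) ?_ y
  rintro _ ⟨a, c, rfl⟩
  refine ⟨tmul (m.fst a) (n.fst c), ?_⟩
  change _ = htop (ext σ hσ m) (ext τ hτ n) * tensorRep σ τ hσ hτ (tmul a c)
  rw [tensorRep_tmul, tensorRep_tmul, htop_mul, ext_mul, ext_mul]

/-- In the universal representations, the tensor product of the operators of m and n multiplies the
spatial tensor product into itself. -/
lemma exists_mtmul (m : 𝓜(ℂ, A)) (n : 𝓜(ℂ, C)) : ∃ p : 𝓜(ℂ, SpatialTensor A C),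
    ∀ (a : A) (c : C), p.fst (tmul a c) = tmul (m.fst a) (n.fst c) := by
  have hA := nondegRep_univHom A
  have hC := nondegRep_univHom C
  have hi := tensorRep_injective hA hC (univHom_injective A) (univHom_injective C)
  obtain ⟨p, hp, -⟩ := exists_multiplier _ hi (htop (ext _ hA m) (ext _ hC n))
    (htop_ext_mul_mem hA hC m n) (fun y => by
      obtain ⟨x, hx⟩ := htop_ext_mul_mem hA hC (star m) (star n) (star y)
      refine ⟨star x, ?_⟩
      rw [map_star, hx, star_mul, map_star, star_star, star_htop, map_star, map_star, star_star,
        star_star])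
  refine ⟨p, fun a c => hi ?_⟩
  rw [hp, tensorRep_tmul, tensorRep_tmul, htop_mul, ext_mul, ext_mul]

lemma mtmul_fst (m : 𝓜(ℂ, A)) (n : 𝓜(ℂ, C)) (a : A) (c : C) :
    (mtmul m n).fst (tmul a c) = tmul (m.fst a) (n.fst c) :=
  Classical.epsilon_spec (exists_mtmul m n) a c

lemma mult_ext_tmul {p q : 𝓜(ℂ, SpatialTensor A C)}
    (h : ∀ a c, p.fst (tmul a c) = q.fst (tmul a c)) : p = q :=
  mult_ext fun y => by rw [spatial_clm_ext h]

lemma mtmul_mul (m m' : 𝓜(ℂ, A)) (n n' : 𝓜(ℂ, C)) :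
    mtmul m n * mtmul m' n' = mtmul (m * m') (n * n') :=
  mult_ext_tmul fun a c => by simp only [mul_fst_apply, mtmul_fst]

lemma mtmul_incl (a : A) (c : C) : mtmul (incl A a) (incl C c) = incl _ (tmul a c) :=
  mult_ext_tmul fun a' c' => by
    rw [mtmul_fst, incl_fst, incl_fst, incl_fst, tmul_mul]

lemma mtmul_add_right (m : 𝓜(ℂ, A)) (n n' : 𝓜(ℂ, C)) :
    mtmul m (n + n') = mtmul m n + mtmul m n' :=
  mult_ext_tmul fun a c => by
    rw [mtmul_fst, DoubleCentralizer.add_fst, DoubleCentralizer.add_fst, add_apply, add_apply,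
      mtmul_fst, mtmul_fst, ← tmulL_apply, map_add]; rfl

lemma mtmul_smul_right (r : ℂ) (m : 𝓜(ℂ, A)) (n : 𝓜(ℂ, C)) :
    mtmul m (r • n) = r • mtmul m n :=
  mult_ext_tmul fun a c => by
    rw [mtmul_fst, DoubleCentralizer.smul_fst, DoubleCentralizer.smul_fst, smul_apply, smul_apply,
      mtmul_fst, ← tmulL_apply, map_smul]; rfl

lemma ext_tensorRep_mtmul {σ : A →⋆ₙₐ[ℂ] (H →L[ℂ] H)} {τ : C →⋆ₙₐ[ℂ] (K →L[ℂ] K)}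
    (hσ : NondegRep σ) (hτ : NondegRep τ) (m : 𝓜(ℂ, A)) (n : 𝓜(ℂ, C)) :
    ext _ (nondegRep_tensorRep hσ hτ) (mtmul m n) = htop (ext σ hσ m) (ext τ hτ n) := by
  refine ext_unique _ fun y x => ?_
  have h : (ContinuousLinearMap.mul ℂ _ (htop (ext σ hσ m) (ext τ hτ n)) ∘L
      homCLM (tensorRep σ τ hσ hτ)) = homCLM (tensorRep σ τ hσ hτ) ∘L (mtmul m n).fst := by
    refine spatial_clm_ext fun a c => ?_
    change htop (ext σ hσ m) (ext τ hτ n) * tensorRep σ τ hσ hτ (tmul a c) =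
      tensorRep σ τ hσ hτ ((mtmul m n).fst (tmul a c))
    rw [mtmul_fst, tensorRep_tmul, tensorRep_tmul, htop_mul, ext_mul, ext_mul]
  exact congrArg (fun T => T y x) h

lemma star_mtmul (m : 𝓜(ℂ, A)) (n : 𝓜(ℂ, C)) : star (mtmul m n) = mtmul (star m) (star n) := by
  have hA := nondegRep_univHom A
  have hC := nondegRep_univHom C
  refine ext_injective (nondegRep_tensorRep hA hC)
    (tensorRep_injective hA hC (univHom_injective A) (univHom_injective C)) ?_
  rw [map_star, ext_tensorRep_mtmul, ext_tensorRep_mtmul, star_htop, map_star, map_star]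

variable {φ : A →⋆ₙₐ[ℂ] 𝓜(ℂ, B)} {ψ : C →⋆ₙₐ[ℂ] 𝓜(ℂ, D)}

/-- Composing φ and ψ with the universal representations of B and D gives nondegenerate
representations of A and C, whose tensor product exists on the spatial tensor product of A and C.
Its values multiply the image of B ⊗ D into itself. -/
lemma exists_tensorHom (hφ : Nondegenerate φ) (hψ : Nondegenerate ψ) :
    ∃ T : SpatialTensor A C →⋆ₙₐ[ℂ] 𝓜(ℂ, SpatialTensor B D),
      ∀ (a : A) (c : C), T (tmul a c) = mtmul (φ a) (ψ c) := by
  have hB := nondegRep_univHom B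
  have hD := nondegRep_univHom D
  have hi := tensorRep_injective hB hD (univHom_injective B) (univHom_injective D)
  set Θ := tensorRep _ _ (nondegRep_comp hB hφ) (nondegRep_comp hD hψ) with hΘ
  have hmem : ∀ y x, Θ y * tensorRep _ _ hB hD x ∈ Set.range (tensorRep _ _ hB hD) := by
    intro y x
    refine clm_mem_range (tensorRep _ _ hB hD) (dense_span_range_tmul A C)
      ((ContinuousLinearMap.mul ℂ _).flip (tensorRep _ _ hB hD x) ∘L homCLM Θ) ?_ y
    rintro _ ⟨a, c, rfl⟩
    change Θ (tmul a c) * _ ∈ _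
    rw [hΘ, tensorRep_tmul]
    exact htop_ext_mul_mem hB hD (φ a) (ψ c) x
  obtain ⟨T, hT⟩ := exists_lift_multiplier _ hi Θ hmem
  refine ⟨T, fun a c => mult_ext fun x => hi ?_⟩
  rw [hT, hΘ, tensorRep_tmul, ← ext_mul (nondegRep_tensorRep hB hD), ext_tensorRep_mtmul]
  rfl

lemma tensorHom_tmul (hφ : Nondegenerate φ) (hψ : Nondegenerate ψ) (a : A) (c : C) : tensorHom φ ψ (tmul a c) = mtmul (φ a) (ψ c) :=
  Classical.epsilon_spec (exists_tensorHom hφ hψ) a c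

lemma nondegenerate_tensorHom (hφ : Nondegenerate φ) (hψ : Nondegenerate ψ) : Nondegenerate (tensorHom φ ψ) := by
  refine (dense_span_tmul hφ hψ).mono (Submodule.span_mono ?_)
  rintro _ ⟨_, ⟨a, b, rfl⟩, _, ⟨c, d, rfl⟩, rfl⟩
  exact ⟨tmul a c, tmul b d, by rw [tensorHom_tmul hφ hψ, mtmul_fst]⟩

lemma ext_comp_tensorHom (hφ : Nondegenerate φ) (hψ : Nondegenerate ψ) {σ : B →⋆ₙₐ[ℂ] (H →L[ℂ] H)} {τ : D →⋆ₙₐ[ℂ] (K →L[ℂ] K)}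
    (hσ : NondegRep σ) (hτ : NondegRep τ) :
    (ext _ (nondegRep_tensorRep hσ hτ)).comp (tensorHom φ ψ) =
      tensorRep _ _ (nondegRep_comp hσ hφ) (nondegRep_comp hτ hψ) :=
  spatial_hom_ext fun a c => by
    change ext _ (nondegRep_tensorRep hσ hτ) (tensorHom φ ψ (tmul a c)) = _
    rw [tensorHom_tmul hφ hψ, ext_tensorRep_mtmul, tensorRep_tmul]; rfl

/-- The representation `σ ⊗ τ` of `M(B ⊗ D)` composed with the extension of `φ ⊗ ψ`. -/
lemma ext_bar_tensorHom (hφ : Nondegenerate φ) (hψ : Nondegenerate ψ) {σ : B →⋆ₙₐ[ℂ] (H →L[ℂ] H)} {τ : D →⋆ₙₐ[ℂ] (K →L[ℂ] K)}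
    (hσ : NondegRep σ) (hτ : NondegRep τ) (m : 𝓜(ℂ, SpatialTensor A C)) :
    ext _ (nondegRep_tensorRep hσ hτ) (bar (tensorHom φ ψ) m) =
      ext _ (nondegRep_tensorRep (nondegRep_comp hσ hφ) (nondegRep_comp hτ hψ)) m := by
  rw [ext_bar (nondegenerate_tensorHom hφ hψ)]
  exact ext_congr (ext_comp_tensorHom hφ hψ hσ hτ) m

variable (B D) in
lemma ext_univ_injective : Function.Injective
    (ext _ (nondegRep_tensorRep (nondegRep_univHom B) (nondegRep_univHom D))) :=
  ext_injective _ (tensorRep_injective _ _ (univHom_injective B) (univHom_injective D))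

lemma bar_tensorHom_mtmul (hφ : Nondegenerate φ) (hψ : Nondegenerate ψ) (m : 𝓜(ℂ, A)) (n : 𝓜(ℂ, C)) :
    bar (tensorHom φ ψ) (mtmul m n) = mtmul (bar φ m) (bar ψ n) := by
  refine ext_univ_injective B D ?_
  rw [ext_bar_tensorHom hφ hψ, ext_tensorRep_mtmul, ext_tensorRep_mtmul, ext_bar hφ, ext_bar hψ]

lemma tensorHom_comp (hφ : Nondegenerate φ) (hψ : Nondegenerate ψ) {B' D' : Type*} [NonUnitalCStarAlgebra B'] [NonUnitalCStarAlgebra D']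
    {φ' : B →⋆ₙₐ[ℂ] 𝓜(ℂ, B')} {ψ' : D →⋆ₙₐ[ℂ] 𝓜(ℂ, D')}
    (hφ' : Nondegenerate φ') (hψ' : Nondegenerate ψ') :
    (bar (tensorHom φ' ψ')).comp (tensorHom φ ψ) =
      tensorHom ((bar φ').comp φ) ((bar ψ').comp ψ) :=
  spatial_hom_ext fun a c => by
    change bar (tensorHom φ' ψ') (tensorHom φ ψ (tmul a c)) = _
    rw [tensorHom_tmul hφ hψ, bar_tensorHom_mtmul hφ' hψ', tensorHom_tmul (hφ'.comp hφ)
      (hψ'.comp hψ)]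
    rfl

lemma bar_tensorHom_comp (hφ : Nondegenerate φ) (hψ : Nondegenerate ψ) {B' D' : Type*} [NonUnitalCStarAlgebra B'] [NonUnitalCStarAlgebra D']
    {φ' : B →⋆ₙₐ[ℂ] 𝓜(ℂ, B')} {ψ' : D →⋆ₙₐ[ℂ] 𝓜(ℂ, D')}
    (hφ' : Nondegenerate φ') (hψ' : Nondegenerate ψ') (m : 𝓜(ℂ, SpatialTensor A C)) :
    bar (tensorHom φ' ψ') (bar (tensorHom φ ψ) m) =
      bar (tensorHom ((bar φ').comp φ) ((bar ψ').comp ψ)) m := by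
  rw [bar_bar (nondegenerate_tensorHom hφ hψ) (nondegenerate_tensorHom hφ' hψ'),
    tensorHom_comp hφ hψ hφ' hψ']

/-- Conjugation by a unitary operator. -/
def conjHom (U : H ≃ₗᵢ[ℂ] K) : (H →L[ℂ] H) →⋆ₙₐ[ℂ] (K →L[ℂ] K) :=
  { toFun := U.conjStarAlgEquiv
    map_smul' := map_smul U.conjStarAlgEquiv
    map_zero' := map_zero U.conjStarAlgEquiv
    map_add' := map_add U.conjStarAlgEquiv
    map_mul' := map_mul U.conjStarAlgEquiv
    map_star' := map_star U.conjStarAlgEquiv }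

lemma conjHom_apply (U : H ≃ₗᵢ[ℂ] K) (T : H →L[ℂ] H) (y : K) :
    conjHom U T y = U (T (U.symm y)) := rfl

lemma conjHom_apply_map (U : H ≃ₗᵢ[ℂ] K) (T : H →L[ℂ] H) (x : H) :
    conjHom U T (U x) = U (T x) := by rw [conjHom_apply, LinearIsometryEquiv.symm_apply_apply]

lemma conjHom_injective (U : H ≃ₗᵢ[ℂ] K) : Function.Injective (conjHom U) :=
  U.conjStarAlgEquiv.injective

lemma conjHom_assocHT (S : H →L[ℂ] H) (T : K →L[ℂ] K) (R : L →L[ℂ] L) :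
    conjHom (assocHT H K L) (htop (htop S T) R) = htop S (htop T R) := by
  refine ContinuousLinearMap.ext fun z => ?_
  obtain ⟨z, rfl⟩ := (assocHT H K L).surjective z
  rw [conjHom_apply_map]
  refine congrArg (fun Q : HT (HT H K) L →L[ℂ] HT H (HT K L) => Q z) (?_ :
    ((assocHT H K L : HT (HT H K) L →L[ℂ] HT H (HT K L)) ∘L htop (htop S T) R) =
      htop S (htop T R) ∘L (assocHT H K L : HT (HT H K) L →L[ℂ] HT H (HT K L)))
  refine htm_ext fun z z' => ?_
  refine congrArg (fun Q : HT H K →L[ℂ] HT H (HT K L) => Q z) (?_ :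
    ((assocHT H K L : HT (HT H K) L →L[ℂ] HT H (HT K L)) ∘L htop (htop S T) R) ∘L
        (htmL _ _).flip z' =
      (htop S (htop T R) ∘L (assocHT H K L : HT (HT H K) L →L[ℂ] HT H (HT K L))) ∘L
        (htmL _ _).flip z')
  refine htm_ext fun x y => ?_
  change assocHT H K L (htop (htop S T) R (htm (htm x y) z')) =
    htop S (htop T R) (assocHT H K L (htm (htm x y) z'))
  simp only [htop_htm, assocHT_htm]

lemma spatial_hom_ext₂ {E : Type*} [NonUnitalCStarAlgebra E]
    {f g : SpatialTensor (SpatialTensor A B) C →⋆ₙₐ[ℂ] E}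
    (h : ∀ a b c, f (tmul (tmul a b) c) = g (tmul (tmul a b) c)) : f = g :=
  spatial_hom_ext fun y c => by
    refine congrArg (fun Q : SpatialTensor A B →L[ℂ] E => Q y) (?_ :
      homCLM f ∘L (tmulL _ _).flip c = homCLM g ∘L (tmulL _ _).flip c)
    exact spatial_clm_ext fun a b => h a b c

variable (A B C) in
-- The associativity unitary of Hilbert spaces conjugates one faithful tensor representation into
-- the range of the other.
lemma exists_assocHom : ∃ T : SpatialTensor (SpatialTensor A B) C →⋆ₙₐ[ℂ]
    𝓜(ℂ, SpatialTensor A (SpatialTensor B C)), ∀ (a : A) (b : B) (c : C),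
      T (tmul (tmul a b) c) = incl _ (tmul a (tmul b c)) := by
  have hA := nondegRep_univHom A
  have hB := nondegRep_univHom B
  have hC := nondegRep_univHom C
  have hi := tensorRep_injective hA (nondegRep_tensorRep hB hC) (univHom_injective A)
    (tensorRep_injective hB hC (univHom_injective B) (univHom_injective C))
  obtain ⟨Θ, hΘ⟩ : ∃ Θ : SpatialTensor (SpatialTensor A B) C →⋆ₙₐ[ℂ] _, ∀ a b c,
      Θ (tmul (tmul a b) c) =
        tensorRep _ _ hA (nondegRep_tensorRep hB hC) (tmul a (tmul b c)) := by
    refine ⟨(conjHom (assocHT _ _ _)).comp (tensorRep _ _ (nondegRep_tensorRep hA hB) hC),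
      fun a b c => ?_⟩
    change conjHom _ (tensorRep _ _ (nondegRep_tensorRep hA hB) hC (tmul (tmul a b) c)) = _
    rw [tensorRep_tmul, tensorRep_tmul, tensorRep_tmul, conjHom_assocHT, tensorRep_tmul]
  generalize tensorRep _ _ hA (nondegRep_tensorRep hB hC) = ι at hi hΘ
  have hm₁ : ∀ y c, Θ (tmul y c) ∈ Set.range ι := by
    intro y c
    refine clm_mem_range ι (dense_span_range_tmul A B) (homCLM Θ ∘L (tmulL _ _).flip c) ?_ y
    rintro _ ⟨a, b, rfl⟩
    change Θ (tmul (tmul a b) c) ∈ _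
    rw [hΘ]
    exact Set.mem_range_self _
  have hm : ∀ y, Θ y ∈ Set.range ι := by
    refine clm_mem_range ι (dense_span_range_tmul (SpatialTensor A B) C) (homCLM Θ) ?_
    rintro _ ⟨y, c, rfl⟩
    exact hm₁ y c
  obtain ⟨T, hT⟩ := exists_lift_multiplier ι hi Θ (fun y x => by
    obtain ⟨z, hz⟩ := hm y
    exact ⟨z * x, by rw [map_mul, hz]⟩)
  refine ⟨T, fun a b c => mult_ext fun x => hi ?_⟩
  rw [hT, hΘ, incl_fst, map_mul]

lemma assocHom_tmul (a : A) (b : B) (c : C) :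
    assocHom A B C (tmul (tmul a b) c) = incl _ (tmul a (tmul b c)) :=
  Classical.epsilon_spec (exists_assocHom A B C) a b c

variable (A) in
lemma dense_span_mul : Dense (Submodule.span ℂ {x : A | ∃ a b, x = a * b} : Set A) := fun b =>
  mem_closure_mul (S := (Submodule.span ℂ {x : A | ∃ a b, x = a * b} : Set A))
    (fun e a => Submodule.subset_span ⟨e, a, rfl⟩) b

variable (A B C) in
lemma nondegenerate_assocHom : Nondegenerate (assocHom A B C) := by
  refine (dense_span_tmul (dense_span_mul A)
    (dense_span_tmul (dense_span_mul B) (dense_span_mul C))).mono (Submodule.span_mono ?_)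
  rintro _ ⟨_, ⟨a, a', rfl⟩, _, ⟨_, ⟨b, b', rfl⟩, _, ⟨c, c', rfl⟩, rfl⟩, rfl⟩
  refine ⟨tmul (tmul a b) c, tmul a' (tmul b' c'), ?_⟩
  rw [assocHom_tmul, incl_fst, tmul_mul, tmul_mul]

variable {σ : A →⋆ₙₐ[ℂ] (H →L[ℂ] H)} {τ : B →⋆ₙₐ[ℂ] (K →L[ℂ] K)} {κ : C →⋆ₙₐ[ℂ] (L →L[ℂ] L)}
  (hσ : NondegRep σ) (hτ : NondegRep τ) (hκ : NondegRep κ)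

lemma nondegRep_conj {σ : A →⋆ₙₐ[ℂ] (H →L[ℂ] H)} (hσ : NondegRep σ) (U : H ≃ₗᵢ[ℂ] K) :
    NondegRep ((conjHom U).comp σ) := by
  rw [nondegRep_iff] at *
  intro x hx
  have := hσ (U.symm x) fun a => by
    have := hx a
    exact U.map_eq_zero_iff.1 this
  exact U.symm.map_eq_zero_iff.1 this

lemma ext_conj {σ : A →⋆ₙₐ[ℂ] (H →L[ℂ] H)} (hσ : NondegRep σ) (U : H ≃ₗᵢ[ℂ] K) (m : 𝓜(ℂ, A)) :
    ext _ (nondegRep_conj hσ U) m = conjHom U (ext σ hσ m) :=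
  ext_unique _ fun a x => by
    change conjHom U (ext σ hσ m) (U (σ a (U.symm x))) = U (σ (m.fst a) (U.symm x))
    rw [conjHom_apply_map, ext_apply]

/-- In all nondegenerate representations associativity is conjugation by one unitary; this is what
turns the coassociativity axiom into an operator identity. -/
lemma ext_bar_assocHom (m : 𝓜(ℂ, SpatialTensor (SpatialTensor A B) C)) :
    ext _ (nondegRep_tensorRep hσ (nondegRep_tensorRep hτ hκ)) (bar (assocHom A B C) m) =
      conjHom (assocHT H K L) (ext _ (nondegRep_tensorRep (nondegRep_tensorRep hσ hτ) hκ) m) := by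
  rw [ext_bar (nondegenerate_assocHom A B C), ← ext_conj]
  refine ext_congr (spatial_hom_ext₂ fun a b c => ?_) m
  change ext _ (nondegRep_tensorRep hσ (nondegRep_tensorRep hτ hκ))
    (assocHom A B C (tmul (tmul a b) c)) = conjHom (assocHT H K L) (tensorRep _ _
      (nondegRep_tensorRep hσ hτ) hκ (tmul (tmul a b) c))
  rw [assocHom_tmul, ext_incl]
  simp only [tensorRep_tmul, conjHom_assocHT]

end TensorCalculus

/-! ### Continuous orbits. -/

section StrongContinuity

variable {S : Type*} [TopologicalSpace S] {E : Type*} {F : Type*} [NormedAddCommGroup E]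
  [NormedSpace ℂ E] [NormedAddCommGroup F] [NormedSpace ℂ F]

/-- For a bounded family of operators, the vectors with continuous orbit form a closed set. -/
lemma isClosed_continuous_orbit (T : S → E →L[ℂ] F) (hT : ∀ s, ‖T s‖ ≤ 1) :
    IsClosed {x : E | Continuous fun s => T s x} := by
  refine isClosed_of_closure_subset fun x hx => ?_
  refine continuous_of_uniform_approx_of_continuous fun u hu => ?_
  obtain ⟨ε, hε, hεu⟩ := Metric.mem_uniformity_dist.1 hu
  obtain ⟨y, hy, hxy⟩ := Metric.mem_closure_iff.1 hx ε hε
  refine ⟨fun s => T s y, hy, fun s => hεu ?_⟩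
  rw [dist_eq_norm, ← map_sub]
  refine ((T s).le_of_opNorm_le (hT s) _).trans_lt ?_
  rwa [one_mul, ← dist_eq_norm]

end StrongContinuity

/-! ### Haar integrals and the canonical map of G into the multipliers of the group algebra. -/

section GroupIntegrals

variable {G : Type v} [Group G] [TopologicalSpace G] [IsTopologicalGroup G]
  [LocallyCompactSpace G] [T2Space G] [MeasurableSpace G] [BorelSpace G]
variable {E : Type*} [NormedAddCommGroup E] [NormedSpace ℂ E] [CompleteSpace E]

lemma integrable_smul_of_continuous (f : C_c(G, ℂ)) {F : G → E} (hF : Continuous F) :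
    Integrable (fun s => f s • F s) (Measure.haar : Measure G) :=
  (f.continuous.smul hF).integrable_of_hasCompactSupport f.hasCompactSupport.smul_right

/-- Approximate identities: a continuous function `F` has weighted means close to `F 1`. -/
lemma exists_integral_smul_near {F : G → E} (hF : Continuous F) {ε : ℝ} (hε : 0 < ε) :
    ∃ f : C_c(G, ℂ), ‖∫ s, f s • F s ∂Measure.haar - F 1‖ ≤ ε := by
  have hU : {s | ‖F s - F 1‖ < ε} ∈ 𝓝 (1 : G) := by
    refine (isOpen_lt (by fun_prop) continuous_const).mem_nhds ?_
    simpa using hε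
  obtain ⟨V, hVU, hVo, h1V⟩ := mem_nhds_iff.1 hU
  obtain ⟨h, h1, hc, hs, h01⟩ := exists_continuousMap_one_of_isCompact_subset_isOpen
    (isCompact_singleton (x := (1 : G))) hVo (Set.singleton_subset_iff.2 h1V)
  have h0 : ∀ x, 0 ≤ h x := fun x => (h01 x).1
  have hpos : 0 < ∫ x, h x ∂(Measure.haar : Measure G) :=
    h.continuous.integral_pos_of_hasCompactSupport_nonneg_nonzero hc h0 (x := 1)
      (by rw [h1 rfl]; exact one_ne_zero)
  set I := ∫ x, h x ∂(Measure.haar : Measure G) with hI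
  -- A bump function normalised to integral one, supported where `F` stays within ε of `F 1`.
  let f : C_c(G, ℂ) :=
    { toFun := fun s => ((I⁻¹ * h s : ℝ) : ℂ)
      continuous_toFun := by fun_prop
      hasCompactSupport' := HasCompactSupport.mono (f := h) hc fun s hs => by
        contrapose! hs
        simp [Function.notMem_support.1 hs] }
  have hfs : ∀ s, f s = ((I⁻¹ * h s : ℝ) : ℂ) := fun s => rfl
  have hf1 : ∫ s, f s • F 1 ∂(Measure.haar : Measure G) = F 1 := by
    rw [integral_smul_const]
    simp only [hfs]
    rw [integral_complex_ofReal, integral_const_mul, ← hI, inv_mul_cancel₀ hpos.ne',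
      Complex.ofReal_one, one_smul]
  refine ⟨f, ?_⟩
  conv_lhs => enter [1, 2]; rw [← hf1]
  rw [← integral_sub (integrable_smul_of_continuous f hF)
    (integrable_smul_of_continuous f continuous_const)]
  have hint : Integrable (fun s => I⁻¹ * h s * ε) (Measure.haar : Measure G) :=
    ((h.continuous.integrable_of_hasCompactSupport hc).const_mul _).mul_const _
  calc ‖∫ s, (f s • F s - f s • F 1) ∂(Measure.haar : Measure G)‖
      ≤ ∫ s, I⁻¹ * h s * ε ∂(Measure.haar : Measure G) := by
        refine norm_integral_le_of_norm_le hint (Eventually.of_forall fun s => ?_)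
        rw [← smul_sub, norm_smul, hfs, Complex.norm_real, Real.norm_of_nonneg
          (mul_nonneg (inv_nonneg.2 hpos.le) (h0 s))]
        by_cases hsV : s ∈ V
        · exact mul_le_mul_of_nonneg_left (le_of_lt (hVU hsV))
            (mul_nonneg (inv_nonneg.2 hpos.le) (h0 s))
        · have : h s = 0 := by
            by_contra hne
            exact hsV (hs (subset_tsupport _ hne))
          simp [this]
    _ = ε := by
        rw [integral_mul_const, integral_const_mul, ← hI, inv_mul_cancel₀ hpos.ne', one_mul]

lemma continuousAt_integral_family {F : G → G → ℝ}
    (hF : Continuous (Function.uncurry F)) {s₀ : G}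
    {V : Set G} (hV : V ∈ 𝓝 s₀) {k : Set G} (hk : IsCompact k)
    (h : ∀ s ∈ V, ∀ t, t ∉ k → F s t = 0) :
    ContinuousAt (fun s => ∫ t, F s t ∂(Measure.haar : Measure G)) s₀ :=
  (continuousOn_integral_of_compact_support hk hF.continuousOn
    fun p x hp hx => h p hp x hx).continuousAt hV

/-- The element of `C*(G)` given by a function in `C_c(G)`. -/
def cc (f : C_c(G, ℂ)) : GroupAlg G :=
  ⟨integratedFamily f, NonUnitalStarSubalgebra.le_topologicalClosure _
    (NonUnitalStarAlgebra.subset_adjoin ℂ _ ⟨f, rfl⟩)⟩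

variable (G) in
lemma dense_adjoin_cc :
    Dense (NonUnitalStarAlgebra.adjoin ℂ (Set.range (cc (G := G))) : Set (GroupAlg G)) := by
  have h := generators_subtype (Set.range (integratedFamily (G := G)))
  have h2 : {y : (NonUnitalStarAlgebra.adjoin ℂ (Set.range (integratedFamily (G := G)))).topologicalClosure |
      (y : RepProduct G) ∈ Set.range (integratedFamily (G := G))} = Set.range (cc (G := G)) := by
    ext y
    exact exists_congr fun f =>
      ⟨fun hf => Subtype.ext hf, fun hf => congrArg Subtype.val hf⟩
  rw [h2] at h
  exact h

/-- The representation of `C*(G)` given by a unitary representation of `G`. -/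
def repHom (π : UnitaryRep G) : GroupAlg G →⋆ₙₐ[ℂ] (π.H →L[ℂ] π.H) :=
  (RepProduct.component π).comp (NonUnitalStarSubalgebraClass.subtype (groupAlg G))

lemma repHom_cc (π : UnitaryRep G) (f : C_c(G, ℂ)) : repHom π (cc f) = π.integrated f := rfl

lemma repHom_jointly_faithful {z : GroupAlg G} (h : ∀ π, repHom π z = 0) : z = 0 :=
  Subtype.ext (RepProduct.ext h)

lemma repHom_ext {z w : GroupAlg G} (h : ∀ π, repHom π z = repHom π w) : z = w :=
  Subtype.ext (RepProduct.ext h)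

lemma nondegRep_repHom (π : UnitaryRep G) : NondegRep (repHom π) := by
  rw [nondegRep_iff]
  intro x hx
  refine norm_le_zero_iff.1 (le_of_forall_pos_le_add fun ε hε => ?_)
  obtain ⟨f, hf⟩ := exists_integral_smul_near (π.cont x) hε
  have h := hx (cc f)
  rw [repHom_cc, π.integrated_apply] at h
  rw [h, zero_sub, norm_neg, map_one] at hf
  simpa using hf

lemma repHom_kG_fst (π : UnitaryRep G) (s : G) (z : GroupAlg G) :
    repHom π ((kG s).fst z) = (π.U s : π.H →L[ℂ] π.H) * repHom π z := rfl

lemma repHom_kG_snd (π : UnitaryRep G) (s : G) (z : GroupAlg G) :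
    repHom π ((kG s).snd z) = repHom π z * (π.U s : π.H →L[ℂ] π.H) := rfl

lemma ext_repHom_kG (π : UnitaryRep G) (s : G) :
    ext (repHom π) (nondegRep_repHom π) (kG s) = π.U s :=
  ext_unique _ fun z x => by rw [repHom_kG_fst]; rfl

lemma kG_snd (s : G) (z : GroupAlg G) : (kG s).snd z = star ((kG s⁻¹).fst (star z)) := by
  refine repHom_ext fun π => ?_
  rw [repHom_kG_snd, map_star, repHom_kG_fst, star_mul, map_star, star_star, map_inv]
  rw [← Unitary.star_eq_inv, Unitary.coe_star, star_star]

lemma norm_groupFamily_le (s : G) : ‖groupFamily s‖ ≤ 1 :=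
  lp.norm_le_of_forall_le zero_le_one fun π => π.opNorm_le s

lemma norm_kG_fst_le (s : G) : ‖(kG s).fst‖ ≤ (1 : ℝ) :=
  ContinuousLinearMap.opNorm_le_bound _ zero_le_one fun z => by
    change ‖groupFamily s * z.1‖ ≤ 1 * ‖z.1‖
    refine (norm_mul_le _ _).trans ?_
    gcongr
    exact norm_groupFamily_le s

lemma norm_cc_sub_le (f g : C_c(G, ℂ)) :
    ‖cc f - cc g‖ ≤ ∫ s, ‖f s - g s‖ ∂(Measure.haar : Measure G) := by
  refine lp.norm_le_of_forall_le (integral_nonneg fun _ => norm_nonneg _) fun π => ?_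
  have h : π.integrated f - π.integrated g = π.integrated (f - g) :=
    ContinuousLinearMap.ext fun x => by
      rw [sub_apply, π.integrated_apply, π.integrated_apply, π.integrated_apply,
        ← integral_sub (π.integrable f x) (π.integrable g x)]
      refine integral_congr_ae (Eventually.of_forall fun s => ?_)
      simp [sub_smul]
  change ‖π.integrated f - π.integrated g‖ ≤ _
  rw [h]
  exact π.norm_integrated_le (f - g)

lemma continuousAt_cc {F : G → C_c(G, ℂ)} (hF : Continuous fun p : G × G => F p.1 p.2) {s₀ : G}
    {V : Set G} (hV : V ∈ 𝓝 s₀) {k : Set G} (hk : IsCompact k)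
    (h : ∀ s ∈ V, ∀ t, t ∉ k → F s t = 0) : ContinuousAt (fun s => cc (F s)) s₀ := by
  have h1 : ContinuousAt (fun s => ∫ t, ‖F s t - F s₀ t‖ ∂(Measure.haar : Measure G)) s₀ := by
    refine continuousAt_integral_family (F := fun s t => ‖F s t - F s₀ t‖) ?_ hV hk ?_
    · have h2 : Continuous fun p : G × G => F s₀ p.2 := (F s₀).continuous.comp continuous_snd
      exact (hF.sub h2).norm
    · intro s hs t ht
      rw [h s hs t ht, h s₀ (mem_of_mem_nhds hV) t ht, sub_zero, norm_zero]
  rw [ContinuousAt, tendsto_iff_norm_sub_tendsto_zero]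
  refine squeeze_zero (fun _ => norm_nonneg _) (fun s => norm_cc_sub_le _ _) ?_
  have h2 := h1.tendsto
  simpa using h2

lemma kG_fst_cc (s : G) (f : C_c(G, ℂ)) : (kG s).fst (cc f) = cc (leftTranslate s f) :=
  Subtype.ext (groupFamily_mul_integratedFamily s f)

/-- The factor by which right translation by `s` changes the Haar measure. -/
def modFactor (s : G) : ℝ :=
  haveI : ((Measure.haar : Measure G).map (Homeomorph.mulRight s)).Regular :=
    Measure.Regular.map (Homeomorph.mulRight s)
  haveI : ((Measure.haar : Measure G).map (Homeomorph.mulRight s)).IsMulLeftInvariant :=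
    isMulLeftInvariant_map_mul_right (μ := Measure.haar) s
  Measure.haarScalarFactor ((Measure.haar : Measure G).map (Homeomorph.mulRight s)) Measure.haar

lemma integral_mulRight (s : G) (F : G → E) :
    ∫ t, F (t * s) ∂(Measure.haar : Measure G) =
      (modFactor s : ℂ) • ∫ t, F t ∂(Measure.haar : Measure G) := by
  have : ((Measure.haar : Measure G).map (Homeomorph.mulRight s)).Regular :=
    Measure.Regular.map (Homeomorph.mulRight s)
  have : ((Measure.haar : Measure G).map (Homeomorph.mulRight s)).IsMulLeftInvariant :=
    isMulLeftInvariant_map_mul_right (μ := Measure.haar) s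
  have h := Measure.isMulLeftInvariant_eq_smul_of_regular
    ((Measure.haar : Measure G).map (Homeomorph.mulRight s)) Measure.haar
  have h2 : ∫ t, F t ∂((Measure.haar : Measure G).map (Homeomorph.mulRight s)) =
      ∫ t, F (t * s) ∂(Measure.haar : Measure G) := by
    rw [(Homeomorph.mulRight s).measurableEmbedding.integral_map]; rfl
  rw [← h2]
  conv_lhs => rw [h]
  rw [integral_smul_nnreal_measure]
  exact (Complex.coe_smul _ _).symm

/-- For s in a compact neighbourhood V, the right translates of functions supported in k all have
support in the compact set k V⁻¹; this permits continuity under the integral. -/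
lemma exists_support_mulRight (s₀ : G) {k : Set G} (hk : IsCompact k) :
    ∃ V ∈ 𝓝 s₀, ∃ k' : Set G, IsCompact k' ∧ ∀ s ∈ V, ∀ t, t ∉ k' → t * s ∉ k := by
  obtain ⟨V, hVc, hV⟩ := exists_compact_mem_nhds s₀
  refine ⟨V, hV, k * V⁻¹, hk.mul hVc.inv, fun s hs t ht hts => ht ?_⟩
  exact ⟨t * s, hts, s⁻¹, by simpa using hs, by simp⟩

/-- The factor is the ratio of the integrals of a translated and an untranslated bump function, and
only the numerator depends on s. -/
lemma continuous_modFactor : Continuous (modFactor (G := G)) := by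
  obtain ⟨h, hc, h0, h1⟩ := exists_continuous_nonneg_pos (1 : G)
  have hpos : 0 < ∫ x, h x ∂(Measure.haar : Measure G) :=
    h.continuous.integral_pos_of_hasCompactSupport_nonneg_nonzero hc h0 h1
  have hp : ∀ s, modFactor s =
      (∫ t, h (t * s) ∂(Measure.haar : Measure G)) / ∫ t, h t ∂(Measure.haar : Measure G) := by
    intro s
    have := integral_mulRight s (fun t => (h t : ℂ))
    rw [integral_complex_ofReal, integral_complex_ofReal, smul_eq_mul, ← Complex.ofReal_mul,
      Complex.ofReal_inj] at this
    rw [this, mul_div_cancel_right₀ _ hpos.ne']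
  rw [show modFactor (G := G) = fun s => (∫ t, h (t * s) ∂(Measure.haar : Measure G)) /
    ∫ t, h t ∂(Measure.haar : Measure G) from funext hp]
  refine Continuous.div_const ?_ _
  refine continuous_iff_continuousAt.2 fun s₀ => ?_
  obtain ⟨V, hV, k, hk, hVk⟩ := exists_support_mulRight s₀ hc
  refine continuousAt_integral_family (F := fun s t => h (t * s)) ?_ hV hk ?_
  · exact h.continuous.comp (continuous_snd.mul continuous_fst)
  · intro s hs t ht
    by_contra hne
    exact hVk s hs t ht (subset_tsupport _ hne)

lemma kG_snd_cc (s : G) (f : C_c(G, ℂ)) :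
    (kG s).snd (cc f) = (modFactor s : ℂ) • cc (rightTranslate s f) := by
  refine repHom_ext fun π => ContinuousLinearMap.ext fun x => ?_
  rw [repHom_kG_snd, map_smul, smul_apply, repHom_cc, repHom_cc, π.integrated_apply,
    ← integral_mulRight s]
  change π.integrated f ((π.U s : π.H →L[ℂ] π.H) x) = _
  rw [π.integrated_apply]
  refine integral_congr_ae (Eventually.of_forall fun t => ?_)
  simp [rightTranslate_apply]

lemma continuous_kG_fst_cc (f : C_c(G, ℂ)) : Continuous fun s : G => (kG s).fst (cc f) := by
  simp only [kG_fst_cc]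
  refine continuous_iff_continuousAt.2 fun s₀ => ?_
  obtain ⟨V, hVc, hV⟩ := exists_compact_mem_nhds s₀
  refine continuousAt_cc ?_ hV (hVc.mul f.hasCompactSupport) fun s hs t ht => ?_
  · exact f.continuous.comp (continuous_fst.inv.mul continuous_snd)
  · by_contra hne
    exact ht ⟨s, hs, s⁻¹ * t, subset_tsupport _ hne, by simp⟩

lemma continuous_kG_snd_cc (f : C_c(G, ℂ)) : Continuous fun s : G => (kG s).snd (cc f) := by
  simp only [kG_snd_cc]
  have h1 : Continuous fun s : G => (modFactor s : ℂ) :=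
    Complex.continuous_ofReal.comp continuous_modFactor
  refine h1.smul ?_
  refine continuous_iff_continuousAt.2 fun s₀ => ?_
  obtain ⟨V, hV, k, hk, hVk⟩ := exists_support_mulRight s₀⁻¹ (k := tsupport f) f.hasCompactSupport
  have hV' : V⁻¹ ∈ 𝓝 s₀ := continuous_inv.continuousAt.preimage_mem_nhds hV
  refine continuousAt_cc ?_ hV' hk fun s hs t ht => ?_
  · exact f.continuous.comp (continuous_snd.mul continuous_fst.inv)
  · by_contra hne
    exact hVk s⁻¹ hs t ht (subset_tsupport _ hne)

lemma continuous_kG_fst_star_iff (z : GroupAlg G) :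
    Continuous (fun s : G => (kG s).fst (star z)) ↔ Continuous fun s : G => (kG s).snd z := by
  have h1 : (fun s : G => (kG s).snd z) = fun s => star ((kG s⁻¹).fst (star z)) :=
    funext fun s => kG_snd s z
  have h2 : (fun s : G => (kG s).fst (star z)) = fun s => star ((kG s⁻¹).snd z) :=
    funext fun s => by rw [kG_snd, inv_inv, star_star]
  constructor
  · intro h
    rw [h1]
    exact (h.comp continuous_inv).star
  · intro h
    rw [h2]
    exact (h.comp continuous_inv).star

/-- The map `s ↦ k_G(s) z` is norm continuous. -/
lemma continuous_kG_fst (z : GroupAlg G) : Continuous fun s : G => (kG s).fst z := by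
  -- Left and right multiplication are treated together because the adjoint exchanges them.
  have hgen : ∀ z ∈ NonUnitalStarAlgebra.adjoin ℂ (Set.range (cc (G := G))),
      (Continuous fun s : G => (kG s).fst z) ∧ Continuous fun s : G => (kG s).snd z := by
    intro z hz
    induction hz using NonUnitalStarAlgebra.adjoin_induction with
    | mem z hz =>
      obtain ⟨f, rfl⟩ := hz
      exact ⟨continuous_kG_fst_cc f, continuous_kG_snd_cc f⟩
    | add y z _ _ hy hz => simp only [map_add]; exact ⟨hy.1.add hz.1, hy.2.add hz.2⟩
    | zero => simp only [map_zero]; exact ⟨continuous_const, continuous_const⟩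
    | mul y z _ _ hy hz =>
      simp only [fst_mul, snd_mul]
      exact ⟨hy.1.mul continuous_const, continuous_const.mul hz.2⟩
    | smul c z _ hz => simp only [map_smul]; exact ⟨hz.1.const_smul c, hz.2.const_smul c⟩
    | star z _ hz =>
      refine ⟨(continuous_kG_fst_star_iff z).2 hz.2, (continuous_kG_fst_star_iff _).1 ?_⟩
      rw [star_star]; exact hz.1
  exact (isClosed_continuous_orbit (fun s : G => (kG s).fst) norm_kG_fst_le).closure_subset_iff.2
    (fun z hz => (hgen z hz).1) (dense_adjoin_cc G z)

lemma continuous_kG_snd (z : GroupAlg G) : Continuous fun s : G => (kG s).snd z :=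
  (continuous_kG_fst_star_iff z).1 (continuous_kG_fst _)

end GroupIntegrals

/-! ### Families of representations. -/

section LpProducts

variable {A : Type*} [NonUnitalCStarAlgebra A] {ι : Type*} {H : ι → Type*}
  [∀ i, NormedAddCommGroup (H i)] [∀ i, InnerProductSpace ℂ (H i)] [∀ i, CompleteSpace (H i)]

/-- The homomorphism into the bounded families given by a family of representations. -/
def lpHom (σ : ∀ i, A →⋆ₙₐ[ℂ] (H i →L[ℂ] H i)) : A →⋆ₙₐ[ℂ] lp (fun i => H i →L[ℂ] H i) ∞ where
  toFun a := ⟨fun i => σ i a, memℓp_infty ⟨‖a‖, by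
    rintro _ ⟨i, rfl⟩; exact NonUnitalStarAlgHom.norm_apply_le (σ i) a⟩⟩
  map_smul' c a := lp.ext (funext fun i => map_smul (σ i) c a)
  map_zero' := lp.ext (funext fun i => map_zero (σ i))
  map_add' a b := lp.ext (funext fun i => map_add (σ i) a b)
  map_mul' a b := lp.ext (funext fun i => map_mul (σ i) a b)
  map_star' a := lp.ext (funext fun i => map_star (σ i) a)

variable {B P : Type*} [NonUnitalCStarAlgebra B] [NonUnitalCStarAlgebra P]

/-- Products on both sides are required at the generators: the adjoint turns one into the other, and
the conclusion must pass to the generated `*`-algebra. -/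
lemma hom_mul_mem_range {s : Set A} (hs : Dense (NonUnitalStarAlgebra.adjoin ℂ s : Set A))
    (Θ : A →⋆ₙₐ[ℂ] P) (κ : B →⋆ₙₐ[ℂ] P)
    (h : ∀ x ∈ s, ∀ y, Θ x * κ y ∈ Set.range κ ∧ κ y * Θ x ∈ Set.range κ) (z : A) (y : B) :
    Θ z * κ y ∈ Set.range κ := by
  have hstar : ∀ {p}, p ∈ Set.range κ → star p ∈ Set.range κ := by
    rintro _ ⟨b, rfl⟩; exact ⟨star b, map_star κ b⟩
  have hadd : ∀ {p q}, p ∈ Set.range κ → q ∈ Set.range κ → p + q ∈ Set.range κ := by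
    rintro _ _ ⟨b, rfl⟩ ⟨b', rfl⟩; exact ⟨b + b', map_add κ b b'⟩
  have hsmul : ∀ (c : ℂ) {p}, p ∈ Set.range κ → c • p ∈ Set.range κ := by
    rintro c _ ⟨b, rfl⟩; exact ⟨c • b, map_smul κ c b⟩
  have key : ∀ z ∈ NonUnitalStarAlgebra.adjoin ℂ s, ∀ y,
      Θ z * κ y ∈ Set.range κ ∧ κ y * Θ z ∈ Set.range κ := by
    intro z hz
    induction hz using NonUnitalStarAlgebra.adjoin_induction with
    | mem z hz => exact h z hz
    | add z w _ _ hz hw =>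
      intro y
      rw [map_add, add_mul, mul_add]
      exact ⟨hadd (hz y).1 (hw y).1, hadd (hz y).2 (hw y).2⟩
    | zero => intro y; rw [map_zero, zero_mul, mul_zero]; exact ⟨⟨0, map_zero κ⟩, ⟨0, map_zero κ⟩⟩
    | mul z w _ _ hz hw =>
      intro y
      rw [map_mul, mul_assoc, ← mul_assoc (κ y)]
      obtain ⟨y₁, hy₁⟩ := (hw y).1
      obtain ⟨y₂, hy₂⟩ := (hz y).2
      rw [← hy₁, ← hy₂]
      exact ⟨(hz y₁).1, (hw y₂).2⟩
    | smul c z _ hz =>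
      intro y
      rw [map_smul, smul_mul_assoc, mul_smul_comm]
      exact ⟨hsmul c (hz y).1, hsmul c (hz y).2⟩
    | star z _ hz =>
      intro y
      have h1 := hstar (hz (star y)).2
      have h2 := hstar (hz (star y)).1
      rw [star_mul, map_star, star_star, ← map_star] at h1 h2
      exact ⟨h1, h2⟩
  have hcl : IsClosed {z | Θ z * κ y ∈ Set.range κ} := by
    have h1 : IsClosed (Set.range κ) := by simpa using isClosed_range κ
    have h2 := continuous_hom Θ
    exact h1.preimage (by fun_prop : Continuous fun z => Θ z * κ y)
  exact hcl.closure_subset_iff.2 (fun z hz => (key z hz y).1) (hs z)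

end LpProducts

/-! ### Tensor products of unitary representations and the comultiplication. -/

section TensorOfReps

variable {G : Type v} [Group G] [TopologicalSpace G] [IsTopologicalGroup G]

/-- The tensor product of two unitary representations. -/
def UnitaryRep.tensor (π ρ : UnitaryRep G) : UnitaryRep G where
  H := HT π.H ρ.H
  U :=
    { toFun := fun s => ⟨htop (π.U s : π.H →L[ℂ] π.H) (ρ.U s : ρ.H →L[ℂ] ρ.H), by
        rw [Unitary.mem_iff, star_htop, htop_mul, htop_mul, Unitary.star_mul_self_of_mem (π.U s).2,
          Unitary.star_mul_self_of_mem (ρ.U s).2, Unitary.mul_star_self_of_mem (π.U s).2,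
          Unitary.mul_star_self_of_mem (ρ.U s).2, htop_one]
        exact ⟨rfl, rfl⟩⟩
      map_one' := Subtype.ext (by
        change htop (π.U 1 : π.H →L[ℂ] π.H) (ρ.U 1 : ρ.H →L[ℂ] ρ.H) = 1
        rw [map_one, map_one]; exact htop_one)
      map_mul' := fun s t => Subtype.ext (by
        change htop (π.U (s * t) : π.H →L[ℂ] π.H) (ρ.U (s * t) : ρ.H →L[ℂ] ρ.H) =
          htop (π.U s : π.H →L[ℂ] π.H) (ρ.U s : ρ.H →L[ℂ] ρ.H) *
            htop (π.U t : π.H →L[ℂ] π.H) (ρ.U t : ρ.H →L[ℂ] ρ.H)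
        rw [htop_mul, map_mul, map_mul]; rfl) }
  cont z := by
    change Continuous fun s => htop (π.U s : π.H →L[ℂ] π.H) (ρ.U s : ρ.H →L[ℂ] ρ.H) z
    refine ht_induction z (isClosed_continuous_orbit
      (fun s => htop (π.U s : π.H →L[ℂ] π.H) (ρ.U s : ρ.H →L[ℂ] ρ.H)) fun s =>
        (norm_htop_le _ _).trans (mul_le_one₀ (π.opNorm_le s) (norm_nonneg _) (ρ.opNorm_le s)))
      fun t => ?_
    induction t using TensorProduct.induction_on with
    | zero => simp only [map_zero]; exact continuous_const
    | add t t' ht ht' => simp only [map_add]; exact ht.add ht'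
    | tmul x y =>
      change Continuous fun s => htop (π.U s : π.H →L[ℂ] π.H) (ρ.U s : ρ.H →L[ℂ] ρ.H) (htm x y)
      simp only [htop_htm]
      exact ((htmL π.H ρ.H).continuous.comp (π.cont x)).clm_apply (ρ.cont y)

variable [LocallyCompactSpace G] [T2Space G] [MeasurableSpace G] [BorelSpace G]

/-- The representation of `C*(G)` given by the tensor product of two unitary representations. -/
def diagRep (π ρ : UnitaryRep G) : GroupAlg G →⋆ₙₐ[ℂ] (HT π.H ρ.H →L[ℂ] HT π.H ρ.H) :=
  repHom (π.tensor ρ)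

lemma diagRep_cc_apply (π ρ : UnitaryRep G) (f : C_c(G, ℂ)) (x : HT π.H ρ.H) :
    diagRep π ρ (cc f) x =
      ∫ s, f s • htop (π.U s : π.H →L[ℂ] π.H) (ρ.U s : ρ.H →L[ℂ] ρ.H) x ∂Measure.haar := rfl

lemma diagRep_kG_fst (π ρ : UnitaryRep G) (s : G) (z : GroupAlg G) :
    diagRep π ρ ((kG s).fst z) =
      htop (π.U s : π.H →L[ℂ] π.H) (ρ.U s : ρ.H →L[ℂ] ρ.H) * diagRep π ρ z := rfl

/-- The tensor product of the representations `π` and `ρ` of `C*(G)`. -/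
abbrev repTensor (π ρ : UnitaryRep G) : SpatialTensor (GroupAlg G) (GroupAlg G) →⋆ₙₐ[ℂ]
    (HT π.H ρ.H →L[ℂ] HT π.H ρ.H) :=
  tensorRep (repHom π) (repHom ρ) (nondegRep_repHom π) (nondegRep_repHom ρ)


lemma continuous_diag_fst (a c : GroupAlg G) :
    Continuous fun s : G => tmul ((kG s).fst a) ((kG s).fst c) :=
  ((tmulL _ _).continuous.comp (continuous_kG_fst a)).clm_apply (continuous_kG_fst c)

lemma continuous_diag_snd (a c : GroupAlg G) :
    Continuous fun s : G => tmul ((kG s).snd a) ((kG s).snd c) :=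
  ((tmulL _ _).continuous.comp (continuous_kG_snd a)).clm_apply (continuous_kG_snd c)

/-- By norm continuity of s ↦ k(s)a, the integral converges in the spatial tensor product itself,
and its value does not depend on π and ρ. -/
lemma diagRep_mul_repTensor (π ρ : UnitaryRep G) (f : C_c(G, ℂ)) (a c : GroupAlg G) :
    diagRep π ρ (cc f) * repTensor π ρ (tmul a c) =
      repTensor π ρ (∫ s, f s • tmul ((kG s).fst a) ((kG s).fst c) ∂Measure.haar) := by
  refine ContinuousLinearMap.ext fun x => ?_
  have h := ((homCLM (repTensor π ρ)).flip x).integral_comp_comm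
    (integrable_smul_of_continuous f (continuous_diag_fst a c))
  refine Eq.trans ?_ h
  change diagRep π ρ (cc f) (repTensor π ρ (tmul a c) x) = _
  rw [diagRep_cc_apply]
  refine integral_congr_ae (Eventually.of_forall fun s => ?_)
  change f s • htop (π.U s : π.H →L[ℂ] π.H) (ρ.U s : ρ.H →L[ℂ] ρ.H) (repTensor π ρ (tmul a c) x) =
    repTensor π ρ (f s • tmul ((kG s).fst a) ((kG s).fst c)) x
  rw [map_smul, tensorRep_tmul, tensorRep_tmul, repHom_kG_fst, repHom_kG_fst,
    ← htop_mul]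
  rfl

lemma repTensor_mul_diagRep (π ρ : UnitaryRep G) (f : C_c(G, ℂ)) (a c : GroupAlg G) :
    repTensor π ρ (tmul a c) * diagRep π ρ (cc f) =
      repTensor π ρ (∫ s, f s • tmul ((kG s).snd a) ((kG s).snd c) ∂Measure.haar) := by
  refine ContinuousLinearMap.ext fun x => ?_
  have h := ((homCLM (repTensor π ρ)).flip x).integral_comp_comm
    (integrable_smul_of_continuous f (continuous_diag_snd a c))
  refine Eq.trans ?_ h
  have h2 := (repTensor π ρ (tmul a c)).integral_comp_comm ((π.tensor ρ).integrable f x)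
  refine Eq.trans h2.symm ?_
  refine integral_congr_ae (Eventually.of_forall fun s => ?_)
  change repTensor π ρ (tmul a c)
      (f s • htop (π.U s : π.H →L[ℂ] π.H) (ρ.U s : ρ.H →L[ℂ] ρ.H) x) =
    repTensor π ρ (f s • tmul ((kG s).snd a) ((kG s).snd c)) x
  rw [map_smul, map_smul, tensorRep_tmul, tensorRep_tmul, repHom_kG_snd,
    repHom_kG_snd, ← htop_mul]
  rfl

lemma repTensor_jointly_faithful {y y' : SpatialTensor (GroupAlg G) (GroupAlg G)}
    (h : ∀ π ρ, repTensor π ρ y = repTensor π ρ y') : y = y' :=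
  sub_eq_zero.1 (tensorRep_jointly_faithful nondegRep_repHom nondegRep_repHom
    (fun _ => repHom_jointly_faithful) (fun _ => repHom_jointly_faithful)
    fun π ρ => by rw [map_sub, sub_eq_zero]; exact h π ρ)

variable (G) in
-- All pairs (π, ρ) are used at once: the family of the π ⊗ ρ is faithful on the tensor product, and
-- the family of the integrated forms of s ↦ π(s) ⊗ ρ(s) multiplies its image into itself.
lemma exists_comul : ∃ Δ : GroupAlg G →⋆ₙₐ[ℂ] 𝓜(ℂ, SpatialTensor (GroupAlg G) (GroupAlg G)),
    Nondegenerate Δ ∧ ∀ s : G, bar Δ (kG s) = mtmul (kG s) (kG s) := by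
  let κ := lpHom (fun i : UnitaryRep G × UnitaryRep G => repTensor i.1 i.2)
  let Θ := lpHom (fun i : UnitaryRep G × UnitaryRep G => diagRep i.1 i.2)
  have hκ : Function.Injective κ := fun y y' h => repTensor_jointly_faithful fun π ρ =>
    congrArg (fun T : lp (fun i : UnitaryRep G × UnitaryRep G =>
      HT i.1.H i.2.H →L[ℂ] HT i.1.H i.2.H) ∞ => T.1 (π, ρ)) h
  have hl : ∀ f a c, Θ (cc f) * κ (tmul a c) =
      κ (∫ s, f s • tmul ((kG s).fst a) ((kG s).fst c) ∂Measure.haar) := fun f a c =>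
    lp.ext (funext fun i => diagRep_mul_repTensor i.1 i.2 f a c)
  have hr : ∀ f a c, κ (tmul a c) * Θ (cc f) =
      κ (∫ s, f s • tmul ((kG s).snd a) ((kG s).snd c) ∂Measure.haar) := fun f a c =>
    lp.ext (funext fun i => repTensor_mul_diagRep i.1 i.2 f a c)
  have hmem : ∀ z y, Θ z * κ y ∈ Set.range κ := by
    refine hom_mul_mem_range (dense_adjoin_cc G) Θ κ ?_
    rintro _ ⟨f, rfl⟩ y
    constructor
    · refine clm_mem_range κ (dense_span_range_tmul _ _)
        (ContinuousLinearMap.mul ℂ _ (Θ (cc f)) ∘L homCLM κ) ?_ y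
      rintro _ ⟨a, c, rfl⟩
      exact ⟨_, (hl f a c).symm⟩
    · refine clm_mem_range κ (dense_span_range_tmul _ _)
        ((ContinuousLinearMap.mul ℂ _).flip (Θ (cc f)) ∘L homCLM κ) ?_ y
      rintro _ ⟨a, c, rfl⟩
      exact ⟨_, (hr f a c).symm⟩
  obtain ⟨Δ, hΔ⟩ := exists_lift_multiplier κ hκ Θ hmem
  have hΔ' : ∀ π ρ z y, repTensor π ρ ((Δ z).fst y) = diagRep π ρ z * repTensor π ρ y :=
    fun π ρ z y => congrArg (fun T : lp (fun i : UnitaryRep G × UnitaryRep G =>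
      HT i.1.H i.2.H →L[ℂ] HT i.1.H i.2.H) ∞ => T.1 (π, ρ)) (hΔ z y)
  -- Δ(f) applied to a ⊗ c is the mean of k(s)a ⊗ k(s)c with weight f, which is close to a ⊗ c for f
  -- concentrated near the identity.
  have hnd : Nondegenerate Δ := by
    refine dense_span_of_clm (dense_span_range_tmul _ _)
      (ContinuousLinearMap.id ℂ _) denseRange_id ?_
    rintro _ ⟨a, c, rfl⟩
    rw [Metric.mem_closure_iff]
    intro ε hε
    obtain ⟨f, hf⟩ := exists_integral_smul_near (continuous_diag_fst a c) (half_pos hε)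
    refine ⟨(Δ (cc f)).fst (tmul a c), Submodule.subset_span ⟨_, _, rfl⟩, ?_⟩
    have h1 : (Δ (cc f)).fst (tmul a c) =
        ∫ s, f s • tmul ((kG s).fst a) ((kG s).fst c) ∂Measure.haar :=
      hκ (by rw [hΔ, hl])
    have h2 : tmul ((kG (1 : G)).fst a) ((kG (1 : G)).fst c) = tmul a c := by
      have : ∀ z, (kG (1 : G)).fst z = z := fun z => repHom_ext fun π => by
        rw [repHom_kG_fst, map_one]; exact one_mul _
      rw [this, this]
    rw [h2, ← h1] at hf
    change dist (tmul a c) _ < ε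
    rw [dist_comm, dist_eq_norm]
    exact hf.trans_lt (half_lt_self hε)
  refine ⟨Δ, hnd, fun s => hnd.mult_ext fun z y => ?_⟩
  rw [bar_fst hnd]
  refine repTensor_jointly_faithful fun π ρ => ?_
  rw [hΔ', ← ext_mul (nondegRep_tensorRep (nondegRep_repHom π) (nondegRep_repHom ρ)),
    ext_tensorRep_mtmul, ext_repHom_kG, ext_repHom_kG, hΔ', diagRep_kG_fst, mul_assoc]

variable (G) in
lemma nondegenerate_comul : Nondegenerate (comul G) :=
  (Classical.epsilon_spec (exists_comul G)).1

lemma bar_comul_kG (s : G) : bar (comul G) (kG s) = mtmul (kG s) (kG s) :=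
  (Classical.epsilon_spec (exists_comul G)).2 s

/-- A nondegenerate representation of `C*(G)` is determined by the unitaries that it assigns to the
group elements. -/
lemma eq_repHom {π : UnitaryRep G} {Ψ : GroupAlg G →⋆ₙₐ[ℂ] (π.H →L[ℂ] π.H)} (hΨ : NondegRep Ψ)
    (h : ∀ s, ext Ψ hΨ (kG s) = π.U s) : Ψ = repHom π := by
  refine hom_ext_of_generators (dense_adjoin_cc G) ?_
  rintro _ ⟨f, rfl⟩
  -- Left multiplication by f is a norm convergent integral of group elements, and a representation
  -- commutes with such integrals.
  have hmul : ∀ z, cc f * z = ∫ s, f s • (kG s).fst z ∂(Measure.haar : Measure G) := by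
    intro z
    refine repHom_ext fun ρ => ContinuousLinearMap.ext fun x => ?_
    have h := ((homCLM (repHom ρ)).flip x).integral_comp_comm
      (integrable_smul_of_continuous f (continuous_kG_fst z))
    refine Eq.trans ?_ h
    rw [map_mul]
    change ρ.integrated f (repHom ρ z x) = _
    rw [ρ.integrated_apply]
    refine integral_congr_ae (Eventually.of_forall fun s => ?_)
    change f s • (ρ.U s : ρ.H →L[ℂ] ρ.H) (repHom ρ z x) = repHom ρ (f s • (kG s).fst z) x
    rw [map_smul, repHom_kG_fst]; rfl
  refine hΨ.clm_ext fun z x => ?_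
  have h1 : Ψ (cc f) (Ψ z x) = Ψ (cc f * z) x := by rw [map_mul]; rfl
  have h2 := ((homCLM Ψ).flip x).integral_comp_comm
    (integrable_smul_of_continuous f (continuous_kG_fst z))
  rw [h1, hmul, repHom_cc, π.integrated_apply]
  refine Eq.trans h2.symm ?_
  refine integral_congr_ae (Eventually.of_forall fun s => ?_)
  change Ψ (f s • (kG s).fst z) x = f s • (π.U s : π.H →L[ℂ] π.H) (Ψ z x)
  rw [map_smul, ← h, ext_apply]; rfl

/-- Both sides are nondegenerate and agree on group elements. In this form the comultiplication
enters the operator computations. -/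
lemma ext_repTensor_comp_comul (π ρ : UnitaryRep G) :
    (ext _ (nondegRep_tensorRep (nondegRep_repHom π) (nondegRep_repHom ρ))).comp (comul G) =
      diagRep π ρ := by
  refine eq_repHom (π := π.tensor ρ) (nondegRep_comp _ (nondegenerate_comul G)) fun s => ?_
  refine (ext_bar (nondegenerate_comul G)
    (nondegRep_tensorRep (nondegRep_repHom π) (nondegRep_repHom ρ)) (kG s)).symm.trans ?_
  rw [bar_comul_kG, ext_tensorRep_mtmul, ext_repHom_kG, ext_repHom_kG]
  rfl

end TensorOfReps

/-! ### Square integrable functions with values in a Hilbert space. -/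

section VectorValued

variable {G : Type v} [Group G] [TopologicalSpace G] [IsTopologicalGroup G]
  [LocallyCompactSpace G] [T2Space G] [MeasurableSpace G] [BorelSpace G]
variable {H : Type*} [NormedAddCommGroup H] [InnerProductSpace ℂ H] [CompleteSpace H]

variable (G H) in
/-- Square integrable functions with values in a Hilbert space. -/
abbrev L2V := Lp H 2 (Measure.haar : Measure G)

/-- The product of a scalar function and a vector. -/
def smulVec (f : L2 G) (x : H) : L2V G H :=
  ((ContinuousLinearMap.lsmul ℂ ℂ).flip x : ℂ →L[ℂ] H).compLp f

lemma coeFn_smulVec (f : L2 G) (x : H) :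
    ∀ᵐ t ∂(Measure.haar : Measure G), smulVec f x t = f t • x :=
  ContinuousLinearMap.coeFn_compLp _ f

variable (G H) in
/-- The product of scalar functions and vectors on the algebraic tensor product. -/
def algVec : L2 G ⊗[ℂ] H →ₗ[ℂ] L2V G H :=
  TensorProduct.lift (LinearMap.mk₂ ℂ smulVec
    (fun f g x => ((ContinuousLinearMap.lsmul ℂ ℂ).flip x : ℂ →L[ℂ] H).compLpL 2 _ |>.map_add f g)
    (fun c f x => ((ContinuousLinearMap.lsmul ℂ ℂ).flip x : ℂ →L[ℂ] H).compLpL 2 _ |>.map_smul c f)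
    (fun f x y => by
      rw [smulVec, map_add]; exact ContinuousLinearMap.add_compLp _ _ f)
    (fun c f x => by
      rw [smulVec, map_smul]; exact ContinuousLinearMap.smul_compLp c _ f))

lemma algVec_tmul (f : L2 G) (x : H) : algVec G H (f ⊗ₜ x) = smulVec f x := rfl

lemma inner_smulVec (f g : L2 G) (x y : H) :
    inner ℂ (smulVec f x) (smulVec g y) = inner ℂ f g * inner ℂ x y := by
  rw [L2.inner_def, L2.inner_def, ← integral_mul_const]
  refine integral_congr_ae ?_
  filter_upwards [coeFn_smulVec f x, coeFn_smulVec g y] with t hf hg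
  rw [hf, hg, inner_smul_left, inner_smul_right]
  simp only [RCLike.inner_apply]
  ring

lemma inner_algVec (s t : L2 G ⊗[ℂ] H) :
    inner ℂ (algVec G H s) (algVec G H t) = inner ℂ s t := by
  induction s using TensorProduct.induction_on with
  | zero => simp
  | add s s' hs hs' => rw [map_add, inner_add_left, inner_add_left, hs, hs']
  | tmul f x =>
    induction t using TensorProduct.induction_on with
    | zero => simp
    | add s s' hs hs' => rw [map_add, inner_add_right, inner_add_right, hs, hs']
    | tmul g y => rw [algVec_tmul, algVec_tmul, inner_smulVec, TensorProduct.inner_tmul]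

variable (G H) in
lemma denseRange_algVec : DenseRange (algVec G H) := by
  intro ξ
  have hcl : IsClosed ((LinearMap.range (algVec G H)).topologicalClosure : Set (L2V G H)) :=
    Submodule.isClosed_topologicalClosure _
  refine Lp.induction (p := 2) (μ := (Measure.haar : Measure G)) (E := H) ENNReal.ofNat_ne_top
    (fun ξ => ξ ∈ (LinearMap.range (algVec G H)).topologicalClosure) ?_ ?_ hcl ξ
  · intro x s hs hμs
    refine Submodule.le_topologicalClosure _
      ⟨indicatorConstLp 2 hs hμs.ne (1 : ℂ) ⊗ₜ x, ?_⟩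
    rw [algVec_tmul, Lp.simpleFunc.coe_indicatorConst]
    refine Lp.ext ?_
    filter_upwards [coeFn_smulVec (indicatorConstLp 2 hs hμs.ne (1 : ℂ)) x,
      indicatorConstLp_coeFn (p := 2) (hs := hs) (hμs := hμs.ne) (c := (1 : ℂ)),
      indicatorConstLp_coeFn (p := 2) (hs := hs) (hμs := hμs.ne) (c := x)] with t h1 h2 h3
    rw [h1, h2, h3]
    by_cases ht : t ∈ s <;> simp [ht]
  · intro f g hf hg _ h1 h2
    exact add_mem h1 h2

variable (G H) in
/-- The identification of `L²(G) ⊗ H` with the square integrable functions with values in `H`. -/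
def vecEquiv : HT (L2 G) H ≃ₗᵢ[ℂ] L2V G H :=
  (LinearEquiv.refl ℂ (L2 G ⊗[ℂ] H)).extendOfIsometry (htIn (L2 G) H).toLinearMap (algVec G H)
    (denseRange_htIn _ _) (denseRange_algVec G H) fun t => by
      refine Eq.trans ?_ ((htIn (L2 G) H).norm_map t).symm
      have h := inner_algVec t t
      rw [inner_self_eq_norm_sq_to_K,
        (inner_self_eq_norm_sq_to_K t : inner ℂ t t = ((‖t‖ : ℂ)) ^ 2)] at h
      norm_cast at h
      exact (sq_eq_sq₀ (norm_nonneg _) (norm_nonneg _)).1 h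

lemma vecEquiv_htm (f : L2 G) (x : H) : vecEquiv G H (htm f x) = smulVec f x :=
  LinearEquiv.extendOfIsometry_eq (LinearEquiv.refl ℂ (L2 G ⊗[ℂ] H)) (htIn (L2 G) H).toLinearMap
    (algVec G H) (denseRange_htIn _ _) (denseRange_algVec G H) _ (f ⊗ₜ x)

lemma memLp_cc (ξ : C_c(G, H)) : MemLp ξ 2 (Measure.haar : Measure G) :=
  ξ.continuous.memLp_of_hasCompactSupport ξ.hasCompactSupport

variable (G H) in
/-- The class of a compactly supported continuous function. -/
def ccLp : C_c(G, H) →ₗ[ℂ] L2V G H where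
  toFun ξ := (memLp_cc ξ).toLp ξ
  map_add' ξ η := MemLp.toLp_add (memLp_cc ξ) (memLp_cc η)
  map_smul' c ξ := MemLp.toLp_const_smul c (memLp_cc ξ)

lemma coeFn_ccLp (ξ : C_c(G, H)) : ccLp G H ξ =ᵐ[(Measure.haar : Measure G)] ξ :=
  (memLp_cc ξ).coeFn_toLp

variable (G H) in
lemma denseRange_ccLp : DenseRange (ccLp G H) := by
  intro ξ
  have hcl : IsClosed ((LinearMap.range (ccLp G H)).topologicalClosure : Set (L2V G H)) :=
    Submodule.isClosed_topologicalClosure _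
  refine Lp.induction (p := 2) (μ := (Measure.haar : Measure G)) (E := H) ENNReal.ofNat_ne_top
    (fun ξ => ξ ∈ (LinearMap.range (ccLp G H)).topologicalClosure) ?_
    (fun f g hf hg _ h1 h2 => add_mem h1 h2) hcl ξ
  intro x s hs hμs
  rw [Lp.simpleFunc.coe_indicatorConst]
  change _ ∈ closure (LinearMap.range (ccLp G H) : Set (L2V G H))
  rw [Metric.mem_closure_iff]
  intro ε hε
  -- On sets of measure at most η, the constant function x has L²-norm at most ε / 2; regularity
  -- then provides a compact K inside s and an open V around s with V \ K that small.
  obtain ⟨η, η_pos, hη⟩ := exists_eLpNorm_indicator_le (μ := (Measure.haar : Measure G))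
    (p := 2) ENNReal.ofNat_ne_top x (ε := ENNReal.ofReal (ε / 2)) (by simpa using hε)
  have hη2 : ((η / 2 : ℝ≥0) : ℝ≥0∞) ≠ 0 := by simpa using η_pos.ne'
  obtain ⟨V, hsV, hVo, -, hV⟩ := hs.exists_isOpen_sdiff_lt hμs.ne hη2
  obtain ⟨K, hKs, hK, hKμ⟩ := hs.exists_isCompact_sdiff_lt hμs.ne hη2
  obtain ⟨f, hf1, hfc, hfV, hf01⟩ := exists_continuousMap_one_of_isCompact_subset_isOpen hK hVo
    (hKs.trans hsV)
  let g : C_c(G, H) :=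
    { toFun := fun t => (f t : ℂ) • x
      continuous_toFun := by fun_prop
      hasCompactSupport' := HasCompactSupport.mono (f := f) hfc fun t ht => by
        contrapose! ht
        simp [Function.notMem_support.1 ht] }
  refine ⟨_, ⟨g, rfl⟩, ?_⟩
  -- The bump function is 1 on K and 0 off V, so it differs from the indicator only on V \ K, by at
  -- most one.
  have hle : ∀ᵐ t ∂(Measure.haar : Measure G),
      ‖(indicatorConstLp 2 hs hμs.ne x - ccLp G H g : L2V G H) t‖ ≤
        ‖(V \ K).indicator (fun _ => x) t‖ := by
    filter_upwards [Lp.coeFn_sub (indicatorConstLp 2 hs hμs.ne x) (ccLp G H g),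
      indicatorConstLp_coeFn (p := 2) (hs := hs) (hμs := hμs.ne) (c := x), coeFn_ccLp g]
      with t h1 h2 h3
    rw [h1, Pi.sub_apply, h2, h3]
    change ‖s.indicator (fun _ => x) t - (f t : ℂ) • x‖ ≤ _
    by_cases htK : t ∈ K
    · rw [Set.indicator_of_mem (hKs htK), hf1 htK]
      simp
    by_cases htV : t ∈ V
    · rw [Set.indicator_of_mem (show t ∈ V \ K from ⟨htV, htK⟩)]
      by_cases hts : t ∈ s
      · rw [Set.indicator_of_mem hts]
        nth_rw 1 [← one_smul ℂ x]
        rw [← sub_smul, norm_smul, ← Complex.ofReal_one, ← Complex.ofReal_sub, Complex.norm_real,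
          Real.norm_of_nonneg (sub_nonneg.2 (hf01 t).2)]
        exact mul_le_of_le_one_left (norm_nonneg _) (sub_le_self _ (hf01 t).1)
      · rw [Set.indicator_of_notMem hts, zero_sub, norm_neg, norm_smul, Complex.norm_real,
          Real.norm_of_nonneg (hf01 t).1]
        exact mul_le_of_le_one_left (norm_nonneg _) (hf01 t).2
    · have hft : f t = 0 := by
        by_contra hne
        exact htV (hfV (subset_tsupport _ hne))
      rw [Set.indicator_of_notMem (fun h => htV (hsV h)), hft]
      simp
  have hVK : (Measure.haar : Measure G) (V \ K) ≤ η := by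
    calc (Measure.haar : Measure G) (V \ K)
        ≤ (Measure.haar : Measure G) (V \ s ∪ s \ K) := measure_mono fun t ht => by
          by_cases hts : t ∈ s
          · exact Or.inr ⟨hts, ht.2⟩
          · exact Or.inl ⟨ht.1, hts⟩
      _ ≤ ((η / 2 : ℝ≥0) : ℝ≥0∞) + ((η / 2 : ℝ≥0) : ℝ≥0∞) :=
          (measure_union_le _ _).trans (add_le_add hV.le hKμ.le)
      _ = η := by rw [← ENNReal.coe_add, add_halves]
  rw [dist_eq_norm, Lp.norm_def]
  refine (ENNReal.toReal_mono ENNReal.ofReal_ne_top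
    ((eLpNorm_mono_ae hle).trans (hη _ hVK))).trans_lt ?_
  rw [ENNReal.toReal_ofReal (by positivity)]
  exact half_lt_self hε

lemma ccLp_clm_ext {F : Type*} [NormedAddCommGroup F] [NormedSpace ℂ F] {S T : L2V G H →L[ℂ] F}
    (h : ∀ ξ, S (ccLp G H ξ) = T (ccLp G H ξ)) : S = T :=
  ContinuousLinearMap.ext fun x => (denseRange_ccLp G H).induction_on (p := fun x => S x = T x) x
    (isClosed_eq S.continuous T.continuous) h

variable (H) in
/-- Left translation of vector valued functions. -/
def transV (s : G) : L2V G H →L[ℂ] L2V G H :=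
  LinearMap.mkContinuous
    { toFun := fun ξ => DomMulAct.mk s⁻¹ • ξ
      map_add' := fun ξ η => smul_add _ ξ η
      map_smul' := fun c ξ => smul_comm _ c ξ } 1 fun ξ => by
    rw [one_mul]; exact (DomMulAct.norm_smul_Lp _ ξ).le

lemma coeFn_transV (s : G) (ξ : L2V G H) :
    ∀ᵐ t ∂(Measure.haar : Measure G), transV H s ξ t = ξ (s⁻¹ * t) :=
  DomMulAct.smul_Lp_ae_eq (DomMulAct.mk s⁻¹) ξ

variable (H) in
/-- Multiplication of vector valued functions by a scalar function. -/
def multV (f : C₀(G, ℂ)) : L2V G H →L[ℂ] L2V G H :=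
  (ContinuousLinearMap.lsmul ℂ ℂ : ℂ →L[ℂ] H →L[ℂ] H).holderL Measure.haar ∞ 2 2 (toLinfty f)

lemma coeFn_toLinfty (f : C₀(G, ℂ)) : ∀ᵐ t ∂(Measure.haar : Measure G), toLinfty f t = f t :=
  MemLp.coeFn_toLp _

lemma coeFn_multV (f : C₀(G, ℂ)) (ξ : L2V G H) :
    ∀ᵐ t ∂(Measure.haar : Measure G), multV H f ξ t = f t • ξ t := by
  have h : multV H f ξ =ᵐ[Measure.haar] fun t => toLinfty f t • ξ t :=
    ContinuousLinearMap.coeFn_holder _ _ _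
  filter_upwards [h, coeFn_toLinfty f] with t h1 h2
  rw [h1, h2]

lemma coeFn_multOp (f : C₀(G, ℂ)) (ξ : L2 G) :
    ∀ᵐ t ∂(Measure.haar : Measure G), multOp f ξ t = f t * ξ t := by
  have h : multOp f ξ =ᵐ[Measure.haar] fun t => toLinfty f t * ξ t :=
    ContinuousLinearMap.coeFn_holder _ _ _
  filter_upwards [h, coeFn_toLinfty f] with t h1 h2
  rw [h1, h2]

/-- The operators of the regular representation. -/
def lamOp (s : G) : L2 G →L[ℂ] L2 G := ((regularRep G).U s).1

lemma lamOp_apply (s : G) (f : L2 G) : lamOp s f = transV ℂ s f := rfl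

lemma ae_comp_mulLeft (s : G) {p : G → Prop} (h : ∀ᵐ t ∂(Measure.haar : Measure G), p t) :
    ∀ᵐ t ∂(Measure.haar : Measure G), p (s⁻¹ * t) :=
  (measurePreserving_mul_left (Measure.haar : Measure G) s⁻¹).quasiMeasurePreserving.ae h

lemma vecEquiv_translate (s : G) (T : H →L[ℂ] H) (z : HT (L2 G) H) :
    vecEquiv G H (htop (lamOp s) T z) =
      T.compLpL 2 _ (transV H s (vecEquiv G H z)) := by
  refine congrArg (fun R : HT (L2 G) H →L[ℂ] L2V G H => R z) (?_ :
    (vecEquiv G H : HT (L2 G) H →L[ℂ] L2V G H) ∘L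
      htop (lamOp s) T =
    T.compLpL 2 _ ∘L transV H s ∘L (vecEquiv G H : HT (L2 G) H →L[ℂ] L2V G H))
  refine htm_ext fun f x => ?_
  change vecEquiv G H (htop (lamOp s) T (htm f x)) =
    T.compLpL 2 _ (transV H s (vecEquiv G H (htm f x)))
  rw [htop_htm, vecEquiv_htm, vecEquiv_htm, lamOp_apply]
  refine Lp.ext ?_
  filter_upwards [coeFn_smulVec (transV ℂ s f) (T x), coeFn_transV s f,
    ContinuousLinearMap.coeFn_compLpL T (transV H s (smulVec f x)), coeFn_transV s (smulVec f x),
    ae_comp_mulLeft s (coeFn_smulVec f x)] with t h1 h2 h3 h4 h5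
  rw [h1, h2, h3, h4, h5, map_smul]

lemma vecEquiv_mult (f : C₀(G, ℂ)) (z : HT (L2 G) H) :
    vecEquiv G H (htop (multOp f) 1 z) = multV H f (vecEquiv G H z) := by
  refine congrArg (fun R : HT (L2 G) H →L[ℂ] L2V G H => R z) (?_ :
    (vecEquiv G H : HT (L2 G) H →L[ℂ] L2V G H) ∘L htop (multOp f) 1 =
    multV H f ∘L (vecEquiv G H : HT (L2 G) H →L[ℂ] L2V G H))
  refine htm_ext fun g x => ?_
  change vecEquiv G H (htop (multOp f) 1 (htm g x)) = multV H f (vecEquiv G H (htm g x))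
  rw [htop_htm, vecEquiv_htm, vecEquiv_htm]
  refine Lp.ext ?_
  filter_upwards [coeFn_smulVec (multOp f g) ((1 : H →L[ℂ] H) x), coeFn_multOp f g,
    coeFn_multV f (smulVec g x), coeFn_smulVec g x] with t h1 h2 h3 h4
  rw [h1, h2, h3, h4, smul_smul]; rfl

end VectorValued

/-! ### The absorption unitary, defined first on compactly supported continuous functions. -/

section Twist

variable {G : Type v} [Group G] [TopologicalSpace G] [IsTopologicalGroup G]
  [LocallyCompactSpace G] [T2Space G] [MeasurableSpace G] [BorelSpace G]

/-- Strong continuity suffices for joint continuity because the operators are isometric. -/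
lemma UnitaryRep.continuous_apply (π : UnitaryRep G) {X : Type*} [TopologicalSpace X] {g : X → G}
    (hg : Continuous g) {ξ : X → π.H} (hξ : Continuous ξ) :
    Continuous fun t => (π.U (g t) : π.H →L[ℂ] π.H) (ξ t) := by
  refine continuous_iff_continuousAt.2 fun t₀ => ?_
  rw [ContinuousAt, tendsto_iff_norm_sub_tendsto_zero]
  have h1 : Tendsto (fun t => ‖ξ t - ξ t₀‖ + ‖(π.U (g t) : π.H →L[ℂ] π.H) (ξ t₀) -
      (π.U (g t₀) : π.H →L[ℂ] π.H) (ξ t₀)‖) (𝓝 t₀) (𝓝 0) := by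
    have h2 := tendsto_iff_norm_sub_tendsto_zero.1 (hξ.tendsto t₀)
    have h3 := tendsto_iff_norm_sub_tendsto_zero.1 (((π.cont (ξ t₀)).comp hg).tendsto t₀)
    simpa using h2.add h3
  refine squeeze_zero (fun _ => norm_nonneg _) (fun t => ?_) h1
  calc _ = ‖(π.U (g t) : π.H →L[ℂ] π.H) (ξ t - ξ t₀) + ((π.U (g t) : π.H →L[ℂ] π.H) (ξ t₀) -
        (π.U (g t₀) : π.H →L[ℂ] π.H) (ξ t₀))‖ := by rw [map_sub]; congr 1; abel
    _ ≤ _ := (norm_add_le _ _).trans (by rw [π.norm_apply])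

lemma UnitaryRep.mul_apply (π : UnitaryRep G) (s t : G) (x : π.H) :
    (π.U (s * t) : π.H →L[ℂ] π.H) x = (π.U s : π.H →L[ℂ] π.H) ((π.U t : π.H →L[ℂ] π.H) x) := by
  rw [map_mul]; rfl

lemma UnitaryRep.one_apply (π : UnitaryRep G) (x : π.H) : (π.U 1 : π.H →L[ℂ] π.H) x = x := by
  rw [map_one]; rfl

/-- The function `t ↦ π(g(t)) ξ(t)`. -/
def UnitaryRep.ccAct (π : UnitaryRep G) (g : C(G, G)) (ξ : C_c(G, π.H)) : C_c(G, π.H) where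
  toFun t := (π.U (g t) : π.H →L[ℂ] π.H) (ξ t)
  continuous_toFun := π.continuous_apply g.continuous ξ.continuous
  hasCompactSupport' := ξ.hasCompactSupport.mono fun t ht => by
    contrapose! ht
    simp [Function.notMem_support.1 ht]

/-- The map `ξ ↦ (t ↦ π(t) ξ(t))` on compactly supported continuous functions. -/
def UnitaryRep.ccTwist (π : UnitaryRep G) : C_c(G, π.H) ≃ₗ[ℂ] C_c(G, π.H) where
  toFun := π.ccAct (ContinuousMap.id G)
  invFun := π.ccAct ⟨fun t => t⁻¹, continuous_inv⟩
  map_add' ξ η := CompactlySupportedContinuousMap.ext fun t => map_add (π.U t : π.H →L[ℂ] π.H) (ξ t) (η t)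
  map_smul' c ξ := CompactlySupportedContinuousMap.ext fun t =>
    map_smul (π.U t : π.H →L[ℂ] π.H) c (ξ t)
  left_inv ξ := CompactlySupportedContinuousMap.ext fun t => by
    change (π.U t⁻¹ : π.H →L[ℂ] π.H) ((π.U t : π.H →L[ℂ] π.H) (ξ t)) = ξ t
    rw [← π.mul_apply, inv_mul_cancel, π.one_apply]
  right_inv ξ := CompactlySupportedContinuousMap.ext fun t => by
    change (π.U t : π.H →L[ℂ] π.H) ((π.U t⁻¹ : π.H →L[ℂ] π.H) (ξ t)) = ξ t
    rw [← π.mul_apply, mul_inv_cancel, π.one_apply]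

lemma UnitaryRep.ccTwist_apply (π : UnitaryRep G) (ξ : C_c(G, π.H)) (t : G) :
    π.ccTwist ξ t = (π.U t : π.H →L[ℂ] π.H) (ξ t) := rfl

lemma UnitaryRep.norm_ccTwist (π : UnitaryRep G) (ξ : C_c(G, π.H)) :
    ‖ccLp G π.H (π.ccTwist ξ)‖ = ‖ccLp G π.H ξ‖ := by
  change ‖(memLp_cc _).toLp _‖ = ‖(memLp_cc _).toLp _‖
  rw [Lp.norm_toLp, Lp.norm_toLp]
  congr 1
  exact eLpNorm_congr_norm_ae (Eventually.of_forall fun t => π.norm_apply t (ξ t))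

/-- The unitary operator `(W ξ)(t) = π(t) ξ(t)`. -/
def UnitaryRep.twist (π : UnitaryRep G) : L2V G π.H ≃ₗᵢ[ℂ] L2V G π.H :=
  π.ccTwist.extendOfIsometry (ccLp G π.H) (ccLp G π.H) (denseRange_ccLp _ _) (denseRange_ccLp _ _)
    π.norm_ccTwist

lemma UnitaryRep.twist_ccLp (π : UnitaryRep G) (ξ : C_c(G, π.H)) :
    π.twist (ccLp G π.H ξ) = ccLp G π.H (π.ccTwist ξ) := by
  unfold UnitaryRep.twist
  exact LinearEquiv.extendOfIsometry_eq π.ccTwist (ccLp G π.H) (ccLp G π.H) (denseRange_ccLp _ _)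
    (denseRange_ccLp _ _) π.norm_ccTwist ξ

/-- The identity π(t)ξ(s⁻¹t) = π(s)π(s⁻¹t)ξ(s⁻¹t); absorption of π by the regular representation
reduces to it. -/
lemma UnitaryRep.twist_translate (π : UnitaryRep G) (s : G) (ξ : L2V G π.H) :
    π.twist (transV π.H s ξ) =
      (π.U s : π.H →L[ℂ] π.H).compLpL 2 _ (transV π.H s (π.twist ξ)) := by
  refine congrArg (fun R : L2V G π.H →L[ℂ] L2V G π.H => R ξ) (?_ :
    (π.twist : L2V G π.H →L[ℂ] L2V G π.H) ∘L transV π.H s =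
    (π.U s : π.H →L[ℂ] π.H).compLpL 2 _ ∘L transV π.H s ∘L (π.twist : L2V G π.H →L[ℂ] L2V G π.H))
  refine ccLp_clm_ext fun ξ => ?_
  change π.twist (transV π.H s (ccLp G π.H ξ)) =
    (π.U s : π.H →L[ℂ] π.H).compLpL 2 _ (transV π.H s (π.twist (ccLp G π.H ξ)))
  let η : C_c(G, π.H) :=
    { toFun := fun t => ξ (s⁻¹ * t)
      continuous_toFun := ξ.continuous.comp (continuous_const_mul s⁻¹)
      hasCompactSupport' := ξ.hasCompactSupport.comp_homeomorph (Homeomorph.mulLeft s⁻¹) }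
  have hη : transV π.H s (ccLp G π.H ξ) = ccLp G π.H η := by
    refine Lp.ext ?_
    filter_upwards [coeFn_transV s (ccLp G π.H ξ), ae_comp_mulLeft s (coeFn_ccLp ξ),
      coeFn_ccLp η] with t h1 h2 h3
    rw [h1, h2, h3]; rfl
  rw [hη, π.twist_ccLp, π.twist_ccLp]
  refine Lp.ext ?_
  filter_upwards [coeFn_ccLp (π.ccTwist η), ContinuousLinearMap.coeFn_compLpL
    (π.U s : π.H →L[ℂ] π.H) (transV π.H s (ccLp G π.H (π.ccTwist ξ))),
    coeFn_transV s (ccLp G π.H (π.ccTwist ξ)), ae_comp_mulLeft s (coeFn_ccLp (π.ccTwist ξ))]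
    with t h1 h2 h3 h4
  rw [h1, h2, h3, h4, π.ccTwist_apply, π.ccTwist_apply, ← π.mul_apply, mul_inv_cancel_left]
  rfl

lemma UnitaryRep.twist_mult (π : UnitaryRep G) (f : C₀(G, ℂ)) (ξ : L2V G π.H) :
    π.twist (multV π.H f ξ) = multV π.H f (π.twist ξ) := by
  refine congrArg (fun R : L2V G π.H →L[ℂ] L2V G π.H => R ξ) (?_ :
    (π.twist : L2V G π.H →L[ℂ] L2V G π.H) ∘L multV π.H f =
    multV π.H f ∘L (π.twist : L2V G π.H →L[ℂ] L2V G π.H))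
  refine ccLp_clm_ext fun ξ => ?_
  change π.twist (multV π.H f (ccLp G π.H ξ)) = multV π.H f (π.twist (ccLp G π.H ξ))
  let η : C_c(G, π.H) :=
    { toFun := fun t => f t • ξ t
      continuous_toFun := f.continuous.smul ξ.continuous
      hasCompactSupport' := ξ.hasCompactSupport.smul_left }
  have hη : multV π.H f (ccLp G π.H ξ) = ccLp G π.H η := by
    refine Lp.ext ?_
    filter_upwards [coeFn_multV f (ccLp G π.H ξ), coeFn_ccLp ξ, coeFn_ccLp η] with t h1 h2 h3
    rw [h1, h2, h3]; rfl
  rw [hη, π.twist_ccLp, π.twist_ccLp]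
  refine Lp.ext ?_
  filter_upwards [coeFn_ccLp (π.ccTwist η), coeFn_multV f (ccLp G π.H (π.ccTwist ξ)),
    coeFn_ccLp (π.ccTwist ξ)] with t h1 h2 h3
  rw [h1, h2, h3, π.ccTwist_apply, π.ccTwist_apply, ← map_smul]
  rfl

/-- The unitary operator on `L²(G) ⊗ H` given by `(W ξ)(t) = π(t) ξ(t)`. -/
def UnitaryRep.W (π : UnitaryRep G) : HT (L2 G) π.H ≃ₗᵢ[ℂ] HT (L2 G) π.H :=
  (vecEquiv G π.H).trans (π.twist.trans (vecEquiv G π.H).symm)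

lemma UnitaryRep.vecEquiv_W (π : UnitaryRep G) (z : HT (L2 G) π.H) :
    vecEquiv G π.H (π.W z) = π.twist (vecEquiv G π.H z) :=
  (vecEquiv G π.H).apply_symm_apply _

lemma UnitaryRep.W_translate (π : UnitaryRep G) (s : G) :
    conjHom π.W (htop (lamOp s) 1) =
      htop (lamOp s) (π.U s : π.H →L[ℂ] π.H) := by
  refine ContinuousLinearMap.ext fun z => ?_
  obtain ⟨z, rfl⟩ := π.W.surjective z
  rw [conjHom_apply_map]
  refine (vecEquiv G π.H).injective ?_
  rw [π.vecEquiv_W, vecEquiv_translate, vecEquiv_translate, π.vecEquiv_W, ← π.twist_translate]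
  congr 1
  refine Lp.ext ?_
  filter_upwards [ContinuousLinearMap.coeFn_compLpL (1 : π.H →L[ℂ] π.H)
    (transV π.H s (vecEquiv G π.H z))] with t ht
  rw [ht]; rfl

/-- W acts pointwise in t, so scalar functions of t commute with it. -/
lemma UnitaryRep.W_mult (π : UnitaryRep G) (f : C₀(G, ℂ)) :
    conjHom π.W (htop (multOp f) 1) = htop (multOp f) 1 := by
  refine ContinuousLinearMap.ext fun z => ?_
  obtain ⟨z, rfl⟩ := π.W.surjective z
  rw [conjHom_apply_map]
  refine (vecEquiv G π.H).injective ?_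
  rw [π.vecEquiv_W, vecEquiv_mult, vecEquiv_mult, π.vecEquiv_W, π.twist_mult]

/-- The slices of `W` are the multiplication operators by the coefficients of `π`. -/
lemma UnitaryRep.slice_W (π : UnitaryRep G) (g h : π.H) (w : C₀(G, ℂ))
    (hw : ∀ t, w t = Inner.inner ℂ g ((π.U t : π.H →L[ℂ] π.H) h)) :
    ContinuousLinearMap.adjoint ((htmL (L2 G) π.H).flip g) ∘L
      (π.W : HT (L2 G) π.H →L[ℂ] HT (L2 G) π.H) ∘L (htmL (L2 G) π.H).flip h = multOp w := by
  refine ccLp_clm_ext fun f => ext_inner_left ℂ fun f' => ?_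
  change Inner.inner ℂ f' (ContinuousLinearMap.adjoint ((htmL (L2 G) π.H).flip g)
    (π.W (htm (ccLp G ℂ f) h))) = Inner.inner ℂ f' (multOp w (ccLp G ℂ f))
  rw [ContinuousLinearMap.adjoint_inner_right]
  change Inner.inner ℂ (htm f' g) (π.W (htm (ccLp G ℂ f) h)) = _
  rw [← (vecEquiv G π.H).inner_map_map, π.vecEquiv_W, vecEquiv_htm, vecEquiv_htm]
  let η : C_c(G, π.H) :=
    { toFun := fun t => f t • h
      continuous_toFun := f.continuous.smul continuous_const
      hasCompactSupport' := f.hasCompactSupport.smul_right }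
  have hη : smulVec (ccLp G ℂ f) h = ccLp G π.H η := by
    refine Lp.ext ?_
    filter_upwards [coeFn_smulVec (ccLp G ℂ f) h, coeFn_ccLp f, coeFn_ccLp η] with t h1 h2 h3
    rw [h1, h2, h3]; rfl
  rw [hη, π.twist_ccLp, L2.inner_def, L2.inner_def]
  refine integral_congr_ae ?_
  filter_upwards [coeFn_smulVec f' g, coeFn_ccLp (π.ccTwist η), coeFn_multOp w (ccLp G ℂ f),
    coeFn_ccLp f] with t h1 h2 h3 h4
  rw [h1, h2, h3, h4, π.ccTwist_apply, hw]
  change Inner.inner ℂ (f' t • g) ((π.U t : π.H →L[ℂ] π.H) (f t • h)) = _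
  rw [map_smul, inner_smul_left, inner_smul_right]
  simp only [RCLike.inner_apply]
  ring

end Twist

/-! ### Amplification by the identity operator. -/

section Amplification

variable {A : Type*} [NonUnitalCStarAlgebra A]
variable {H : Type*} [NormedAddCommGroup H] [InnerProductSpace ℂ H] [CompleteSpace H]
variable {K : Type*} [NormedAddCommGroup K] [InnerProductSpace ℂ K] [CompleteSpace K]

variable (H K) in
/-- The amplification `T ↦ T ⊗ 1`. -/
def ampHom : (H →L[ℂ] H) →⋆ₙₐ[ℂ] (HT H K →L[ℂ] HT H K) where
  toFun T := htop T 1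
  map_smul' c T := htop_smul_left c T 1
  map_zero' := by simpa using htop_smul_left (0 : ℂ) (0 : H →L[ℂ] H) (1 : K →L[ℂ] K)
  map_add' S T := htop_add_left S T 1
  map_mul' S T := by rw [htop_mul, one_mul]
  map_star' T := by rw [star_htop, star_one]

lemma ampHom_apply (T : H →L[ℂ] H) : ampHom H K T = htop T 1 := rfl

lemma nondegRep_ampHom {σ : A →⋆ₙₐ[ℂ] (H →L[ℂ] H)} (hσ : NondegRep σ) :
    NondegRep ((ampHom H K).comp σ) := by
  refine (dense_span_htm (K := K) (t := Set.univ) hσ (by simp)).mono ?_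
  refine Submodule.span_mono ?_
  rintro _ ⟨_, ⟨a, x, rfl⟩, y, -, rfl⟩
  exact ⟨a, htm x y, by
    change _ = htop (σ a) 1 (htm x y)
    rw [htop_htm]; rfl⟩

lemma ext_ampHom {σ : A →⋆ₙₐ[ℂ] (H →L[ℂ] H)} (hσ : NondegRep σ) (m : 𝓜(ℂ, A)) :
    ext _ (nondegRep_ampHom (K := K) hσ) m = htop (ext σ hσ m) 1 :=
  ext_unique _ fun a x => by
    change htop (ext σ hσ m) 1 (htop (σ a) 1 x) = htop (σ (m.fst a)) 1 x
    rw [← ext_mul hσ, ← one_mul (1 : K →L[ℂ] K), ← htop_mul]; rfl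

lemma htop_one_injective [Nontrivial K] :
    Function.Injective fun T : H →L[ℂ] H => htop T (1 : K →L[ℂ] K) := by
  intro S T h
  obtain ⟨y, hy⟩ := exists_ne (0 : K)
  refine ContinuousLinearMap.ext fun x => ?_
  have h1 := congrArg (fun R : HT H K →L[ℂ] HT H K => R (htm x y)) h
  simp only [htop_htm] at h1
  have h2 : htm (S x - T x) y = 0 := by
    rw [sub_eq_add_neg, ← neg_one_smul ℂ (T x), htm_add_left, htm_smul_left]
    change htm (S x) y = htm (T x) y at h1
    rw [h1, neg_one_smul, add_neg_cancel]
  have h3 := norm_htm (S x - T x) y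
  rw [h2, norm_zero, eq_comm, mul_eq_zero, norm_eq_zero, norm_eq_zero] at h3
  exact sub_eq_zero.1 (h3.resolve_right hy)

end Amplification

/-! ### Compact operators and their multipliers. -/

section CompactOperatorsRep

variable (H : Type*) [NormedAddCommGroup H] [InnerProductSpace ℂ H] [CompleteSpace H]

/-- The identity representation of the compact operators. -/
def idK : CompactOps H →⋆ₙₐ[ℂ] (H →L[ℂ] H) :=
  NonUnitalStarSubalgebraClass.subtype (compactOps H)

lemma idK_injective : Function.Injective (idK H) := Subtype.val_injective

lemma nondegRep_idK : NondegRep (idK H) := by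
  rw [nondegRep_iff]
  intro x hx
  have hc : IsCompactOperator ((innerSL ℂ x).smulRight x : H →L[ℂ] H) :=
    (IsCompactOperator.clm_comp (f := (ContinuousLinearMap.id ℂ ℂ : ℂ →L[ℂ] ℂ))
      (isCompactOperator_id_iff_locallyCompactSpace.2 inferInstance)
      ((ContinuousLinearMap.id ℂ ℂ).smulRight x : ℂ →L[ℂ] H)).comp_clm (innerSL ℂ x)
  have h := hx ⟨_, hc⟩
  change inner ℂ x x • x = 0 at h
  rcases smul_eq_zero.1 h with h | h
  · exact inner_self_eq_zero.1 h
  · exact h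

variable {H}

lemma ext_idK (T : H →L[ℂ] H) : ext _ (nondegRep_idK H) (boundedToMultiplier H T) = T :=
  ext_unique _ fun _ _ => rfl

/-- A nondegenerate representation maps an approximate unit to one converging strongly to `1`. -/
lemma NondegRep.exists_tendsto {A : Type*} [NonUnitalCStarAlgebra A] {σ : A →⋆ₙₐ[ℂ] (H →L[ℂ] H)}
    (hσ : NondegRep σ) : ∃ l : Filter A, l.NeBot ∧ (∀ x, Tendsto (fun e => σ e x) l (𝓝 x)) ∧
      ∀ᶠ e in l, ‖e‖ ≤ 1 := by
  obtain ⟨l, hl, h1, -, h2⟩ := exists_approxUnit A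
  refine ⟨l, hl, fun x => ?_, h2⟩
  rw [Metric.tendsto_nhds]
  intro η hη
  have hx : x ∈ closure (Submodule.span ℂ {y : H | ∃ a x, y = σ a x} : Set H) := hσ x
  obtain ⟨y, hy, hxy⟩ := Metric.mem_closure_iff.1 hx (η / 3) (by positivity)
  have hy' : Tendsto (fun e => σ e y) l (𝓝 y) := by
    clear hxy
    induction hy using Submodule.span_induction with
    | mem y hy =>
      obtain ⟨a, x, rfl⟩ := hy
      have : Tendsto (fun e => σ (e * a) x) l (𝓝 (σ a x)) :=
        (((homCLM σ).flip x).continuous.tendsto a).comp (h1 a)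
      simpa only [map_mul, mul_apply_eq_comp] using this
    | zero => simp
    | add y z _ _ hy hz => simpa only [map_add] using hy.add hz
    | smul c y _ hy => simpa only [map_smul] using hy.const_smul c
  filter_upwards [Metric.tendsto_nhds.1 hy' (η / 3) (by positivity), h2] with e he he'
  have h3 : ‖σ e (x - y)‖ ≤ ‖x - y‖ := by
    refine ((σ e).le_of_opNorm_le ((NonUnitalStarAlgHom.norm_apply_le σ e).trans he') _).trans ?_
    rw [one_mul]
  rw [map_sub] at h3
  rw [dist_eq_norm] at *
  have : σ e x - x = (σ e x - σ e y) + (σ e y - y) - (x - y) := by abel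
  rw [this]
  refine (norm_sub_le _ _).trans_lt ?_
  have := norm_add_le (σ e x - σ e y) (σ e y - y)
  linarith

/-- Strong convergence σ(e) → 1 with ‖e‖ ≤ 1 is uniform on the totally bounded image of the unit
ball under T. -/
lemma exists_norm_sub_mul_lt {A : Type*} [NonUnitalCStarAlgebra A] {σ : A →⋆ₙₐ[ℂ] (H →L[ℂ] H)}
    (hσ : NondegRep σ) (T : H →L[ℂ] H) (hT : IsCompactOperator T) {ε : ℝ} (hε : 0 < ε) :
    ∃ a, ‖σ a * T - T‖ ≤ ε := by
  obtain ⟨l, hl, hlim, h2⟩ := hσ.exists_tendsto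
  have htb : TotallyBounded (T '' Metric.closedBall 0 1) :=
    ((IsCompactOperator.isCompact_closure_image_closedBall
      (f := (T : H →ₗ[ℂ] H)) hT 1).totallyBounded).subset subset_closure
  obtain ⟨t, htf, hcov⟩ := Metric.totallyBounded_iff.1 htb (ε / 3) (by positivity)
  have hev : ∀ᶠ e in l, ∀ y ∈ t, ‖σ e y - y‖ < ε / 3 := by
    rw [htf.eventually_all]
    intro y _
    filter_upwards [Metric.tendsto_nhds.1 (hlim y) (ε / 3) (by positivity)] with e he
    rwa [← dist_eq_norm]
  obtain ⟨e, he, he'⟩ := (hev.and h2).exists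
  have hn : ‖σ e‖ ≤ 1 := (NonUnitalStarAlgHom.norm_apply_le σ e).trans he'
  refine ⟨e, ContinuousLinearMap.opNorm_le_of_unit_norm (𝕜 := ℂ) hε.le fun x hx => ?_⟩
  obtain ⟨y, hy, hxy⟩ : ∃ y ∈ t, dist (T x) y < ε / 3 := by
    simpa using hcov ⟨x, by simp [hx], rfl⟩
  rw [dist_eq_norm] at hxy
  have h3 := (σ e).le_of_opNorm_le hn (T x - y)
  change ‖σ e (T x) - T x‖ ≤ ε
  have : σ e (T x) - T x = σ e (T x - y) + (σ e y - y) - (T x - y) := by rw [map_sub]; abel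
  rw [this]
  refine (norm_sub_le _ _).trans ?_
  have h4 := norm_add_le (σ e (T x - y)) (σ e y - y)
  have h5 := he y hy
  linarith

lemma nondegenerate_boundedToMultiplier_comp {A : Type*} [NonUnitalCStarAlgebra A]
    {σ : A →⋆ₙₐ[ℂ] (H →L[ℂ] H)} (hσ : NondegRep σ) :
    Nondegenerate ((boundedToMultiplier H).comp σ) := by
  intro T
  refine Metric.mem_closure_iff.2 fun ε hε => ?_
  obtain ⟨a, ha⟩ := exists_norm_sub_mul_lt hσ T.1 T.2 (half_pos hε)
  refine ⟨_, Submodule.subset_span ⟨a, T, rfl⟩, ?_⟩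
  rw [dist_comm, dist_eq_norm]
  exact lt_of_le_of_lt ha (half_lt_self hε)

end CompactOperatorsRep

/-! ### Absorption by the regular representation. -/

section RegularRep

variable {G : Type v} [Group G] [TopologicalSpace G] [IsTopologicalGroup G]
  [LocallyCompactSpace G] [T2Space G] [MeasurableSpace G] [BorelSpace G]

variable (G) in
/-- The integrated form of the regular representation. -/
def lamHom : GroupAlg G →⋆ₙₐ[ℂ] (L2 G →L[ℂ] L2 G) := repHom (regularRep G)

variable (G) in
lemma nondegRep_lamHom : NondegRep (lamHom G) := nondegRep_repHom (regularRep G)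

variable (G) in
lemma nondegenerate_regHom : Nondegenerate (regHom G) :=
  nondegenerate_boundedToMultiplier_comp (nondegRep_lamHom G)

variable (G) in
lemma ext_idK_comp_regHom : (ext _ (nondegRep_idK (L2 G))).comp (regHom G) = lamHom G :=
  NonUnitalStarAlgHom.ext fun z => ext_idK (lamHom G z)

/-- Nondegenerate representations of the group algebra are determined by their values on group
elements, by `eq_repHom`. -/
lemma conj_lamHom_of_translate (π : UnitaryRep G) (U : HT (L2 G) π.H ≃ₗᵢ[ℂ] HT (L2 G) π.H)
    (hU : ∀ s, conjHom U (htop (lamOp s) 1) = htop (lamOp s) (π.U s : π.H →L[ℂ] π.H))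
    (z : GroupAlg G) :
    conjHom U (htop (lamHom G z) 1) = diagRep (regularRep G) π z := by
  have hn := nondegRep_conj (nondegRep_ampHom (K := π.H) (nondegRep_lamHom G)) U
  refine congrArg (fun Ψ : GroupAlg G →⋆ₙₐ[ℂ] (HT (L2 G) π.H →L[ℂ] HT (L2 G) π.H) => Ψ z)
    (eq_repHom (π := (regularRep G).tensor π) hn fun s => ?_)
  refine (ext_conj (nondegRep_ampHom (K := π.H) (nondegRep_lamHom G)) U (kG s)).trans ?_
  rw [ext_ampHom (nondegRep_lamHom G)]
  have h : ext _ (nondegRep_lamHom G) (kG s) = lamOp s := ext_repHom_kG (regularRep G) s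
  rw [h, hU]
  rfl

/-- The absorption principle: `λ ⊗ 1` is equivalent to `λ ⊗ π`. -/
lemma UnitaryRep.conj_W (π : UnitaryRep G) (z : GroupAlg G) :
    conjHom π.W (htop (lamHom G z) 1) = diagRep (regularRep G) π z :=
  conj_lamHom_of_translate π π.W π.W_translate z

lemma conjHom_flipHT {H K : Type*} [NormedAddCommGroup H] [InnerProductSpace ℂ H] [CompleteSpace H]
    [NormedAddCommGroup K] [InnerProductSpace ℂ K] [CompleteSpace K]
    (S : H →L[ℂ] H) (T : K →L[ℂ] K) : conjHom (flipHT H K) (htop S T) = htop T S := by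
  refine ContinuousLinearMap.ext fun z => ?_
  obtain ⟨z, rfl⟩ := (flipHT H K).surjective z
  rw [conjHom_apply_map]
  refine congrArg (fun Q : HT H K →L[ℂ] HT K H => Q z) (?_ :
    (flipHT H K : HT H K →L[ℂ] HT K H) ∘L htop S T =
      htop T S ∘L (flipHT H K : HT H K →L[ℂ] HT K H))
  refine htm_ext fun x y => ?_
  change flipHT H K (htop S T (htm x y)) = htop T S (flipHT H K (htm x y))
  rw [htop_htm, flipHT_htm, flipHT_htm, htop_htm]

variable (G) in
/-- The unitary operator `(S ξ)(s, t) = ξ(t, t⁻¹ s)` on `L²(G) ⊗ L²(G)`. -/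
def swapW : HT (L2 G) (L2 G) ≃ₗᵢ[ℂ] HT (L2 G) (L2 G) :=
  (regularRep G).W.trans (flipHT (L2 G) (L2 G))

/-- The flip fixes each λ_s ⊗ λ_s, so W may be followed by it. The gain is that M(f) ⊗ 1 is then
carried to 1 ⊗ M(f), as the crossed product requires. -/
lemma conj_swapW_lamHom (z : GroupAlg G) :
    conjHom (swapW G) (htop (lamHom G z) 1) = diagRep (regularRep G) (regularRep G) z :=
  conj_lamHom_of_translate (regularRep G) (swapW G) (fun s => by
    change conjHom (flipHT (L2 G) (L2 G)) (conjHom (regularRep G).W (htop (lamOp s) 1)) = _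
    rw [(regularRep G).W_translate]
    exact conjHom_flipHT (lamOp s) (lamOp s)) z

lemma conj_swapW_multOp (f : C₀(G, ℂ)) :
    conjHom (swapW G) (htop (multOp f) 1) = htop 1 (multOp f) := by
  change conjHom (flipHT (L2 G) (L2 G)) (conjHom (regularRep G).W (htop (multOp f) 1)) = _
  rw [(regularRep G).W_mult]
  exact conjHom_flipHT (multOp f) (1 : L2 G →L[ℂ] L2 G)

end RegularRep

/-! ### Multiplication operators as a representation. -/

section Multiplication

variable {G : Type v} [Group G] [TopologicalSpace G] [IsTopologicalGroup G]
  [LocallyCompactSpace G] [T2Space G] [MeasurableSpace G] [BorelSpace G]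

lemma multOp_eq_of_forall {f : C₀(G, ℂ)} {T : L2 G →L[ℂ] L2 G}
    (h : ∀ ξ, ∀ᵐ t ∂(Measure.haar : Measure G), T ξ t = f t * ξ t) : multOp f = T :=
  ContinuousLinearMap.ext fun ξ => Lp.ext (by
    filter_upwards [coeFn_multOp f ξ, h ξ] with t h1 h2
    rw [h1, h2])

variable (G) in
/-- The representation of `C₀(G)` by multiplication operators. -/
def multHom : C₀(G, ℂ) →⋆ₙₐ[ℂ] (L2 G →L[ℂ] L2 G) where
  toFun := multOp
  map_smul' c f := multOp_eq_of_forall fun ξ => by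
    filter_upwards [Lp.coeFn_smul c (multOp f ξ), coeFn_multOp f ξ] with t h1 h2
    rw [MonoidHom.id_apply, smul_apply, h1, Pi.smul_apply, h2]
    simp [mul_assoc]
  map_zero' := multOp_eq_of_forall fun ξ => by
    filter_upwards [Lp.coeFn_zero ℂ 2 (Measure.haar : Measure G)] with t h1
    rw [zero_apply, h1]; simp
  map_add' f g := multOp_eq_of_forall fun ξ => by
    filter_upwards [Lp.coeFn_add (multOp f ξ) (multOp g ξ), coeFn_multOp f ξ,
      coeFn_multOp g ξ] with t h1 h2 h3
    rw [add_apply, h1, Pi.add_apply, h2, h3]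
    simp [add_mul]
  map_mul' f g := multOp_eq_of_forall fun ξ => by
    filter_upwards [coeFn_multOp f (multOp g ξ), coeFn_multOp g ξ] with t h2 h3
    rw [mul_apply_eq_comp, h2, h3]
    simp [mul_assoc]
  map_star' f := by
    rw [ContinuousLinearMap.star_eq_adjoint, ContinuousLinearMap.eq_adjoint_iff]
    intro ξ η
    rw [L2.inner_def, L2.inner_def]
    refine integral_congr_ae ?_
    filter_upwards [coeFn_multOp (star f) ξ, coeFn_multOp f η] with t h1 h2
    rw [h1, h2]
    simp only [RCLike.inner_apply, map_mul]
    simp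
    ring

end Multiplication

/-! ### Coefficients of the regular representation are dense in the functions vanishing at infinity.
-/

section Coefficients

variable {G : Type v} [Group G] [TopologicalSpace G] [IsTopologicalGroup G]
  [LocallyCompactSpace G] [T2Space G] [MeasurableSpace G] [BorelSpace G]

/-- A limit along uniformly Lipschitz families may be checked on a dense set. -/
lemma tendsto_zero_of_dense {E ι : Type*} [NormedAddCommGroup E] {l : Filter ι} (T : ι → E → ℂ)
    {c : ℝ} (hT : ∀ i x y, ‖T i x - T i y‖ ≤ c * ‖x - y‖) {s : Set E} (hs : Dense s)
    (h : ∀ x ∈ s, Tendsto (fun i => T i x) l (𝓝 0)) (x : E) :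
    Tendsto (fun i => T i x) l (𝓝 0) := by
  rw [Metric.tendsto_nhds]
  intro ε hε
  have hc : 0 < |c| + 1 := by positivity
  obtain ⟨y, hy, hxy⟩ := Metric.mem_closure_iff.1 (hs x) (ε / 2 / (|c| + 1)) (by positivity)
  filter_upwards [Metric.tendsto_nhds.1 (h y hy) (ε / 2) (by positivity)] with i hi
  rw [dist_zero_right] at *
  have h1 := hT i x y
  rw [dist_eq_norm, lt_div_iff₀ hc] at hxy
  have h2 : c * ‖x - y‖ ≤ ‖x - y‖ * (|c| + 1) := by
    nlinarith [norm_nonneg (x - y), le_abs_self c]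
  have h3 : ‖T i x‖ ≤ ‖T i x - T i y‖ + ‖T i y‖ := by
    simpa using norm_add_le (T i x - T i y) (T i y)
  linarith

lemma norm_lamOp_apply (t : G) (h : L2 G) : ‖lamOp t h‖ = ‖h‖ := (regularRep G).norm_apply t h

/-- The coefficient vanishes unless t lies in supp(g) supp(h)⁻¹, for otherwise g and the translate
of h have disjoint supports. -/
lemma tendsto_inner_lamOp_cc (g h : C_c(G, ℂ)) :
    Tendsto (fun t : G => inner ℂ (ccLp G ℂ g) (lamOp t (ccLp G ℂ h))) (cocompact G) (𝓝 0) := by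
  refine tendsto_const_nhds.congr' ?_
  have hK : IsCompact (tsupport g * (tsupport h)⁻¹) :=
    g.hasCompactSupport.isCompact.mul h.hasCompactSupport.isCompact.inv
  filter_upwards [hK.compl_mem_cocompact] with t ht
  rw [L2.inner_def]
  symm
  refine integral_eq_zero_of_ae ?_
  filter_upwards [coeFn_ccLp g, coeFn_transV (H := ℂ) t (ccLp G ℂ h),
    ae_comp_mulLeft t (coeFn_ccLp h)] with s h1 h2 h3
  rw [lamOp_apply, h2, h1, h3]
  by_contra hne
  have h4 : g s ≠ 0 := fun h0 => hne (by simp [h0])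
  have h5 : h (t⁻¹ * s) ≠ 0 := fun h0 => hne (by simp [h0])
  exact ht ⟨s, subset_tsupport _ h4, s⁻¹ * t,
    Set.mem_inv.2 (by simpa using subset_tsupport _ h5), by simp⟩

/-- The coefficients of the regular representation vanish at infinity. -/
def coeff (g h : L2 G) : C₀(G, ℂ) where
  toFun t := inner ℂ g (lamOp t h)
  continuous_toFun := continuous_const.inner ((regularRep G).cont h)
  zero_at_infty' := by
    refine tendsto_zero_of_dense (fun (t : G) h => inner ℂ g (lamOp t h)) (c := ‖g‖)
      (fun t x y => ?_) (denseRange_ccLp G ℂ) ?_ h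
    · rw [← inner_sub_right, ← map_sub]
      exact (norm_inner_le_norm _ _).trans_eq (by rw [norm_lamOp_apply])
    rintro _ ⟨h, rfl⟩
    refine tendsto_zero_of_dense (fun (t : G) g => inner ℂ g (lamOp t (ccLp G ℂ h)))
      (c := ‖ccLp G ℂ h‖) (fun t x y => ?_) (denseRange_ccLp G ℂ) ?_ g
    · rw [← inner_sub_left]
      exact (norm_inner_le_norm _ _).trans_eq (by rw [norm_lamOp_apply, mul_comm])
    rintro _ ⟨g, rfl⟩
    exact tendsto_inner_lamOp_cc g h

lemma coeff_apply (g h : L2 G) (t : G) : coeff g h t = inner ℂ g (lamOp t h) := rfl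

/-- A compactly supported continuous function, as a function vanishing at infinity. -/
def ccZero (f : C_c(G, ℂ)) : C₀(G, ℂ) := ⟨f.toContinuousMap, by
  refine tendsto_const_nhds.congr' ?_
  filter_upwards [f.hasCompactSupport.isCompact.compl_mem_cocompact] with t ht
  exact (image_eq_zero_of_notMem_tsupport ht).symm⟩

lemma norm_zeroAtInfty_le {f : C₀(G, ℂ)} {c : ℝ} (hc : 0 ≤ c) (h : ∀ t, ‖f t‖ ≤ c) : ‖f‖ ≤ c :=
  (BoundedContinuousFunction.norm_le hc).2 h

variable (G) in
lemma denseRange_ccZero : DenseRange (ccZero (G := G)) := by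
  intro f
  refine Metric.mem_closure_iff.2 fun ε hε => ?_
  have hf := Metric.tendsto_nhds.1 f.zero_at_infty' (ε / 2) (half_pos hε)
  obtain ⟨K, hK, hKs⟩ := mem_cocompact.1 hf
  obtain ⟨k, hk1, hkc, -, hk01⟩ := exists_continuousMap_one_of_isCompact_subset_isOpen hK
    isOpen_univ (Set.subset_univ _)
  let χ : C_c(G, ℂ) := ⟨⟨fun t => (k t : ℂ) * f t, by fun_prop⟩, by
    refine HasCompactSupport.mono (f := k) hkc fun t ht => ?_
    contrapose! ht
    simp [Function.notMem_support.1 ht]⟩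
  refine ⟨_, ⟨χ, rfl⟩, ?_⟩
  rw [dist_eq_norm]
  refine lt_of_le_of_lt (norm_zeroAtInfty_le (half_pos hε).le fun t => ?_) (half_lt_self hε)
  change ‖f t - (k t : ℂ) * f t‖ ≤ ε / 2
  by_cases ht : t ∈ K
  · have h1 : k t = 1 := hk1 ht
    rw [h1]; simpa using (half_pos hε).le
  · have h1 : ‖f t‖ < ε / 2 := by simpa using hKs ht
    have h2 : f t - (k t : ℂ) * f t = ((1 - k t : ℝ) : ℂ) * f t := by push_cast; ring
    rw [h2, norm_mul, Complex.norm_real]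
    have h3 := hk01 t
    have h4 : ‖(1 - k t : ℝ)‖ ≤ 1 := by
      rw [Real.norm_eq_abs, abs_le]; constructor <;> linarith [h3.1, h3.2]
    nlinarith [norm_nonneg (f t)]

/-- Left translation of a compactly supported function is continuous in the uniform norm. -/
lemma continuous_ccZero_leftTranslate (f : C_c(G, ℂ)) :
    Continuous fun s : G => ccZero (leftTranslate s f) := by
  rw [continuous_iff_continuousAt]
  intro s
  obtain ⟨V, hVc, hV⟩ := exists_compact_mem_nhds s
  let Φ : C(G × G, ℂ) := ⟨fun p => f (p.1⁻¹ * p.2), by fun_prop⟩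
  have hΦ := (ContinuousMap.tendsto_iff_forall_isCompact_tendstoUniformlyOn.1
    (Φ.curry.continuous.tendsto s)) (V * tsupport f) (hVc.mul f.hasCompactSupport.isCompact)
  rw [Metric.tendstoUniformlyOn_iff] at hΦ
  refine Metric.tendsto_nhds.2 fun ε hε => ?_
  filter_upwards [hΦ (ε / 2) (half_pos hε), hV] with r hr hrV
  rw [dist_comm, dist_eq_norm]
  refine lt_of_le_of_lt (norm_zeroAtInfty_le (half_pos hε).le fun t => ?_) (half_lt_self hε)
  change ‖f (s⁻¹ * t) - f (r⁻¹ * t)‖ ≤ ε / 2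
  by_cases ht : t ∈ V * tsupport f
  · rw [← dist_eq_norm]; exact (hr t ht).le
  · have h0 : ∀ q ∈ V, f (q⁻¹ * t) = 0 := fun q hq => by
      refine image_eq_zero_of_notMem_tsupport fun hq' => ht ⟨q, hq, _, hq', by simp⟩
    rw [h0 s (mem_of_mem_nhds hV), h0 r hrV, sub_zero, norm_zero]
    positivity

variable (G) in
/-- Evaluation at a point. -/
def evalZero (t : G) : C₀(G, ℂ) →L[ℂ] ℂ :=
  LinearMap.mkContinuous
    { toFun := fun f => f t
      map_add' := fun _ _ => rfl
      map_smul' := fun _ _ => rfl } 1 fun f => by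
    rw [one_mul]; exact f.toBCF.norm_coe_le_norm t

variable (G) in
-- With g the conjugate of f and h(t) = φ(t⁻¹), the coefficient is the convolution of f with φ, and
-- f runs through an approximate identity.
lemma dense_coeff : Dense {f : C₀(G, ℂ) | ∃ g h, f = coeff g h} := by
  refine dense_closure.1 ((denseRange_ccZero G).mono ?_)
  rintro _ ⟨φ, rfl⟩
  refine Metric.mem_closure_iff.2 fun ε hε => ?_
  obtain ⟨f, hf⟩ := exists_integral_smul_near (continuous_ccZero_leftTranslate φ) (half_pos hε)
  let g : C_c(G, ℂ) := ⟨⟨fun t => star (f t), by fun_prop⟩, by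
    refine HasCompactSupport.mono (f := f) f.hasCompactSupport fun t ht => ?_
    contrapose! ht
    simp [Function.notMem_support.1 ht]⟩
  let h : C_c(G, ℂ) := ⟨⟨fun t => φ t⁻¹, by fun_prop⟩,
    φ.hasCompactSupport.comp_homeomorph (Homeomorph.inv G)⟩
  refine ⟨_, ⟨ccLp G ℂ g, ccLp G ℂ h, rfl⟩, ?_⟩
  have h1 : ∫ s, f s • ccZero (leftTranslate s φ) ∂Measure.haar =
      coeff (ccLp G ℂ g) (ccLp G ℂ h) := by
    ext t
    have h2 := (evalZero G t).integral_comp_comm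
      (integrable_smul_of_continuous f (continuous_ccZero_leftTranslate φ))
    refine h2.symm.trans ?_
    rw [coeff_apply, L2.inner_def]
    refine integral_congr_ae ?_
    filter_upwards [coeFn_ccLp g, coeFn_transV (H := ℂ) t (ccLp G ℂ h),
      ae_comp_mulLeft t (coeFn_ccLp h)] with s h1 h2 h3
    rw [lamOp_apply, h2, h1, h3]
    change f s * φ (s⁻¹ * t) = inner ℂ (star (f s)) (φ (t⁻¹ * s)⁻¹)
    rw [mul_inv_rev, inv_inv, RCLike.inner_apply]
    simp [mul_comm]
  have h2 : leftTranslate 1 φ = φ := by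
    ext t; simp [leftTranslate_apply]
  rw [h1, h2] at hf
  rw [dist_comm, dist_eq_norm]
  exact lt_of_le_of_lt hf (half_lt_self hε)

end Coefficients

/-! ### Operators of multipliers of a tensor product. -/

section TensorExtension

variable {A C : Type*} [NonUnitalCStarAlgebra A] [NonUnitalCStarAlgebra C]
variable {H : Type*} [NormedAddCommGroup H] [InnerProductSpace ℂ H] [CompleteSpace H]
variable {K : Type*} [NormedAddCommGroup K] [InnerProductSpace ℂ K] [CompleteSpace K]
variable {L : Type*} [NormedAddCommGroup L] [InnerProductSpace ℂ L] [CompleteSpace L]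

/-- The extension of `σ ⊗ τ` to the multiplier algebra of `A ⊗ C`. -/
abbrev tensorExt {σ : A →⋆ₙₐ[ℂ] (H →L[ℂ] H)} {τ : C →⋆ₙₐ[ℂ] (K →L[ℂ] K)} (hσ : NondegRep σ)
    (hτ : NondegRep τ) : 𝓜(ℂ, SpatialTensor A C) →⋆ₙₐ[ℂ] (HT H K →L[ℂ] HT H K) :=
  ext _ (nondegRep_tensorRep hσ hτ)

lemma tensorExt_congr {σ σ' : A →⋆ₙₐ[ℂ] (H →L[ℂ] H)} {τ τ' : C →⋆ₙₐ[ℂ] (K →L[ℂ] K)}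
    {hσ : NondegRep σ} {hσ' : NondegRep σ'} {hτ : NondegRep τ} {hτ' : NondegRep τ'}
    (h : σ = σ') (h' : τ = τ') (m : 𝓜(ℂ, SpatialTensor A C)) :
    tensorExt hσ hτ m = tensorExt hσ' hτ' m := by subst h h'; rfl

lemma ext_comp_incl {σ : A →⋆ₙₐ[ℂ] (H →L[ℂ] H)} (hσ : NondegRep σ) :
    (ext σ hσ).comp (incl A) = σ := NonUnitalStarAlgHom.ext fun a => ext_incl hσ a

variable (H) in
/-- The unitary operator `1 ⊗ U`. -/
def htIso (U : K ≃ₗᵢ[ℂ] K) : HT H K ≃ₗᵢ[ℂ] HT H K :=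
  Unitary.linearIsometryEquiv ⟨htop 1 (Unitary.linearIsometryEquiv.symm U : K →L[ℂ] K), by
    rw [Unitary.mem_iff, star_htop, htop_mul, htop_mul, star_one, one_mul,
      Unitary.coe_star_mul_self, Unitary.mul_star_self_of_mem (Subtype.prop _), htop_one]
    exact ⟨rfl, rfl⟩⟩

lemma htIso_htm (U : K ≃ₗᵢ[ℂ] K) (x : H) (y : K) : htIso H U (htm x y) = htm x (U y) :=
  htop_htm 1 (Unitary.linearIsometryEquiv.symm U : K →L[ℂ] K) x y

lemma conjHom_htIso (U : K ≃ₗᵢ[ℂ] K) (S : H →L[ℂ] H) (T : K →L[ℂ] K) :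
    conjHom (htIso H U) (htop S T) = htop S (conjHom U T) := by
  refine ContinuousLinearMap.ext fun z => ?_
  obtain ⟨z, rfl⟩ := (htIso H U).surjective z
  rw [conjHom_apply_map]
  refine congrArg (fun Q : HT H K →L[ℂ] HT H K => Q z) (?_ :
    (htIso H U : HT H K →L[ℂ] HT H K) ∘L htop S T =
      htop S (conjHom U T) ∘L (htIso H U : HT H K →L[ℂ] HT H K))
  refine htm_ext fun x y => ?_
  change htIso H U (htop S T (htm x y)) = htop S (conjHom U T) (htIso H U (htm x y))
  rw [htop_htm, htIso_htm, htIso_htm, htop_htm, conjHom_apply_map]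

lemma tensorExt_conj {σ : A →⋆ₙₐ[ℂ] (H →L[ℂ] H)} {τ : C →⋆ₙₐ[ℂ] (K →L[ℂ] K)} (hσ : NondegRep σ)
    (hτ : NondegRep τ) (U : K ≃ₗᵢ[ℂ] K) (m : 𝓜(ℂ, SpatialTensor A C)) :
    tensorExt hσ (nondegRep_conj hτ U) m = conjHom (htIso H U) (tensorExt hσ hτ m) := by
  rw [← ext_conj]
  refine ext_congr (spatial_hom_ext fun a c => ?_) m
  rw [tensorRep_tmul]
  change _ = conjHom (htIso H U) (tensorRep σ τ hσ hτ (tmul a c))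
  rw [tensorRep_tmul, conjHom_htIso]; rfl

lemma tensorExt_ampHom {σ : A →⋆ₙₐ[ℂ] (H →L[ℂ] H)} {τ : C →⋆ₙₐ[ℂ] (K →L[ℂ] K)} (hσ : NondegRep σ)
    (hτ : NondegRep τ) (m : 𝓜(ℂ, SpatialTensor A C)) :
    tensorExt hσ (nondegRep_ampHom (K := L) hτ) m =
      conjHom (assocHT H K L) (htop (tensorExt hσ hτ m) 1) := by
  rw [← ext_ampHom, ← ext_conj]
  refine ext_congr (spatial_hom_ext fun a c => ?_) m
  rw [tensorRep_tmul]
  change _ = conjHom (assocHT H K L) (htop (tensorRep σ τ hσ hτ (tmul a c)) 1)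
  rw [tensorRep_tmul, conjHom_assocHT]; rfl

/-- An operator `T` on `H ⊗ K` with `T ⊗ 1 = 0` on `(H ⊗ K) ⊗ K` vanishes; here `K` may be zero. -/
lemma eq_zero_of_htop_one {T : HT H K →L[ℂ] HT H K}
    (h : htop T (1 : K →L[ℂ] K) = 0) : T = 0 := by
  rcases subsingleton_or_nontrivial K with hs | hs
  · refine htm_ext fun x y => ?_
    have : htm x y = 0 := by
      rw [← norm_eq_zero, norm_htm, Subsingleton.elim y 0, norm_zero, mul_zero]
    rw [this, map_zero, map_zero]
  · exact htop_one_injective (K := K) (h.trans (map_zero (ampHom _ K)).symm)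

end TensorExtension

/-! ### The central identity for J = (σ ⊗ λ) ∘ δ, and its consequences. -/

section RegularCoaction

variable {G : Type v} [Group G] [TopologicalSpace G] [IsTopologicalGroup G]
  [LocallyCompactSpace G] [T2Space G] [MeasurableSpace G] [BorelSpace G]
variable {B : Type u} [NonUnitalCStarAlgebra B]
variable {H : Type*} [NormedAddCommGroup H] [InnerProductSpace ℂ H] [CompleteSpace H]

namespace FullCoaction

/-- The representation `(σ ⊗ λ) ∘ δ` of `B` on `H ⊗ L²(G)`. -/
def regRep (δ : FullCoaction G B) {σ : B →⋆ₙₐ[ℂ] (H →L[ℂ] H)} (hσ : NondegRep σ) :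
    B →⋆ₙₐ[ℂ] (HT H (L2 G) →L[ℂ] HT H (L2 G)) :=
  (tensorExt hσ (nondegRep_lamHom G)).comp δ.δ

variable (δ : FullCoaction G B) {σ : B →⋆ₙₐ[ℂ] (H →L[ℂ] H)} (hσ : NondegRep σ)

lemma nondegRep_regRep : NondegRep (δ.regRep hσ) := nondegRep_comp _ δ.nondegenerate

lemma tensorExt_jB (b : B) : tensorExt hσ (nondegRep_idK (L2 G)) (δ.jB b) = δ.regRep hσ b := by
  refine (ext_bar_tensorHom (nondegenerate_incl B) (nondegenerate_regHom G) hσ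
    (nondegRep_idK (L2 G)) (δ.δ b)).trans ?_
  exact tensorExt_congr (ext_comp_incl hσ) (ext_idK_comp_regHom G) _

lemma tensorExt_jG (f : C₀(G, ℂ)) :
    tensorExt hσ (nondegRep_idK (L2 G)) (δ.jG f) = htop 1 (multOp f) := by
  refine (ext_tensorRep_mtmul hσ (nondegRep_idK (L2 G)) _ _).trans ?_
  rw [ext_one, ext_idK]

/-- If `U` implements the equivalence of `λ ⊗ 1` with `λ ⊗ π`, then it implements an equivalence of
`J ⊗ 1` with `(J ⊗ π) ∘ δ`, where `J = (σ ⊗ λ) ∘ δ`. -/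
lemma conj_regRep (π : UnitaryRep G) (U : HT (L2 G) π.H ≃ₗᵢ[ℂ] HT (L2 G) π.H)
    (hU : ∀ z, conjHom U (htop (lamHom G z) 1) = diagRep (regularRep G) π z) (b : B) :
    conjHom (assocHT H (L2 G) π.H)
        (tensorExt (δ.nondegRep_regRep hσ) (nondegRep_repHom π) (δ.δ b)) =
      conjHom (htIso H U) (conjHom (assocHT H (L2 G) π.H) (htop (δ.regRep hσ b) 1)) := by
  -- Coassociativity seen in the representation σ ⊗ (λ ⊗ π).
  have h := congrArg (tensorExt hσ
    (nondegRep_tensorRep (nondegRep_lamHom G) (nondegRep_repHom π))) (δ.coassoc b)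
  rw [tensorExt, ext_bar_assocHom] at h
  -- On the left, σ ⊗ λ absorbs the inner δ and becomes J.
  have h1 : tensorExt (nondegRep_tensorRep hσ (nondegRep_lamHom G)) (nondegRep_repHom π)
        (bar (tensorHom δ.δ (incl (GroupAlg G))) (δ.δ b)) =
      tensorExt (δ.nondegRep_regRep hσ) (nondegRep_repHom π) (δ.δ b) := by
    refine (ext_bar_tensorHom δ.nondegenerate (nondegenerate_incl _) _ _ _).trans ?_
    exact tensorExt_congr rfl (ext_comp_incl _) _
  -- On the right, λ ⊗ π absorbs the comultiplication and becomes the conjugate of λ ⊗ 1 by U.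
  have h2 : tensorExt hσ (nondegRep_tensorRep (nondegRep_lamHom G) (nondegRep_repHom π))
        (bar (tensorHom (incl B) (comul G)) (δ.δ b)) =
      tensorExt hσ (nondegRep_conj (nondegRep_ampHom (K := π.H) (nondegRep_lamHom G)) U) (δ.δ b) := by
    refine (ext_bar_tensorHom (nondegenerate_incl _) (nondegenerate_comul G) _ _ _).trans ?_
    refine tensorExt_congr (ext_comp_incl _) ?_ _
    refine (ext_repTensor_comp_comul (regularRep G) π).trans ?_
    exact NonUnitalStarAlgHom.ext fun z => (hU z).symm
  have h3 := h.trans h2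
  rw [tensorExt_conj hσ (nondegRep_ampHom (nondegRep_lamHom G)),
    tensorExt_ampHom hσ (nondegRep_lamHom G)] at h3
  rw [← h1]
  exact h3

/-- The inclusion of the crossed product in `M(B ⊗ K(L²(G)))`. -/
def cpIncl : δ.CrossedProduct →⋆ₙₐ[ℂ] 𝓜(ℂ, SpatialTensor B (CompactOps (L2 G))) :=
  NonUnitalStarSubalgebraClass.subtype δ.crossedProduct

lemma cpIncl_injective : Function.Injective δ.cpIncl := Subtype.val_injective

lemma jB_mul_jG_mem (b : B) (f : C₀(G, ℂ)) : δ.jB b * δ.jG f ∈ δ.crossedProduct :=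
  NonUnitalStarSubalgebra.le_topologicalClosure _
    (NonUnitalStarAlgebra.subset_adjoin ℂ _ ⟨b, f, rfl⟩)

/-- The generator `j_B(b) j_G(f)` of the crossed product. -/
def gen (b : B) (f : C₀(G, ℂ)) : δ.CrossedProduct := ⟨_, δ.jB_mul_jG_mem b f⟩

lemma cpIncl_gen (b : B) (f : C₀(G, ℂ)) : δ.cpIncl (δ.gen b f) = δ.jB b * δ.jG f := rfl

lemma dense_adjoin_gen : Dense (NonUnitalStarAlgebra.adjoin ℂ
    {x : δ.CrossedProduct | ∃ b f, x = δ.gen b f} : Set δ.CrossedProduct) := by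
  have h := generators_subtype {x | ∃ (b : B) (f : C₀(G, ℂ)), x = δ.jB b * δ.jG f}
  have h2 : {y : (NonUnitalStarAlgebra.adjoin ℂ
      {x | ∃ (b : B) (f : C₀(G, ℂ)), x = δ.jB b * δ.jG f}).topologicalClosure |
      (y : 𝓜(ℂ, SpatialTensor B (CompactOps (L2 G)))) ∈
        {x | ∃ (b : B) (f : C₀(G, ℂ)), x = δ.jB b * δ.jG f}} =
      {x : δ.CrossedProduct | ∃ b f, x = δ.gen b f} := by
    ext y
    exact exists_congr fun b => exists_congr fun f =>
      ⟨fun hf => Subtype.ext hf, fun hf => congrArg Subtype.val hf⟩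
  rw [h2] at h
  exact h

/-- For j_B(b) this is the central identity with π = λ. For j_G(f) it holds because the flip moves
the multiplication operator to the last factor, where J ⊗ id leaves it. Together they settle the
generators. -/
lemma conj_crossedProduct (x : δ.CrossedProduct) :
    conjHom (assocHT H (L2 G) (L2 G))
        (tensorExt (δ.nondegRep_regRep hσ) (nondegRep_idK (L2 G)) (δ.cpIncl x)) =
      conjHom (htIso H (swapW G)) (conjHom (assocHT H (L2 G) (L2 G))
        (htop (tensorExt hσ (nondegRep_idK (L2 G)) (δ.cpIncl x)) 1)) := by
  let Φ := (conjHom (assocHT H (L2 G) (L2 G))).comp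
    (tensorExt (δ.nondegRep_regRep hσ) (nondegRep_idK (L2 G)))
  let Ψ := (conjHom (htIso H (swapW G))).comp ((conjHom (assocHT H (L2 G) (L2 G))).comp
    ((ampHom (HT H (L2 G)) (L2 G)).comp (tensorExt hσ (nondegRep_idK (L2 G)))))
  have hB : ∀ b, Φ (δ.jB b) = Ψ (δ.jB b) := fun b => by
    change conjHom _ (tensorExt (δ.nondegRep_regRep hσ) (nondegRep_idK (L2 G)) (δ.jB b)) =
      conjHom _ (conjHom _ (htop (tensorExt hσ (nondegRep_idK (L2 G)) (δ.jB b)) 1))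
    rw [tensorExt_jB, tensorExt_jB]
    exact δ.conj_regRep hσ (regularRep G) (swapW G) conj_swapW_lamHom b
  have hG : ∀ f, Φ (δ.jG f) = Ψ (δ.jG f) := fun f => by
    change conjHom _ (tensorExt (δ.nondegRep_regRep hσ) (nondegRep_idK (L2 G)) (δ.jG f)) =
      conjHom _ (conjHom _ (htop (tensorExt hσ (nondegRep_idK (L2 G)) (δ.jG f)) 1))
    rw [tensorExt_jG, tensorExt_jG, conjHom_assocHT, conjHom_htIso, conj_swapW_multOp,
      ← htop_one, conjHom_assocHT]
  have h := hom_ext_of_generators δ.dense_adjoin_gen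
    (φ := Φ.comp δ.cpIncl) (ψ := Ψ.comp δ.cpIncl) (by
      rintro _ ⟨b, f, rfl⟩
      change Φ (δ.jB b * δ.jG f) = Ψ (δ.jB b * δ.jG f)
      rw [map_mul, map_mul, hB, hG])
  exact DFunLike.congr_fun h x

/-- The two operators are J(b) ⊗ 1 and (J ⊗ λ)(δ(b)), which are unitarily equivalent. This will give
injectivity and normality of the quotient coaction. -/
lemma regRep_eq_zero_iff (b : B) : δ.regRep hσ b = 0 ↔
    tensorExt (δ.nondegRep_regRep hσ) (nondegRep_lamHom G) (δ.δ b) = 0 := by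
  have h := δ.conj_regRep hσ (regularRep G) (swapW G) conj_swapW_lamHom b
  constructor
  · intro hb
    rw [hb] at h
    refine conjHom_injective (assocHT H (L2 G) (L2 G)) (Eq.trans h ?_)
    rw [map_zero]
    exact map_zero ((conjHom (htIso H (swapW G))).comp ((conjHom (assocHT H (L2 G) (L2 G))).comp
      (ampHom (HT H (L2 G)) (L2 G))))
  · intro hb
    have h2 : htop (δ.regRep hσ b) (1 : L2 G →L[ℂ] L2 G) = 0 := by
      refine conjHom_injective (assocHT H (L2 G) (L2 G)) (conjHom_injective (htIso H (swapW G)) ?_)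
      refine Eq.trans h.symm ?_
      rw [map_zero, map_zero]
      refine (congrArg _ hb).trans (map_zero (conjHom (assocHT H (L2 G) (L2 G))))
    exact eq_zero_of_htop_one h2

end FullCoaction

end RegularCoaction

/-! ### Moving functions past B in the crossed product. -/

section Commutation

variable {G : Type v} [Group G] [TopologicalSpace G] [IsTopologicalGroup G]
  [LocallyCompactSpace G] [T2Space G] [MeasurableSpace G] [BorelSpace G]
variable {B : Type u} [NonUnitalCStarAlgebra B]
variable {H : Type*} [NormedAddCommGroup H] [InnerProductSpace ℂ H] [CompleteSpace H]
variable {K : Type*} [NormedAddCommGroup K] [InnerProductSpace ℂ K] [CompleteSpace K]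

/-- The operator `x ⊗ y ↦ ⟨g, y⟩ x`. -/
def sliceOp (H : Type*) [NormedAddCommGroup H] [InnerProductSpace ℂ H] [CompleteSpace H]
    (g : K) : HT H K →L[ℂ] H := ContinuousLinearMap.adjoint ((htmL H K).flip g)

lemma continuous_sliceOp : Continuous (sliceOp (K := K) H) :=
  (ContinuousLinearMap.adjoint (𝕜 := ℂ) (E := H) (F := HT H K)).continuous.comp
    (htmL H K).flip.continuous

lemma sliceOp_htm (g : K) (x : H) (y : K) : sliceOp H g (htm x y) = (inner ℂ g y : ℂ) • x :=
  adjoint_htmL_flip g x y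

lemma inner_sliceOp (g : K) (x : H) (z : HT H K) :
    inner ℂ x (sliceOp H g z) = inner ℂ (htm x g) z := by
  rw [sliceOp, ContinuousLinearMap.adjoint_inner_right]; rfl

lemma sliceOp_comp_htop (g : K) (S : H →L[ℂ] H) (T : K →L[ℂ] K) :
    sliceOp H g ∘L htop S T = S ∘L sliceOp H (star T g) := by
  refine htm_ext fun x y => ?_
  change sliceOp H g (htop S T (htm x y)) = S (sliceOp H (star T g) (htm x y))
  rw [htop_htm, sliceOp_htm, sliceOp_htm, map_smul, ContinuousLinearMap.star_eq_adjoint,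
    ContinuousLinearMap.adjoint_inner_left]

variable (H G) in
/-- The operator `W` acting on the second and third tensor factors. -/
def legW : HT (HT H (L2 G)) (L2 G) →L[ℂ] HT (HT H (L2 G)) (L2 G) :=
  ((assocHT H (L2 G) (L2 G)).trans ((htIso H (regularRep G).W).trans
    (assocHT H (L2 G) (L2 G)).symm) : HT (HT H (L2 G)) (L2 G) ≃ₗᵢ[ℂ] HT (HT H (L2 G)) (L2 G))

lemma assocHT_legW (z : HT (HT H (L2 G)) (L2 G)) :
    assocHT H (L2 G) (L2 G) (legW G H z) =
      htIso H (regularRep G).W (assocHT H (L2 G) (L2 G) z) :=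
  (assocHT H (L2 G) (L2 G)).apply_symm_apply _

/-- The third factor of W carries the regular representation; pairing it off leaves multiplication
by a coefficient. -/
lemma sliceOp_legW (g h : L2 G) :
    sliceOp (HT H (L2 G)) g ∘L legW G H ∘L (htmL (HT H (L2 G)) (L2 G)).flip h =
      htop 1 (multOp (coeff g h)) := by
  refine htm_ext fun x y => eq_of_inner_htm fun x' y' => ?_
  change inner ℂ (htm x' y') (sliceOp (HT H (L2 G)) g (legW G H (htm (htm x y) h))) = _
  rw [inner_sliceOp, ← (assocHT H (L2 G) (L2 G)).inner_map_map, assocHT_legW, assocHT_htm,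
    assocHT_htm, htop_htm, inner_htm]
  refine (congrArg (fun w => inner ℂ (htm x' (htm y' g)) w)
    (htIso_htm (regularRep G).W x (htm y h))).trans ?_
  refine (inner_htm (H := H) (K := HT (L2 G) (L2 G)) x' x (htm y' g)
    ((regularRep G).W (htm y h))).trans ?_
  have h1 := (regularRep G).slice_W g h (coeff g h) fun t => rfl
  have h2 : inner ℂ y' (multOp (coeff g h) y) =
      inner ℂ (htm y' g) ((regularRep G).W (htm y h)) := by
    rw [← h1]
    exact inner_sliceOp (H := L2 G) g y' _
  rw [h2]; rfl

namespace FullCoaction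

variable (δ : FullCoaction G B)

lemma mul_mem_left (b : B) (z : GroupAlg G) :
    ∃ x : SpatialTensor B (GroupAlg G), mtmul 1 (incl _ z) * δ.δ b = incl _ x := by
  obtain ⟨x, hx⟩ := δ.mul_mem (star b) (star z)
  refine ⟨star x, ?_⟩
  have h := congrArg star hx
  rw [star_mul, star_mtmul, star_one, map_star, map_star, star_star, star_star] at h
  rw [h, map_star]

variable {σ : B →⋆ₙₐ[ℂ] (H →L[ℂ] H)} (hσ : NondegRep σ)

/-- The central identity with π = λ and U = W, written as an intertwining relation. -/
lemma tensorExt_legW (b : B) :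
    tensorExt (δ.nondegRep_regRep hσ) (nondegRep_lamHom G) (δ.δ b) ∘L legW G H =
      legW G H ∘L htop (δ.regRep hσ b) 1 := by
  refine ContinuousLinearMap.ext fun z => (assocHT H (L2 G) (L2 G)).injective ?_
  have h := δ.conj_regRep hσ (regularRep G) (regularRep G).W (regularRep G).conj_W b
  have h1 := DFunLike.congr_fun h (assocHT H (L2 G) (L2 G) (legW G H z))
  refine Eq.trans ?_ (h1.trans ?_)
  · exact (conjHom_apply_map (assocHT H (L2 G) (L2 G)) _ (legW G H z)).symm
  · rw [assocHT_legW]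
    refine (conjHom_apply_map (htIso H (regularRep G).W) _ _).trans ?_
    refine (congrArg _ (conjHom_apply_map (assocHT H (L2 G) (L2 G)) _ z)).trans ?_
    exact (assocHT_legW _).symm

/-- Expressing the multiplication operator as a slice of W lets J(b) ⊗ 1 pass through W, where it
becomes (J ⊗ λ)(δ(b)). -/
lemma htop_coeff_mul_regRep (g h : L2 G) (b : B) :
    htop 1 (multOp (coeff g h)) * δ.regRep hσ b =
      sliceOp (HT H (L2 G)) g ∘L tensorExt (δ.nondegRep_regRep hσ) (nondegRep_lamHom G) (δ.δ b) ∘L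
        legW G H ∘L (htmL (HT H (L2 G)) (L2 G)).flip h := by
  rw [← sliceOp_legW]
  have h1 : (htmL (HT H (L2 G)) (L2 G)).flip h ∘L δ.regRep hσ b =
      htop (δ.regRep hσ b) 1 ∘L (htmL (HT H (L2 G)) (L2 G)).flip h :=
    ContinuousLinearMap.ext fun x => (htop_htm (δ.regRep hσ b) 1 x h).symm
  have h2 := δ.tensorExt_legW hσ b
  change (sliceOp (HT H (L2 G)) g ∘L legW G H ∘L (htmL (HT H (L2 G)) (L2 G)).flip h) ∘L
    δ.regRep hσ b = _
  rw [ContinuousLinearMap.comp_assoc, ContinuousLinearMap.comp_assoc, h1,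
    ← ContinuousLinearMap.comp_assoc (legW G H), ← h2]
  rfl

/-- The closed linear span of the operators `J(b) (1 ⊗ M(f))`. -/
def regSpan : Submodule ℂ (HT H (L2 G) →L[ℂ] HT H (L2 G)) :=
  (Submodule.span ℂ {T | ∃ (b : B) (f : C₀(G, ℂ)),
    T = δ.regRep hσ b * htop 1 (multOp f)}).topologicalClosure

/-- For y = b ⊗ z the slice is J(b)(1 ⊗ M(c)), with c the coefficient of λ(z)*g and h. -/
lemma slice_mem_regSpan (g h : L2 G) (y : SpatialTensor B (GroupAlg G)) :
    sliceOp (HT H (L2 G)) g ∘L tensorRep _ _ (δ.nondegRep_regRep hσ) (nondegRep_lamHom G) y ∘L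
        legW G H ∘L (htmL (HT H (L2 G)) (L2 G)).flip h ∈ δ.regSpan hσ := by
  refine clm_mem_of_dense_span (dense_span_range_tmul B (GroupAlg G))
    (ContinuousLinearMap.compL ℂ _ _ _ (sliceOp (HT H (L2 G)) g) ∘L
      (ContinuousLinearMap.compL ℂ _ _ _).flip
        (legW G H ∘L (htmL (HT H (L2 G)) (L2 G)).flip h) ∘L
      homCLM (tensorRep _ _ (δ.nondegRep_regRep hσ) (nondegRep_lamHom G)))
    (Submodule.isClosed_topologicalClosure _) ?_ y
  rintro _ ⟨b, z, rfl⟩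
  change sliceOp (HT H (L2 G)) g ∘L tensorRep _ _ (δ.nondegRep_regRep hσ) (nondegRep_lamHom G)
    (tmul b z) ∘L legW G H ∘L (htmL (HT H (L2 G)) (L2 G)).flip h ∈ δ.regSpan hσ
  rw [tensorRep_tmul, ← ContinuousLinearMap.comp_assoc, sliceOp_comp_htop,
    ContinuousLinearMap.comp_assoc, sliceOp_legW]
  exact Submodule.le_topologicalClosure _ (Submodule.subset_span ⟨b, _, rfl⟩)

lemma coeff_mul_mem_regSpan (g h : L2 G) (b : B) :
    htop 1 (multOp (coeff g h)) * δ.regRep hσ b ∈ δ.regSpan hσ := by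
  -- Taking λ(z)g for g inserts 1 ⊗ z* in front of δ(b), and this product lies in B ⊗ C*(G) rather
  -- than only in its multipliers.
  have key : ∀ z, htop 1 (multOp (coeff (lamHom G z g) h)) * δ.regRep hσ b ∈ δ.regSpan hσ := by
    intro z
    obtain ⟨y, hy⟩ := δ.mul_mem_left b (star z)
    have h1 := slice_mem_regSpan δ hσ g h y
    have h2 : tensorRep _ _ (δ.nondegRep_regRep hσ) (nondegRep_lamHom G) y =
        htop 1 (lamHom G (star z)) *
          tensorExt (δ.nondegRep_regRep hσ) (nondegRep_lamHom G) (δ.δ b) := by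
      rw [← ext_incl (nondegRep_tensorRep (δ.nondegRep_regRep hσ) (nondegRep_lamHom G)), ← hy,
        map_mul, ext_tensorRep_mtmul, ext_one, ext_incl]
    rw [h2] at h1
    have h3 := sliceOp_comp_htop (H := HT H (L2 G)) g 1 (lamHom G (star z))
    rw [← map_star, star_star] at h3
    rw [htop_coeff_mul_regRep]
    refine Set.mem_of_eq_of_mem ?_ h1
    refine congrArg (fun R => R ∘L (tensorExt (δ.nondegRep_regRep hσ) (nondegRep_lamHom G) (δ.δ b) ∘L
        legW G H ∘L (htmL (HT H (L2 G)) (L2 G)).flip h)) h3.symm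
  -- The auxiliary z is removed through an approximate unit with λ(e)g → g.
  obtain ⟨l, hl, hlim, -⟩ := (nondegRep_lamHom G).exists_tendsto
  have hc : Continuous fun g : L2 G => htop 1 (multOp (coeff g h)) * δ.regRep hσ b := by
    simp only [htop_coeff_mul_regRep]
    exact continuous_sliceOp.clm_comp continuous_const
  exact (Submodule.isClosed_topologicalClosure _).mem_of_tendsto
    ((hc.tendsto g).comp (hlim g)) (Eventually.of_forall fun e => key e)

/-- The homomorphism `j_G`. -/
def jGHom : C₀(G, ℂ) →⋆ₙₐ[ℂ] 𝓜(ℂ, SpatialTensor B (CompactOps (L2 G))) where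
  toFun := δ.jG
  map_smul' c f := by
    change mtmul 1 (boundedToMultiplier (L2 G) (multHom G (c • f))) = _
    rw [map_smul, map_smul, mtmul_smul_right]; rfl
  map_zero' := by
    change mtmul 1 (boundedToMultiplier (L2 G) (multHom G 0)) = _
    rw [map_zero, map_zero]
    simpa using mtmul_smul_right (0 : ℂ) (1 : 𝓜(ℂ, B)) (0 : 𝓜(ℂ, CompactOps (L2 G)))
  map_add' f g := by
    change mtmul 1 (boundedToMultiplier (L2 G) (multHom G (f + g))) = _
    rw [map_add, map_add, mtmul_add_right]; rfl
  map_mul' f g := by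
    change mtmul 1 (boundedToMultiplier (L2 G) (multHom G (f * g))) = mtmul 1 _ * mtmul 1 _
    rw [map_mul, map_mul, mtmul_mul, one_mul]; rfl
  map_star' f := by
    change mtmul 1 (boundedToMultiplier (L2 G) (multHom G (star f))) = star (mtmul 1 _)
    rw [map_star, map_star, star_mtmul, star_one]; rfl

lemma jGHom_apply (f : C₀(G, ℂ)) : δ.jGHom f = δ.jG f := rfl

lemma mult_mul_mem_regSpan (f : C₀(G, ℂ)) (b : B) :
    htop 1 (multOp f) * δ.regRep hσ b ∈ δ.regSpan hσ := by
  have hc : Continuous fun f : C₀(G, ℂ) => htop (1 : H →L[ℂ] H) (multOp f) * δ.regRep hσ b := by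
    have : Continuous ((tensorExt hσ (nondegRep_idK (L2 G))).comp δ.jGHom) := continuous_hom _
    refine (this.mul (continuous_const (y := δ.regRep hσ b))).congr fun f => ?_
    exact congrArg (· * δ.regRep hσ b) (δ.tensorExt_jG hσ f)
  have hcl : IsClosed {f : C₀(G, ℂ) | htop (1 : H →L[ℂ] H) (multOp f) * δ.regRep hσ b ∈
      δ.regSpan hσ} := (Submodule.isClosed_topologicalClosure _).preimage hc
  refine hcl.closure_subset_iff.2 ?_ (dense_coeff G f)
  rintro _ ⟨g, h, rfl⟩
  exact δ.coeff_mul_mem_regSpan hσ g h b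

/-- This places the adjoints of the generators j_B(b) j_G(f) in the closed span of the generators.
The operator version is pulled back along an isometric representation. -/
lemma jG_mul_jB_mem_closure (f : C₀(G, ℂ)) (b : B) :
    δ.jG f * δ.jB b ∈ closure (Submodule.span ℂ {x | ∃ b f, x = δ.jB b * δ.jG f} :
      Set 𝓜(ℂ, SpatialTensor B (CompactOps (L2 G)))) := by
  have hσ := nondegRep_univHom B
  let ι := tensorExt hσ (nondegRep_idK (L2 G))
  have hι : Function.Injective ι :=
    ext_injective _ (tensorRep_injective hσ (nondegRep_idK (L2 G)) (univHom_injective B)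
      (idK_injective (L2 G)))
  have h := δ.mult_mul_mem_regSpan hσ f b
  rw [← δ.tensorExt_jG hσ, ← δ.tensorExt_jB hσ, ← map_mul] at h
  have h2 : {T | ∃ (b : B) (f : C₀(G, ℂ)), T = δ.regRep hσ b * htop 1 (multOp f)} =
      (homCLM ι).toLinearMap '' {x | ∃ b f, x = δ.jB b * δ.jG f} := by
    ext T
    constructor
    · rintro ⟨b, f, rfl⟩
      refine ⟨_, ⟨b, f, rfl⟩, ?_⟩
      change ι (δ.jB b * δ.jG f) = _
      rw [map_mul, tensorExt_jB, tensorExt_jG]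
    · rintro ⟨_, ⟨b, f, rfl⟩, rfl⟩
      refine ⟨b, f, ?_⟩
      change ι (δ.jB b * δ.jG f) = _
      rw [map_mul, tensorExt_jB, tensorExt_jG]
  have h3 : ι (δ.jG f * δ.jB b) ∈ closure (ι '' (Submodule.span ℂ {x | ∃ b f, x = δ.jB b * δ.jG f} :
      Set 𝓜(ℂ, SpatialTensor B (CompactOps (L2 G))))) := by
    have h4 : ι (δ.jG f * δ.jB b) ∈ (δ.regSpan hσ : Set _) := h
    rw [regSpan, Submodule.topologicalClosure_coe, h2, ← Submodule.map_span,
      Submodule.map_coe] at h4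
    exact h4
  have hiso : Isometry ι := NonUnitalStarAlgHom.isometry ι hι
  rw [hiso.isEmbedding.isInducing.closure_eq_preimage_closure_image]
  exact h3

end FullCoaction

end Commutation

/-! ### The crossed product and its canonical multipliers. -/

section CrossedProducts

variable {G : Type v} [Group G] [TopologicalSpace G] [IsTopologicalGroup G]
  [LocallyCompactSpace G] [T2Space G] [MeasurableSpace G] [BorelSpace G]
variable {B : Type u} [NonUnitalCStarAlgebra B]

namespace FullCoaction

variable (δ : FullCoaction G B)

lemma isClosed_crossedProduct :
    IsClosed (δ.crossedProduct : Set 𝓜(ℂ, SpatialTensor B (CompactOps (L2 G)))) :=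
  NonUnitalStarSubalgebra.isClosed_topologicalClosure _

lemma jG_mul_jB_mem (f : C₀(G, ℂ)) (b : B) : δ.jG f * δ.jB b ∈ δ.crossedProduct := by
  have h := star_mem (δ.jB_mul_jG_mem (star b) (star f))
  rwa [star_mul, map_star, star_star, ← jGHom_apply, map_star, star_star] at h

/-- Approximating f by products splits the expression into a generator times the adjoint of a
generator. -/
lemma jB_mul_jG_mul_jB_mem (b c : B) (f : C₀(G, ℂ)) :
    δ.jB b * δ.jG f * δ.jB c ∈ δ.crossedProduct := by
  have hc : Continuous fun f : C₀(G, ℂ) => δ.jB b * δ.jGHom f * δ.jB c :=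
    (continuous_const.mul (continuous_hom δ.jGHom)).mul continuous_const
  have hcl : IsClosed {f : C₀(G, ℂ) | δ.jB b * δ.jGHom f * δ.jB c ∈ δ.crossedProduct} :=
    δ.isClosed_crossedProduct.preimage hc
  refine hcl.closure_subset (mem_closure_mul (fun f₁ f₂ => ?_) f)
  change δ.jB b * δ.jGHom (f₁ * f₂) * δ.jB c ∈ δ.crossedProduct
  rw [map_mul, ← mul_assoc, mul_assoc]
  exact MulMemClass.mul_mem (δ.jB_mul_jG_mem b f₁) (δ.jG_mul_jB_mem f₂ c)

lemma jG_mul_jB_mul_jG_mem (b : B) (g f : C₀(G, ℂ)) :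
    δ.jG g * (δ.jB b * δ.jG f) ∈ δ.crossedProduct := by
  have hc : Continuous fun b : B => δ.jG g * (δ.jB b * δ.jG f) :=
    continuous_const.mul ((continuous_hom δ.jB).mul continuous_const)
  have hcl : IsClosed {b : B | δ.jG g * (δ.jB b * δ.jG f) ∈ δ.crossedProduct} :=
    δ.isClosed_crossedProduct.preimage hc
  refine hcl.closure_subset (mem_closure_mul (fun b₁ b₂ => ?_) b)
  change δ.jG g * (δ.jB (b₁ * b₂) * δ.jG f) ∈ δ.crossedProduct
  rw [map_mul, mul_assoc, ← mul_assoc]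
  exact MulMemClass.mul_mem (δ.jG_mul_jB_mem g b₁) (δ.jB_mul_jG_mem b₂ f)

/-- `p` multiplies the crossed product into itself. -/
def Idealizes (p : 𝓜(ℂ, SpatialTensor B (CompactOps (L2 G)))) : Prop :=
  ∀ x ∈ δ.crossedProduct, p * x ∈ δ.crossedProduct ∧ x * p ∈ δ.crossedProduct

lemma idealizes_jB (b : B) : δ.Idealizes (δ.jB b) := fun x hx => by
  refine idealizes_of_generators (δ.jB b) ?_ hx
  rintro _ ⟨c, f, rfl⟩
  rw [← map_star, ← mul_assoc, ← mul_assoc, ← map_mul, ← map_mul]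
  exact ⟨δ.jB_mul_jG_mem _ f, δ.jB_mul_jG_mul_jB_mem c b f, δ.jB_mul_jG_mem _ f,
    δ.jB_mul_jG_mul_jB_mem c (star b) f⟩

lemma idealizes_jG (f : C₀(G, ℂ)) : δ.Idealizes (δ.jG f) := fun x hx => by
  refine idealizes_of_generators (δ.jG f) ?_ hx
  rintro _ ⟨c, g, rfl⟩
  have hr : ∀ f, δ.jB c * δ.jG g * δ.jG f ∈ δ.crossedProduct := fun f => by
    rw [← jGHom_apply, ← jGHom_apply, mul_assoc, ← map_mul]
    exact δ.jB_mul_jG_mem c (g * f)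
  have hs : star (δ.jG f) = δ.jG (star f) := (map_star δ.jGHom f).symm
  rw [hs]
  exact ⟨δ.jG_mul_jB_mul_jG_mem c f g, hr f, δ.jG_mul_jB_mul_jG_mem c (star f) g, hr (star f)⟩

lemma multiplier_eq {p : 𝓜(ℂ, SpatialTensor B (CompactOps (L2 G)))} (hp : δ.Idealizes p) :
    δ.multiplier p = (multiplierOfIdealizer δ.crossedProduct p (fun x hx => (hp x hx).1)
      (fun x hx => (hp x hx).2) : 𝓜(ℂ, δ.CrossedProduct)) :=
  dif_pos hp

lemma cpIncl_multiplier_fst {p : 𝓜(ℂ, SpatialTensor B (CompactOps (L2 G)))} (hp : δ.Idealizes p)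
    (x : δ.CrossedProduct) : δ.cpIncl ((δ.multiplier p).fst x) = p * δ.cpIncl x := by
  rw [multiplier_eq δ hp]; rfl

lemma cpIncl_multiplier_snd {p : 𝓜(ℂ, SpatialTensor B (CompactOps (L2 G)))} (hp : δ.Idealizes p)
    (x : δ.CrossedProduct) : δ.cpIncl ((δ.multiplier p).snd x) = δ.cpIncl x * p := by
  rw [multiplier_eq δ hp]; rfl

lemma multiplier_ext {m n : 𝓜(ℂ, δ.CrossedProduct)}
    (h : ∀ x, δ.cpIncl (m.fst x) = δ.cpIncl (n.fst x)) : m = n :=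
  mult_ext fun x => δ.cpIncl_injective (h x)

/-- The homomorphism of `B` to the multiplier algebra of the crossed product. -/
def multB : B →⋆ₙₐ[ℂ] 𝓜(ℂ, δ.CrossedProduct) where
  toFun b := δ.multiplier (δ.jB b)
  map_smul' c b := δ.multiplier_ext fun x => by
    rw [cpIncl_multiplier_fst _ (δ.idealizes_jB _), MonoidHom.id_apply,
      DoubleCentralizer.smul_fst, smul_apply, map_smul, map_smul,
      cpIncl_multiplier_fst _ (δ.idealizes_jB _), smul_mul_assoc]
  map_zero' := δ.multiplier_ext fun x => by
    rw [cpIncl_multiplier_fst _ (δ.idealizes_jB _), map_zero, zero_mul,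
      DoubleCentralizer.zero_fst, zero_apply, map_zero]
  map_add' b c := δ.multiplier_ext fun x => by
    rw [cpIncl_multiplier_fst _ (δ.idealizes_jB _), DoubleCentralizer.add_fst, add_apply, map_add,
      map_add, cpIncl_multiplier_fst _ (δ.idealizes_jB _),
      cpIncl_multiplier_fst _ (δ.idealizes_jB _), add_mul]
  map_mul' b c := δ.multiplier_ext fun x => by
    rw [cpIncl_multiplier_fst _ (δ.idealizes_jB _), mul_fst_apply,
      cpIncl_multiplier_fst _ (δ.idealizes_jB _), cpIncl_multiplier_fst _ (δ.idealizes_jB _),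
      map_mul, mul_assoc]
  map_star' b := δ.multiplier_ext fun x => by
    rw [cpIncl_multiplier_fst _ (δ.idealizes_jB _), DoubleCentralizer.star_fst]
    change _ = δ.cpIncl (star ((δ.multiplier (δ.jB b)).snd (star x)))
    rw [map_star δ.cpIncl, cpIncl_multiplier_snd _ (δ.idealizes_jB _), star_mul, map_star,
      map_star, star_star]

lemma multB_apply (b : B) : δ.multB b = δ.multiplier (δ.jB b) := rfl

lemma cpIncl_multB_fst (b : B) (x : δ.CrossedProduct) :
    δ.cpIncl ((δ.multB b).fst x) = δ.jB b * δ.cpIncl x :=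
  δ.cpIncl_multiplier_fst (δ.idealizes_jB b) x

lemma incl_gen (b : B) (f : C₀(G, ℂ)) :
    incl _ (δ.gen b f) = δ.multB b * δ.multiplier (δ.jG f) := by
  refine δ.multiplier_ext fun x => ?_
  rw [incl_fst, map_mul, cpIncl_gen, mul_fst_apply, cpIncl_multB_fst,
    cpIncl_multiplier_fst _ (δ.idealizes_jG f), mul_assoc]

lemma multB_fst_gen (b c : B) (f : C₀(G, ℂ)) : (δ.multB b).fst (δ.gen c f) = δ.gen (b * c) f := by
  refine δ.cpIncl_injective ?_
  rw [cpIncl_multB_fst, cpIncl_gen, cpIncl_gen, map_mul, mul_assoc]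

lemma continuous_gen (f : C₀(G, ℂ)) : Continuous fun b => δ.gen b f :=
  Continuous.subtype_mk ((continuous_hom δ.jB).mul continuous_const) _

lemma star_gen_mem_closure (b : B) (f : C₀(G, ℂ)) :
    star (δ.gen b f) ∈ closure (Submodule.span ℂ {x | ∃ b f, x = δ.gen b f} :
      Set δ.CrossedProduct) := by
  have hiso : Isometry δ.cpIncl := NonUnitalStarAlgHom.isometry δ.cpIncl δ.cpIncl_injective
  rw [hiso.isEmbedding.isInducing.closure_eq_preimage_closure_image]
  have h := δ.jG_mul_jB_mem_closure (star f) (star b)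
  have h2 : δ.cpIncl (star (δ.gen b f)) = δ.jG (star f) * δ.jB (star b) := by
    rw [map_star δ.cpIncl, cpIncl_gen, star_mul, map_star, ← jGHom_apply, ← jGHom_apply, map_star]
  have h3 : {x | ∃ b f, x = δ.jB b * δ.jG f} =
      (homCLM δ.cpIncl).toLinearMap '' {x | ∃ b f, x = δ.gen b f} := by
    ext T
    constructor
    · rintro ⟨b, f, rfl⟩
      exact ⟨_, ⟨b, f, rfl⟩, rfl⟩
    · rintro ⟨_, ⟨b, f, rfl⟩, rfl⟩
      exact ⟨b, f, rfl⟩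
  rw [h3, ← Submodule.map_span, Submodule.map_coe] at h
  rw [Set.mem_preimage, h2]
  exact h

/-- The closed span N of B (B ×_δ G) contains the generators and is a right ideal. The commutation
relation puts the adjoints of the generators in N too, so N contains the whole generated
`*`-algebra. Nondegeneracy is what gives meaning to extending this map to M(B) in `IsCrossedMap`. -/
lemma nondegenerate_multB : Nondegenerate δ.multB := by
  set N := (Submodule.span ℂ {x | ∃ b y, x = (δ.multB b).fst y}).topologicalClosure with hN
  have hcl : IsClosed (N : Set δ.CrossedProduct) := Submodule.isClosed_topologicalClosure _
  have hgen : ∀ b f, δ.gen b f ∈ N := fun b f => by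
    have hc : IsClosed {b : B | δ.gen b f ∈ N} := hcl.preimage (δ.continuous_gen f)
    refine hc.closure_subset (mem_closure_mul (fun b₁ b₂ => ?_) b)
    rw [Set.mem_ofPred, ← multB_fst_gen]
    exact Submodule.le_topologicalClosure _ (Submodule.subset_span ⟨b₁, _, rfl⟩)
  have hstar : ∀ b f, star (δ.gen b f) ∈ N := fun b f => by
    refine hcl.closure_subset_iff.2 ?_ (δ.star_gen_mem_closure b f)
    refine Submodule.span_le.2 ?_
    rintro _ ⟨b, f, rfl⟩
    exact hgen b f
  have hmul : ∀ x ∈ N, ∀ y, x * y ∈ N := by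
    intro x hx y
    have hc : IsClosed {x : δ.CrossedProduct | x * y ∈ N} :=
      hcl.preimage (continuous_mul_const y)
    refine hc.closure_subset_iff.2 ?_ (hx : x ∈ closure _)
    intro x hx
    induction hx using Submodule.span_induction with
    | mem x hx =>
      obtain ⟨b, z, rfl⟩ := hx
      rw [Set.mem_ofPred, ← fst_mul]
      exact Submodule.le_topologicalClosure _ (Submodule.subset_span ⟨b, _, rfl⟩)
    | zero => rw [Set.mem_ofPred, zero_mul]; exact zero_mem _
    | add x z _ _ hx hz => rw [Set.mem_ofPred, add_mul]; exact add_mem hx hz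
    | smul c x _ hx => rw [Set.mem_ofPred, smul_mul_assoc]; exact Submodule.smul_mem _ c hx
  have hadj : ∀ x ∈ NonUnitalStarAlgebra.adjoin ℂ {x : δ.CrossedProduct | ∃ b f, x = δ.gen b f},
      x ∈ N ∧ star x ∈ N := by
    intro x hx
    induction hx using NonUnitalStarAlgebra.adjoin_induction with
    | mem x hx => obtain ⟨b, f, rfl⟩ := hx; exact ⟨hgen b f, hstar b f⟩
    | add x y _ _ hx hy => rw [star_add]; exact ⟨add_mem hx.1 hy.1, add_mem hx.2 hy.2⟩
    | zero => rw [star_zero]; exact ⟨zero_mem _, zero_mem _⟩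
    | mul x y _ _ hx hy => rw [star_mul]; exact ⟨hmul x hx.1 y, hmul _ hy.2 _⟩
    | smul c x _ hx =>
      rw [star_smul]; exact ⟨Submodule.smul_mem _ c hx.1, Submodule.smul_mem _ _ hx.2⟩
    | star x _ hx => rw [star_star]; exact ⟨hx.2, hx.1⟩
  intro x
  have h := hcl.closure_subset_iff.2 (fun x hx => (hadj x hx).1) (δ.dense_adjoin_gen x)
  exact h

end FullCoaction

end CrossedProducts

/-! ### Homomorphisms of crossed products induced by surjective morphisms. -/

section CrossedMaps

lemma exists_factor {A B E : Type*} [NonUnitalCStarAlgebra A] [NonUnitalCStarAlgebra B]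
    [NonUnitalCStarAlgebra E] {p : A →⋆ₙₐ[ℂ] B} (hp : Function.Surjective p) (ψ : A →⋆ₙₐ[ℂ] E)
    (h : ∀ a, p a = 0 → ψ a = 0) : ∃ ψ' : B →⋆ₙₐ[ℂ] E, ∀ a, ψ' (p a) = ψ a := by
  let r := Function.surjInv hp
  have hr : ∀ b, p (r b) = b := Function.surjInv_eq hp
  have h' : ∀ a a', p a = p a' → ψ a = ψ a' := fun a a' haa => by
    rw [← sub_eq_zero, ← map_sub]
    exact h _ (by rw [map_sub, haa, sub_self])
  refine ⟨⟨⟨⟨⟨fun b => ψ (r b), ?_⟩, ?_, ?_⟩, ?_⟩, ?_⟩, fun a => h' _ _ (hr _)⟩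
  · intro c b
    change ψ (r (c • b)) = c • ψ (r b)
    rw [← map_smul]
    exact h' _ _ (by rw [hr, map_smul, hr])
  · exact (h' _ 0 (by rw [hr, map_zero])).trans (map_zero ψ)
  · intro a b
    change ψ (r (a + b)) = ψ (r a) + ψ (r b)
    rw [← map_add]
    exact h' _ _ (by rw [hr, map_add, hr, hr])
  · intro a b
    change ψ (r (a * b)) = ψ (r a) * ψ (r b)
    rw [← map_mul]
    exact h' _ _ (by rw [hr, map_mul, hr, hr])
  · intro a
    change ψ (r (star a)) = star (ψ (r a))
    rw [← map_star]
    exact h' _ _ (by rw [hr, map_star, hr])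

variable {G : Type v} [Group G] [TopologicalSpace G] [IsTopologicalGroup G]
  [LocallyCompactSpace G] [T2Space G] [MeasurableSpace G] [BorelSpace G]
variable {B : Type u} {D : Type w} [NonUnitalCStarAlgebra B] [NonUnitalCStarAlgebra D]

namespace FullCoaction

variable {δ : FullCoaction G B} {η : FullCoaction G D}

lemma nondegenerate_jB (δ : FullCoaction G B) : Nondegenerate δ.jB :=
  (nondegenerate_tensorHom (nondegenerate_incl B) (nondegenerate_regHom G)).comp δ.nondegenerate

lemma bar_comp_incl {A C : Type*} [NonUnitalCStarAlgebra A] [NonUnitalCStarAlgebra C]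
    {φ : A →⋆ₙₐ[ℂ] 𝓜(ℂ, C)} (hφ : Nondegenerate φ) : (bar φ).comp (incl A) = φ :=
  NonUnitalStarAlgHom.ext fun a => bar_incl hφ a

lemma bar_incl_comp {A C : Type*} [NonUnitalCStarAlgebra A] [NonUnitalCStarAlgebra C]
    (φ : A →⋆ₙₐ[ℂ] 𝓜(ℂ, C)) : (bar (incl C)).comp φ = φ :=
  NonUnitalStarAlgHom.ext fun a => bar_incl_self (φ a)

/-- Naturality of `j_B`. -/
lemma bar_tensorHom_jB {φ : B →⋆ₙₐ[ℂ] 𝓜(ℂ, D)} (hφ : IsMorphism δ η φ) (b : B) :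
    bar (tensorHom φ (incl (CompactOps (L2 G)))) (δ.jB b) = bar η.jB (φ b) := by
  have h1 : bar (tensorHom φ (incl (CompactOps (L2 G)))) (δ.jB b) =
      bar (tensorHom φ (regHom G)) (δ.δ b) := by
    refine (bar_tensorHom_comp (nondegenerate_incl B) (nondegenerate_regHom G) hφ.1
      (nondegenerate_incl _) (δ.δ b)).trans ?_
    rw [bar_comp_incl hφ.1, bar_incl_comp]
  have h2 : bar η.jB (φ b) = bar (tensorHom (incl D) (regHom G)) (bar η.δ (φ b)) :=
    (bar_bar η.nondegenerate
      (nondegenerate_tensorHom (nondegenerate_incl D) (nondegenerate_regHom G)) (φ b)).symm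
  rw [h1, h2, ← hφ.2 b, bar_tensorHom_comp hφ.1 (nondegenerate_incl _) (nondegenerate_incl D)
    (nondegenerate_regHom G), bar_incl_comp, bar_comp_incl (nondegenerate_regHom G)]

lemma bar_tensorHom_jG {φ : B →⋆ₙₐ[ℂ] 𝓜(ℂ, D)} (hφ : Nondegenerate φ) (f : C₀(G, ℂ)) :
    bar (tensorHom φ (incl (CompactOps (L2 G)))) (δ.jG f) = η.jG f := by
  refine (bar_tensorHom_mtmul hφ (nondegenerate_incl _) _ _).trans ?_
  rw [bar_one hφ, bar_incl_self]; rfl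

variable {p : B →⋆ₙₐ[ℂ] D}

lemma bar_tensorHom_jB_of_surjective (hφ : IsMorphism δ η ((incl D).comp p)) (b : B) :
    bar (tensorHom ((incl D).comp p) (incl (CompactOps (L2 G)))) (δ.jB b) = η.jB (p b) := by
  rw [bar_tensorHom_jB hφ]
  exact bar_incl η.nondegenerate_jB (p b)

/-- A morphism with values in `D` induces a homomorphism of crossed products. -/
lemma exists_crossedHom (hφ : IsMorphism δ η ((incl D).comp p)) :
    ∃ Θ : δ.CrossedProduct →⋆ₙₐ[ℂ] η.CrossedProduct, ∀ x, η.cpIncl (Θ x) =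
      bar (tensorHom ((incl D).comp p) (incl (CompactOps (L2 G)))) (δ.cpIncl x) := by
  set T := bar (tensorHom ((incl D).comp p) (incl (CompactOps (L2 G)))) with hT
  have hle : δ.crossedProduct ≤ NonUnitalStarSubalgebra.comap T η.crossedProduct := by
    refine NonUnitalStarSubalgebra.topologicalClosure_minimal _ (NonUnitalStarAlgebra.adjoin_le ?_)
      (η.isClosed_crossedProduct.preimage (continuous_hom T))
    rintro _ ⟨b, f, rfl⟩
    change T (δ.jB b * δ.jG f) ∈ η.crossedProduct
    rw [map_mul, hT, bar_tensorHom_jB_of_surjective hφ, bar_tensorHom_jG (η := η) hφ.1]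
    exact η.jB_mul_jG_mem (p b) f
  exact ⟨NonUnitalStarAlgHom.codRestrict (T.comp δ.cpIncl) η.crossedProduct
    fun x => hle x.2, fun x => rfl⟩

/-- By `hker`, J = k ∘ p for a representation k of D, so (J ⊗ id)(x) = (k ⊗ id)((p ⊗ id)(x)) = 0;
but (J ⊗ id)(x) is equivalent to x ⊗ 1. -/
lemma eq_zero_of_regRep (hp : Function.Surjective p) (hφ : IsMorphism δ η ((incl D).comp p))
    (hker : ∀ b, p b = 0 → δ.jB b = 0) (x : δ.CrossedProduct)
    (hx : bar (tensorHom ((incl D).comp p) (incl (CompactOps (L2 G)))) (δ.cpIncl x) = 0) :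
    x = 0 := by
  have hσ := nondegRep_univHom B
  have hinj : Function.Injective (tensorExt hσ (nondegRep_idK (L2 G))) :=
    ext_injective _ (tensorRep_injective hσ (nondegRep_idK (L2 G)) (univHom_injective B)
      (idK_injective (L2 G)))
  obtain ⟨k, hk⟩ := exists_factor hp (δ.regRep hσ) fun b hb => by
    rw [← tensorExt_jB, hker b hb, map_zero]
  have hkp : k.comp p = δ.regRep hσ := NonUnitalStarAlgHom.ext hk
  have hkn : NondegRep k := NondegRep.of_surjective (p := p) (hkp ▸ δ.nondegRep_regRep hσ)
  have h1 := ext_bar_tensorHom hφ.1 (nondegenerate_incl _) hkn (nondegRep_idK (L2 G)) (δ.cpIncl x)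
  rw [hx, map_zero] at h1
  have h2 : tensorExt (δ.nondegRep_regRep hσ) (nondegRep_idK (L2 G)) (δ.cpIncl x) = 0 := by
    refine Eq.trans (tensorExt_congr ?_ ?_ _) h1.symm
    · exact NonUnitalStarAlgHom.ext fun b =>
        ((ext_incl hkn (p b)).trans (hk b)).symm
    · exact (ext_comp_incl _).symm
  have h3 := δ.conj_crossedProduct hσ x
  rw [h2, map_zero] at h3
  have h4 : htop (tensorExt hσ (nondegRep_idK (L2 G)) (δ.cpIncl x)) (1 : L2 G →L[ℂ] L2 G) = 0 :=
    conjHom_injective (assocHT _ (L2 G) (L2 G)) (conjHom_injective (htIso _ (swapW G))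
      (h3.symm.trans (by rw [map_zero, map_zero])))
  refine δ.cpIncl_injective (hinj ?_)
  rw [map_zero, map_zero]
  exact eq_zero_of_htop_one h4

/-- A surjective morphism whose kernel is contained in that of `j_B` induces an isomorphism of
crossed products. -/
lemma crossedMapIsIso_of_surjective (hp : Function.Surjective p)
    (hφ : IsMorphism δ η ((incl D).comp p)) (hker : ∀ b, p b = 0 → δ.jB b = 0) :
    δ.CrossedMapIsIso η ((incl D).comp p) := by
  obtain ⟨Θ, hΘ⟩ := exists_crossedHom hφ
  have hgen : ∀ b f, Θ (δ.gen b f) = η.gen (p b) f := fun b f => η.cpIncl_injective (by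
    rw [hΘ, cpIncl_gen, cpIncl_gen, map_mul, bar_tensorHom_jB_of_surjective hφ,
      bar_tensorHom_jG (η := η) hφ.1])
  have hsurj : Function.Surjective Θ := by
    have hle : NonUnitalStarAlgebra.adjoin ℂ {x | ∃ b f, x = η.gen b f} ≤
        NonUnitalStarAlgHom.range Θ := by
      refine NonUnitalStarAlgebra.adjoin_le ?_
      rintro _ ⟨d, f, rfl⟩
      obtain ⟨b, rfl⟩ := hp d
      exact ⟨δ.gen b f, hgen b f⟩
    intro y
    exact (isClosed_range Θ).closure_subset_iff.2 hle (η.dense_adjoin_gen y)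
  have hinj : Function.Injective Θ := by
    rw [injective_iff_map_eq_zero]
    intro x hx
    refine eq_zero_of_regRep hp hφ hker x ?_
    rw [← hΘ, hx, map_zero]
  have hΦ : Nondegenerate ((incl η.CrossedProduct).comp Θ) := nondegenerate_of_surjective hsurj
  -- To identify the extension of Θ at m, it suffices to compare the left actions on the range of Θ.
  have hbar : ∀ {m : 𝓜(ℂ, δ.CrossedProduct)} {n : 𝓜(ℂ, η.CrossedProduct)},
      (∀ x, Θ (m.fst x) = n.fst (Θ x)) → bar ((incl η.CrossedProduct).comp Θ) m = n := by
    intro m n h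
    refine hΦ.mult_ext fun x y => ?_
    rw [bar_fst hΦ]
    change Θ (m.fst x) * y = n.fst (Θ x * y)
    rw [h, fst_mul]
  -- The bare function under `bar` is the homomorphism `multB`, so its nondegeneracy shows that the
  -- extension restricts to it on D.
  have hB : ∀ b, bar (fun c : D => η.multiplier (η.jB c)) ((incl D).comp p b) = η.multB (p b) :=
    fun b => bar_incl η.nondegenerate_multB (p b)
  refine ⟨(incl η.CrossedProduct).comp Θ, ⟨hΦ, fun b => ?_, fun f => ?_⟩, fun Ψ hΨ => ?_, ?_, ?_⟩
  · rw [hB]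
    refine hbar fun x => η.cpIncl_injective ?_
    rw [hΘ, cpIncl_multiplier_fst _ (δ.idealizes_jB b), map_mul, cpIncl_multB_fst, hΘ,
      bar_tensorHom_jB_of_surjective hφ]
  · refine hbar fun x => η.cpIncl_injective ?_
    rw [hΘ, cpIncl_multiplier_fst _ (δ.idealizes_jG f), map_mul,
      cpIncl_multiplier_fst _ (η.idealizes_jG f), hΘ, bar_tensorHom_jG (η := η) hφ.1]
  -- A generator is a product of the multipliers of b and f, on whose images the two defining
  -- conditions leave no choice.
  · refine hom_ext_of_generators δ.dense_adjoin_gen ?_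
    rintro _ ⟨b, f, rfl⟩
    rw [← bar_incl hΨ.1, incl_gen, map_mul, multB_apply, hΨ.2.1, hΨ.2.2, hB]
    change _ = incl _ (Θ (δ.gen b f))
    rw [hgen, incl_gen]
  · exact (incl_injective).comp hinj
  · ext m
    constructor
    · rintro ⟨x, rfl⟩; exact ⟨Θ x, rfl⟩
    · rintro ⟨y, rfl⟩
      obtain ⟨x, rfl⟩ := hsurj y
      exact ⟨x, rfl⟩

end FullCoaction

end CrossedMaps

/-! ### Composition of morphisms, identities, and a faithfulness criterion. -/

section Morphisms

variable {G : Type v} [Group G] [TopologicalSpace G] [IsTopologicalGroup G]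
  [LocallyCompactSpace G] [T2Space G] [MeasurableSpace G] [BorelSpace G]

open FullCoaction

lemma IsMorphism.comp {B C D : Type*} [NonUnitalCStarAlgebra B] [NonUnitalCStarAlgebra C]
    [NonUnitalCStarAlgebra D] {δ : FullCoaction G B} {ε : FullCoaction G C} {η : FullCoaction G D}
    {φ : B →⋆ₙₐ[ℂ] 𝓜(ℂ, C)} {ψ : C →⋆ₙₐ[ℂ] 𝓜(ℂ, D)} (hψ : IsMorphism ε η ψ)
    (hφ : IsMorphism δ ε φ) : IsMorphism δ η ((bar ψ).comp φ) := by
  refine ⟨hψ.1.comp hφ.1, fun b => ?_⟩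
  have hn := nondegenerate_tensorHom hψ.1 (nondegenerate_incl (GroupAlg G))
  have h1 := bar_tensorHom_comp hφ.1 (nondegenerate_incl (GroupAlg G)) hψ.1
    (nondegenerate_incl (GroupAlg G)) (δ.δ b)
  rw [bar_incl_comp] at h1
  have h2 : (bar (tensorHom ψ (incl (GroupAlg G)))).comp ε.δ = (bar η.δ).comp ψ :=
    NonUnitalStarAlgHom.ext hψ.2
  rw [← h1, hφ.2, bar_bar ε.nondegenerate hn, h2]
  exact (bar_bar hψ.1 η.nondegenerate (φ b)).symm

lemma tensorHom_incl_incl (A C : Type*) [NonUnitalCStarAlgebra A] [NonUnitalCStarAlgebra C] :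
    tensorHom (incl A) (incl C) = incl (SpatialTensor A C) :=
  spatial_hom_ext fun a c => by
    rw [tensorHom_tmul (nondegenerate_incl A) (nondegenerate_incl C), mtmul_incl]

lemma isMorphism_incl {D : Type*} [NonUnitalCStarAlgebra D] (η : FullCoaction G D) :
    IsMorphism η η (incl D) := by
  refine ⟨nondegenerate_incl D, fun d => ?_⟩
  rw [tensorHom_incl_incl, bar_incl_self, bar_incl η.nondegenerate]

lemma Nondegenerate.of_surjective {A B C : Type*} [NonUnitalCStarAlgebra A]
    [NonUnitalCStarAlgebra B] [NonUnitalCStarAlgebra C] {q : A →⋆ₙₐ[ℂ] B} {φ : A →⋆ₙₐ[ℂ] 𝓜(ℂ, C)}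
    {ψ : B →⋆ₙₐ[ℂ] 𝓜(ℂ, C)} (h : ∀ a, ψ (q a) = φ a) (hφ : Nondegenerate φ) : Nondegenerate ψ := by
  refine hφ.mono (Submodule.span_mono ?_)
  rintro _ ⟨a, c, rfl⟩
  exact ⟨q a, c, by rw [h]⟩

/-- The group algebra is tested on all unitary representations because the central identity treats
them one at a time. -/
lemma tensorExt_jointly_faithful {A : Type*} [NonUnitalCStarAlgebra A]
    {K : Type*} [NormedAddCommGroup K] [InnerProductSpace ℂ K] [CompleteSpace K]
    {k : A →⋆ₙₐ[ℂ] (K →L[ℂ] K)} (hk : NondegRep k) (hk' : Function.Injective k)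
    {m : 𝓜(ℂ, SpatialTensor A (GroupAlg G))}
    (h : ∀ π : UnitaryRep G, tensorExt hk (nondegRep_repHom π) m = 0) : m = 0 := by
  refine mult_ext fun y => ?_
  refine (tensorRep_jointly_faithful (I := Unit) (σ := fun _ => k) (τ := fun π => repHom π)
    (fun _ => hk) (fun π => nondegRep_repHom π)
    (fun a ha => (injective_iff_map_eq_zero k).1 hk' a (ha ()))
    (fun z hz => repHom_jointly_faithful hz) fun _ π => ?_)
  rw [← ext_mul (nondegRep_tensorRep hk (nondegRep_repHom π)), h, zero_mul]

end Morphisms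

/-! ### The coaction on the quotient by the kernel of j_B. -/

section Normalization

variable {G : Type v} [Group G] [TopologicalSpace G] [IsTopologicalGroup G]
  [LocallyCompactSpace G] [T2Space G] [MeasurableSpace G] [BorelSpace G]
variable {B : Type u} {N : Type w} [NonUnitalCStarAlgebra B] [NonUnitalCStarAlgebra N]

namespace FullCoaction

lemma tensorHom_mem_range_incl {C : Type*} [NonUnitalCStarAlgebra C] {q : B →⋆ₙₐ[ℂ] N}
    (hq : Nondegenerate ((incl N).comp q)) (x : SpatialTensor B C) :
    tensorHom ((incl N).comp q) (incl C) x ∈ Set.range (incl _) := by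
  refine clm_mem_range (incl _) (dense_span_range_tmul B C)
    (homCLM (tensorHom ((incl N).comp q) (incl C))) ?_ x
  rintro _ ⟨b, z, rfl⟩
  refine ⟨tmul (q b) z, ?_⟩
  rw [homCLM_apply, tensorHom_tmul hq (nondegenerate_incl _), ← mtmul_incl]; rfl

/-- Naturality of the associativity isomorphism in its first factor. -/
lemma bar_assocHom_tensorHom {C D : Type*} [NonUnitalCStarAlgebra C] [NonUnitalCStarAlgebra D]
    {q : B →⋆ₙₐ[ℂ] N} (hq : Nondegenerate ((incl N).comp q))
    (m : 𝓜(ℂ, SpatialTensor (SpatialTensor B C) D)) :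
    bar (assocHom N C D)
        (bar (tensorHom (tensorHom ((incl N).comp q) (incl C)) (incl D)) m) =
      bar (tensorHom ((incl N).comp q) (incl (SpatialTensor C D))) (bar (assocHom B C D) m) := by
  have hC := nondegenerate_incl C
  have hD := nondegenerate_incl D
  have hCD := nondegenerate_incl (SpatialTensor C D)
  have hT := nondegenerate_tensorHom hq hC
  rw [bar_bar (nondegenerate_tensorHom hT hD) (nondegenerate_assocHom _ _ _),
    bar_bar (nondegenerate_assocHom _ _ _) (nondegenerate_tensorHom hq hCD)]
  have h : (bar (assocHom N C D)).comp (tensorHom (tensorHom ((incl N).comp q) (incl C)) (incl D)) =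
      (bar (tensorHom ((incl N).comp q) (incl (SpatialTensor C D)))).comp (assocHom B C D) := by
    refine spatial_hom_ext₂ fun b c d => ?_
    have h1 : tensorHom (tensorHom ((incl N).comp q) (incl C)) (incl D) (tmul (tmul b c) d) =
        incl _ (tmul (tmul (q b) c) d) := by
      rw [tensorHom_tmul hT hD, tensorHom_tmul hq hC, ← mtmul_incl, ← mtmul_incl]; rfl
    have h2 : tensorHom ((incl N).comp q) (incl (SpatialTensor C D)) (tmul b (tmul c d)) =
        incl _ (tmul (q b) (tmul c d)) := by
      rw [tensorHom_tmul hq hCD]; exact mtmul_incl (q b) (tmul c d)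
    rw [NonUnitalStarAlgHom.comp_apply, NonUnitalStarAlgHom.comp_apply, h1,
      bar_incl (nondegenerate_assocHom _ _ _), assocHom_tmul, assocHom_tmul,
      bar_incl (nondegenerate_tensorHom hq hCD), h2]
  rw [h]

variable (δ : FullCoaction G B)

section Quotient

variable {q : B →⋆ₙₐ[ℂ] N}

lemma exists_mul_mem_of_quotient (hq : Nondegenerate ((incl N).comp q)) (b : B) (z : GroupAlg G) :
    ∃ y, bar (tensorHom ((incl N).comp q) (incl (GroupAlg G))) (δ.δ b) * mtmul 1 (incl _ z) =
      incl _ y := by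
  have hC := nondegenerate_incl (GroupAlg G)
  obtain ⟨x, hx⟩ := δ.mul_mem b z
  have h1 := congrArg (bar (tensorHom ((incl N).comp q) (incl (GroupAlg G)))) hx
  rw [map_mul, bar_tensorHom_mtmul hq hC, bar_one hq, bar_incl hC,
    bar_incl (nondegenerate_tensorHom hq hC)] at h1
  obtain ⟨y, hy⟩ := tensorHom_mem_range_incl hq x
  exact ⟨y, h1.trans hy.symm⟩

/-- The relation is the image of coassociativity of δ under q ⊗ id ⊗ id. -/
lemma coassoc_of_quotient (hq : Nondegenerate ((incl N).comp q))
    {δ' : N →⋆ₙₐ[ℂ] 𝓜(ℂ, SpatialTensor N (GroupAlg G))} (hδn : Nondegenerate δ')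
    (hδ' : ∀ b, δ' (q b) = bar (tensorHom ((incl N).comp q) (incl (GroupAlg G))) (δ.δ b)) (b : B) :
    bar (assocHom N (GroupAlg G) (GroupAlg G))
        (bar (tensorHom δ' (incl (GroupAlg G))) (δ' (q b))) =
      bar (tensorHom (incl N) (comul G)) (δ' (q b)) := by
  have hC := nondegenerate_incl (GroupAlg G)
  have hT := nondegenerate_tensorHom hq hC
  have hCC := nondegenerate_incl (SpatialTensor (GroupAlg G) (GroupAlg G))
  have h1 : (bar δ').comp ((incl N).comp q) =
      (bar (tensorHom ((incl N).comp q) (incl (GroupAlg G)))).comp δ.δ :=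
    NonUnitalStarAlgHom.ext fun b => (bar_incl hδn (q b)).trans (hδ' b)
  have h2 : bar (tensorHom δ' (incl (GroupAlg G))) (δ' (q b)) =
      bar (tensorHom (tensorHom ((incl N).comp q) (incl (GroupAlg G))) (incl (GroupAlg G)))
        (bar (tensorHom δ.δ (incl (GroupAlg G))) (δ.δ b)) := by
    rw [hδ', bar_tensorHom_comp δ.nondegenerate hC hT hC, bar_tensorHom_comp hq hC hδn hC, h1]
  rw [h2, bar_assocHom_tensorHom hq, δ.coassoc, hδ',
    bar_tensorHom_comp (nondegenerate_incl B) (nondegenerate_comul G) hq hCC,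
    bar_comp_incl hq, bar_incl_comp, bar_tensorHom_comp hq hC (nondegenerate_incl N)
    (nondegenerate_comul G), bar_incl_comp, bar_comp_incl (nondegenerate_comul G)]

variable {H : Type*} [NormedAddCommGroup H] [InnerProductSpace ℂ H] [CompleteSpace H]
variable {σ : B →⋆ₙₐ[ℂ] (H →L[ℂ] H)} {hσ : NondegRep σ}
variable {k : N →⋆ₙₐ[ℂ] (HT H (L2 G) →L[ℂ] HT H (L2 G))}

lemma tensorExt_of_quotient (hq : Nondegenerate ((incl N).comp q)) (hkn : NondegRep k)
    (hk : ∀ b, k (q b) = δ.regRep hσ b)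
    {K : Type*} [NormedAddCommGroup K] [InnerProductSpace ℂ K] [CompleteSpace K]
    {τ : GroupAlg G →⋆ₙₐ[ℂ] (K →L[ℂ] K)} (hτ : NondegRep τ) (b : B) :
    tensorExt hkn hτ (bar (tensorHom ((incl N).comp q) (incl (GroupAlg G))) (δ.δ b)) =
      tensorExt (δ.nondegRep_regRep hσ) hτ (δ.δ b) := by
  refine (ext_bar_tensorHom hq (nondegenerate_incl _) hkn hτ (δ.δ b)).trans ?_
  refine tensorExt_congr ?_ (ext_comp_incl _) _
  exact NonUnitalStarAlgHom.ext fun b => (ext_incl hkn (q b)).trans (hk b)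

/-- The operator is equivalent to J(b) ⊗ 1. Since π is arbitrary, δ descends to the quotient by ker
J as a map into multipliers over the full group algebra, not merely its regular image. -/
lemma tensorExt_eq_zero_of_regRep (b : B) (hb : δ.regRep hσ b = 0) (π : UnitaryRep G) :
    tensorExt (δ.nondegRep_regRep hσ) (nondegRep_repHom π) (δ.δ b) = 0 := by
  have h := δ.conj_regRep hσ π π.W π.conj_W b
  rw [hb, ← ampHom_apply, map_zero, map_zero, map_zero] at h
  exact conjHom_injective (assocHT H (L2 G) π.H) (h.trans (map_zero _).symm)

end Quotient

/-- The quotient of a coaction by the kernel of `j_B` is a normal coaction. -/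
lemma exists_normalization {q : B →⋆ₙₐ[ℂ] N} (hq : Function.Surjective q)
    (hker : ∀ b, q b = 0 ↔ δ.jB b = 0) :
    ∃ δn : FullCoaction G N, (∀ b, δn.δ (q b) =
        bar (tensorHom ((incl N).comp q) (incl (GroupAlg G))) (δ.δ b)) ∧ δn.IsNormal := by
  have hφ : Nondegenerate ((incl N).comp q) := nondegenerate_of_surjective hq
  have hT := nondegenerate_tensorHom hφ (nondegenerate_incl (GroupAlg G))
  have hσ := nondegRep_univHom B
  have hinj : Function.Injective (tensorExt hσ (nondegRep_idK (L2 G))) :=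
    ext_injective _ (tensorRep_injective hσ (nondegRep_idK (L2 G)) (univHom_injective B)
      (idK_injective (L2 G)))
  have hJ : ∀ b, q b = 0 ↔ δ.regRep hσ b = 0 := fun b => by
    rw [hker, ← tensorExt_jB, map_eq_zero_iff _ hinj]
  -- J passes to a faithful nondegenerate representation k of the quotient, in which all vanishing
  -- statements are checked.
  obtain ⟨k, hk⟩ := exists_factor hq (δ.regRep hσ) fun b hb => (hJ b).1 hb
  have hkq : k.comp q = δ.regRep hσ := NonUnitalStarAlgHom.ext hk
  have hkn : NondegRep k := NondegRep.of_surjective (p := q) (hkq ▸ δ.nondegRep_regRep hσ)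
  have hkinj : Function.Injective k := by
    rw [injective_iff_map_eq_zero]
    intro n hn
    obtain ⟨b, rfl⟩ := hq n
    rw [hk] at hn
    exact (hJ b).2 hn
  obtain ⟨δ', hδ'⟩ := exists_factor hq
    ((bar (tensorHom ((incl N).comp q) (incl (GroupAlg G)))).comp δ.δ) fun b hb =>
      tensorExt_jointly_faithful hkn hkinj fun π =>
        (δ.tensorExt_of_quotient hφ hkn hk (nondegRep_repHom π) b).trans
          (δ.tensorExt_eq_zero_of_regRep b ((hJ b).1 hb) π)
  replace hδ' : ∀ b, δ' (q b) =
    bar (tensorHom ((incl N).comp q) (incl (GroupAlg G))) (δ.δ b) := hδ'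
  have hδn : Nondegenerate δ' := Nondegenerate.of_surjective hδ' (hT.comp δ.nondegenerate)
  -- Faithfulness of (k ⊗ λ) ∘ δ' serves twice: it implies that δ' is injective, and, being the
  -- operator form of j_N, it is normality.
  have hlam : ∀ n, n = 0 ↔ tensorExt hkn (nondegRep_lamHom G) (δ' n) = 0 := fun n => by
    obtain ⟨b, rfl⟩ := hq n
    rw [hδ', δ.tensorExt_of_quotient hφ hkn hk, hJ, regRep_eq_zero_iff]
  let δn : FullCoaction G N :=
    { δ := δ'
      injective := (injective_iff_map_eq_zero δ').2 fun n hn => (hlam n).2 (by rw [hn, map_zero])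
      nondegenerate := hδn
      mul_mem := fun n z => by
        obtain ⟨b, rfl⟩ := hq n
        rw [hδ']
        exact δ.exists_mul_mem_of_quotient hφ b z
      coassoc := fun n => by
        obtain ⟨b, rfl⟩ := hq n
        exact δ.coassoc_of_quotient hφ hδn hδ' b }
  refine ⟨δn, hδ', ?_⟩
  refine (injective_iff_map_eq_zero δn.jB).2 fun n hn => (hlam n).2 ?_
  have h := δn.tensorExt_jB hkn n
  rw [hn, map_zero] at h
  exact h.symm

end FullCoaction

end Normalization

/-! ### Factorization through the normalization, and universal morphisms. -/

section Universality

variable {G : Type v} [Group G] [TopologicalSpace G] [IsTopologicalGroup G]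
  [LocallyCompactSpace G] [T2Space G] [MeasurableSpace G] [BorelSpace G]

open FullCoaction

lemma exists_lift_incl {A B : Type*} [NonUnitalCStarAlgebra A] [NonUnitalCStarAlgebra B]
    (φ : A →⋆ₙₐ[ℂ] 𝓜(ℂ, B)) (h : ∀ a, φ a ∈ Set.range (incl B)) :
    ∃ p : A →⋆ₙₐ[ℂ] B, (incl B).comp p = φ := by
  choose p hp using h
  have hi : Function.Injective (incl B) := incl_injective
  refine ⟨⟨⟨⟨⟨p, fun c a => hi ?_⟩, hi ?_, fun a b => hi ?_⟩, fun a b => hi ?_⟩, fun a => hi ?_⟩,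
    NonUnitalStarAlgHom.ext hp⟩
  · change incl B (p (c • a)) = incl B (c • p a)
    rw [hp, map_smul, map_smul, hp]
  · change incl B (p 0) = incl B 0
    rw [hp, map_zero, map_zero]
  · change incl B (p (a + b)) = incl B (p a + p b)
    rw [hp, map_add, map_add, hp, hp]
  · change incl B (p (a * b)) = incl B (p a * p b)
    rw [hp, map_mul, map_mul, hp, hp]
  · change incl B (p (star a)) = incl B (star (p a))
    rw [hp, map_star, map_star, hp]

/-- If `ψ̄ ∘ φ` is the identity, then `ψ` maps `B` into `A`. -/
lemma mem_range_incl_of_bar_comp {A B : Type*} [NonUnitalCStarAlgebra A] [NonUnitalCStarAlgebra B]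
    {φ : A →⋆ₙₐ[ℂ] 𝓜(ℂ, B)} {ψ : B →⋆ₙₐ[ℂ] 𝓜(ℂ, A)} (hφ : Nondegenerate φ)
    (hψ : Nondegenerate ψ) (h : ∀ a, bar ψ (φ a) = incl A a) (b : B) :
    ψ b ∈ Set.range (incl A) := by
  refine clm_mem_range (incl A) hφ (homCLM ψ) ?_ b
  rintro _ ⟨a, b, rfl⟩
  -- ψ(φ(a)b) = ψ̄(φ(a))ψ(b) = aψ(b), which lies in the ideal A of M(A).
  rw [homCLM_apply, ← bar_mul hψ, h, incl_mul]
  exact ⟨_, rfl⟩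

lemma CStarQuotient.mk_surjective {A E : Type*} [NonUnitalCStarAlgebra A] [NonUnitalCStarAlgebra E]
    (φ : A →⋆ₙₐ[ℂ] E) : Function.Surjective (CStarQuotient.mk φ) := Quotient.mk_surjective

lemma CStarQuotient.mk_eq_zero_iff {A E : Type*} [NonUnitalCStarAlgebra A]
    [NonUnitalCStarAlgebra E] (φ : A →⋆ₙₐ[ℂ] E) (a : A) : CStarQuotient.mk φ a = 0 ↔ φ a = 0 := by
  rw [← map_zero (CStarQuotient.mk φ)]
  refine Quotient.eq.trans ?_
  rw [Setoid.ker_def, map_zero]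

/-- The normalization of a coaction. -/
lemma FullCoaction.exists_normalized {B : Type u} [NonUnitalCStarAlgebra B]
    (δ : FullCoaction G B) : ∃ δn : FullCoaction G δ.Normalized,
      (∀ b : B, δn.δ (δ.qn b) = bar (tensorHom ((incl δ.Normalized).comp δ.qn)
        (incl (GroupAlg G))) (δ.δ b)) ∧ δn.IsNormal ∧
      IsMorphism δ δn ((incl δ.Normalized).comp δ.qn) := by
  have hq := CStarQuotient.mk_surjective δ.jB
  obtain ⟨δn, h1, h2⟩ := δ.exists_normalization hq (CStarQuotient.mk_eq_zero_iff δ.jB)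
  exact ⟨δn, h1, h2, nondegenerate_of_surjective hq, fun b =>
    (h1 b).symm.trans (bar_incl δn.nondegenerate (δ.qn b)).symm⟩

/-- Naturality gives j_D(φ(b)) = 0 in the extended sense, and the extension of the injective j_D to
M(D) is still injective. -/
lemma IsMorphism.eq_zero_of_jB {B D : Type*} [NonUnitalCStarAlgebra B] [NonUnitalCStarAlgebra D]
    {δ : FullCoaction G B} {η : FullCoaction G D} (hη : η.IsNormal) {φ : B →⋆ₙₐ[ℂ] 𝓜(ℂ, D)}
    (hφ : IsMorphism δ η φ) (b : B) (hb : δ.jB b = 0) : φ b = 0 := by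
  refine bar_injective η.nondegenerate_jB hη ?_
  rw [map_zero, ← bar_tensorHom_jB hφ, hb, map_zero]

/-- A morphism to a normal coaction factors through the quotient by the kernel of `j_B`. -/
lemma IsMorphism.exists_factor {B N D : Type*} [NonUnitalCStarAlgebra B] [NonUnitalCStarAlgebra N]
    [NonUnitalCStarAlgebra D] {δ : FullCoaction G B} {ε : FullCoaction G N} {η : FullCoaction G D}
    (hη : η.IsNormal) {φ : B →⋆ₙₐ[ℂ] 𝓜(ℂ, D)} (hφ : IsMorphism δ η φ) {q : B →⋆ₙₐ[ℂ] N}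
    (hq : Function.Surjective q) (hker : ∀ b, q b = 0 → δ.jB b = 0)
    (hqm : IsMorphism δ ε ((incl N).comp q)) :
    ∃ φ' : N →⋆ₙₐ[ℂ] 𝓜(ℂ, D), IsMorphism ε η φ' ∧ ∀ b, φ' (q b) = φ b := by
  obtain ⟨φ', h⟩ := Coact.exists_factor hq φ fun b hb => hφ.eq_zero_of_jB hη b (hker b hb)
  have hn : Nondegenerate φ' := Nondegenerate.of_surjective h hφ.1
  refine ⟨φ', ⟨hn, fun n => ?_⟩, h⟩
  obtain ⟨b, rfl⟩ := hq n
  have hC := nondegenerate_incl (GroupAlg G)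
  have h1 : (bar φ').comp ((incl N).comp q) = φ :=
    NonUnitalStarAlgHom.ext fun b => (bar_incl hn (q b)).trans (h b)
  have h2 : ε.δ (q b) = bar (tensorHom ((incl N).comp q) (incl (GroupAlg G))) (δ.δ b) :=
    (bar_incl ε.nondegenerate (q b)).symm.trans (hqm.2 b).symm
  rw [h2, bar_tensorHom_comp hqm.1 hC hn hC, h1, bar_incl_comp, hφ.2, h]

/-- A morphism that is universal among the morphisms to normal coactions maps onto `D`, and it
induces an isomorphism of crossed products, if the quotient by the kernel of `j_B` is normal. -/
lemma IsMorphism.of_universal {B N D : Type u} [NonUnitalCStarAlgebra B] [NonUnitalCStarAlgebra N]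
    [NonUnitalCStarAlgebra D] {δ : FullCoaction G B} {ε : FullCoaction G N} {η : FullCoaction G D}
    {q : B →⋆ₙₐ[ℂ] N} (hq : Function.Surjective q) (hker : ∀ b, q b = 0 → δ.jB b = 0)
    (hqm : IsMorphism δ ε ((incl N).comp q)) (hε : ε.IsNormal)
    {φ : B →⋆ₙₐ[ℂ] 𝓜(ℂ, D)} (hη : η.IsNormal) (hφ : IsMorphism δ η φ)
    (huniv : ∀ (C : Type u) [NonUnitalCStarAlgebra C] (ε : FullCoaction G C), ε.IsNormal →
      ∀ ψ : B →⋆ₙₐ[ℂ] 𝓜(ℂ, C), IsMorphism δ ε ψ →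
        ∃! θ : D →⋆ₙₐ[ℂ] 𝓜(ℂ, C), IsMorphism η ε θ ∧ (bar θ).comp φ = ψ) :
    Set.range φ = Set.range (incl D) ∧ δ.CrossedMapIsIso η φ := by
  -- The universal property is applied to q; together with the factorization of φ through q this
  -- gives morphisms in both directions between N and D.
  obtain ⟨θ, ⟨hθ, hθφ⟩, -⟩ := huniv N ε hε _ hqm
  obtain ⟨φ', hφ', hφq⟩ := hφ.exists_factor hη hq hker hqm
  have h1 : ∀ n, bar θ (φ' n) = incl _ n := fun n => by
    obtain ⟨b, rfl⟩ := hq n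
    rw [hφq]
    exact DFunLike.congr_fun hθφ b
  -- Both sides are endomorphisms of D that fix φ, so uniqueness in the universal property
  -- identifies them.
  have h2 : (bar φ').comp θ = incl D := by
    refine (huniv D η hη φ hφ).unique ⟨hφ'.comp hθ, ?_⟩ ⟨isMorphism_incl η, bar_incl_comp φ⟩
    refine NonUnitalStarAlgHom.ext fun b => ?_
    change bar ((bar φ').comp θ) (φ b) = φ b
    rw [← bar_bar hθ.1 hφ'.1]
    refine (congrArg (bar φ') (DFunLike.congr_fun hθφ b)).trans ?_
    exact (bar_incl hφ'.1 _).trans (hφq b)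
  have h3 : ∀ d, bar φ' (θ d) = incl D d := DFunLike.congr_fun h2
  obtain ⟨p, hp⟩ := exists_lift_incl φ' (mem_range_incl_of_bar_comp hθ.1 hφ'.1 h3)
  -- θ also takes values in the algebra N itself, so θ(d) is the required preimage.
  have hpsurj : Function.Surjective p := by
    intro d
    obtain ⟨n, hn⟩ := mem_range_incl_of_bar_comp hφ'.1 hθ.1 h1 d
    refine ⟨n, incl_injective ?_⟩
    rw [← h3 d, ← hn, bar_incl hφ'.1, ← hp]; rfl
  have hpq : (incl D).comp (p.comp q) = φ := NonUnitalStarAlgHom.ext fun b => by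
    rw [← hφq, ← hp]; rfl
  have hs : Function.Surjective (p.comp q) := hpsurj.comp hq
  subst hpq
  refine ⟨?_, crossedMapIsIso_of_surjective hs hφ fun b hb => hker b (incl_injective ?_)⟩
  · ext m
    constructor
    · rintro ⟨b, rfl⟩; exact ⟨_, rfl⟩
    · rintro ⟨d, rfl⟩
      obtain ⟨b, rfl⟩ := hs d
      exact ⟨b, rfl⟩
  -- φ' has the left inverse θ, so an element killed by φ = φ' ∘ q is killed by q, hence by j_B.
  · have h4 : φ' (q b) = 0 := by
      rw [← hp]
      exact (congrArg (incl D) hb).trans (map_zero _)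
    rw [← h1]
    refine (congrArg (bar θ) h4).trans ?_
    rw [map_zero, map_zero]

end Universality

end Coact

end

theorem proposition4p4 {G : Type v} [Group G] [TopologicalSpace G] [IsTopologicalGroup G]
    [LocallyCompactSpace G] [T2Space G] [MeasurableSpace G] [BorelSpace G] :
    (∀ (B D : Type u) [NonUnitalCStarAlgebra B] [NonUnitalCStarAlgebra D]
      (δ : Coact.FullCoaction G B) (η : Coact.FullCoaction G D) (φ : B →⋆ₙₐ[ℂ] 𝓜(ℂ, D)),
      η.IsNormal → Coact.IsMorphism δ η φ →
      (∀ (C : Type u) [NonUnitalCStarAlgebra C] (ε : Coact.FullCoaction G C), ε.IsNormal →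
        ∀ ψ : B →⋆ₙₐ[ℂ] 𝓜(ℂ, C), Coact.IsMorphism δ ε ψ →
          ∃! θ : D →⋆ₙₐ[ℂ] 𝓜(ℂ, C), Coact.IsMorphism η ε θ ∧ (Coact.bar θ).comp φ = ψ) →
      Set.range φ = Set.range (Coact.incl D) ∧ δ.CrossedMapIsIso η φ) ∧
    (∀ (B : Type u) [NonUnitalCStarAlgebra B] (δ : Coact.FullCoaction G B),
      ∃ δn : Coact.FullCoaction G δ.Normalized,
        (∀ δ' : δ.Normalized →⋆ₙₐ[ℂ]
            𝓜(ℂ, Coact.SpatialTensor δ.Normalized (Coact.GroupAlg G)),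
          (∀ b : B, δ' (δ.qn b) = Coact.bar (Coact.tensorHom ((Coact.incl δ.Normalized).comp δ.qn)
            (Coact.incl (Coact.GroupAlg G))) (δ.δ b)) ↔ δ' = δn.δ) ∧
        δn.IsNormal ∧
        Coact.IsMorphism δ δn ((Coact.incl δ.Normalized).comp δ.qn) ∧
        δ.CrossedMapIsIso δn ((Coact.incl δ.Normalized).comp δ.qn)) := by
  refine ⟨fun B D _ _ δ η φ hη hφ huniv => ?_, fun B _ δ => ?_⟩
  -- The normalization lives in the universe of B, so it is an admissible target in the universal
  -- property.
  · obtain ⟨δn, -, hε, hqm⟩ := δ.exists_normalized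
    exact Coact.IsMorphism.of_universal (Coact.CStarQuotient.mk_surjective δ.jB)
      (fun b => (Coact.CStarQuotient.mk_eq_zero_iff δ.jB b).1) hqm hε hη hφ huniv
  obtain ⟨δn, h1, h2, h3⟩ := δ.exists_normalized
  have hq := Coact.CStarQuotient.mk_surjective δ.jB
  refine ⟨δn, fun δ' => ⟨fun h => NonUnitalStarAlgHom.ext fun n => ?_, fun h b => ?_⟩, h2, h3,
    Coact.FullCoaction.crossedMapIsIso_of_surjective hq h3 fun b =>
      (Coact.CStarQuotient.mk_eq_zero_iff δ.jB b).1⟩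
  · obtain ⟨b, rfl⟩ := hq n
    exact (h b).trans (h1 b).symm
  · rw [h, h1]
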